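/- **Setting.** Let $\mathbb X$ be a Polish space with its Borel $\sigma$-algebra, $\pi_0$ a probability measure on $\mathbb X$, $f$ a probability kernel on $\mathbb X$, and $g_n:\mathbb X\to(0,\infty)$, $n\ge 0$, bounded measurable functions. Put $\pi_{n+1}(A)=\int g_n(x)f(x,A)\,\pi_n(dx)\big/\int g_n\,d\pi_n$, $Q_{n+1}(x,dx')=g_n(x)f(x,dx')$ and $\gamma_n=\pi_0Q_1\cdots Q_n$. Fix a bounded measurable $\varphi:\mathbb X\to\mathbb R$ and an integer $M>1$; $\overline\varphi:=\varphi-\pi_n(\varphi)$, $\overline\varphi^{\otimes2}(x,y)=\overline\varphi(x)\overline\varphi(y)$, $Q_n^{\otimes2}((x,y),d(x',y'))=Q_n(x,dx')Q_n(y,dy')$ and $\pi_0^{\otimes2}=\pi_0\otimes\pi_0$. **Algorithm.** For $N=Mm$, $m\ge1$, and a row-stochastic $N\times N$ matrix $\alpha_N$ (indices $0,\dots,N-1$), let $W_0^i=1$, let $\zeta_0^0,\dots,\zeta_0^{N-1}$ be i.i.d. with law $\pi_0$, and for $n\ge 0$ let $W_{n+1}^i=\sum_j\alpha_N^{ij}W_n^jg_n(\zeta_n^j)$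 and, given $\zeta_0,\dots,\zeta_n$, let the $\zeta_{n+1}^i$ be independent with laws $(W_{n+1}^i)^{-1}\sum_j\alpha_N^{ij}W_n^jg_n(\zeta_n^j)f(\zeta_n^j,\cdot)$. Put $\pi_n^N(\varphi)=\sum_iW_n^i\varphi(\zeta_n^i)/\sum_iW_n^i$. **Hypotheses on the matrices.** There are an integer $\beta\ge1$ and $(\alpha_\infty^{ij})_{i,j\in\mathbb Z}$ such that for all $N=Mm$, $m\ge 1$: $\alpha_N$ is doubly stochastic; $\alpha_N^{ij}=\alpha_N^{(i+zM)\bmod N,\,(j+zM)\bmod N}$ for all $z\in\mathbb Z$; and, if $N\ge2\beta+1$, $\alpha_N^{ij}=0$ whenever $\min_{\ell\in\mathbb Z}|i-j+\ell N|>\beta$, and $\alpha_\infty^{ij}=\alpha_N^{i\bmod N,\,j\bmod N}\,\mathbb I[|i-j|\le\beta]$ for all $i,j\in\mathbb Z$. **Asymptotic variance.** Let $\sigma_0^2=\pi_0((\varphi-\pi_0(\varphi))^2)$ and, for $n\ge1$, $$\sigma_n^2=\frac1{\gamma_n(\mathbf 1)^2M}\sum_{0\le u<M}\ \sum_{|v|\le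 2n\beta}\mathbb E_{u,u+v}\Big[\pi_0^{\otimes2}\,\mathcal C_{\epsilon_0}Q_1^{\otimes2}\mathcal C_{\epsilon_1}\cdots Q_n^{\otimes2}\mathcal C_{\epsilon_n}\big(\overline\varphi^{\otimes2}\big)\Big],$$ where $\mathcal C_0h=h$, $(\mathcal C_1h)(x,y)=h(x,x)$, $\epsilon_k=\mathbb I[I_k=J_k]$, and $\mathbb E_{u,v}$ is the expectation for the backward Markov chain $(I_k,J_k)_{0\le k\le n}$ on $\mathbb Z^2$ with $(I_n,J_n)=(u,v)$ and transition probabilities $\alpha_\infty^{i_{k+1}i_k}\alpha_\infty^{j_{k+1}j_k}$ from $(i_{k+1},j_{k+1})$ at time $k+1$ to $(i_k,j_k)$ at time $k$. **Proposition.** (a) Under these hypotheses, for every $n\ge0$ with $\sigma_n^2>0$ and every real $p\ge1$, $$\lim_{m\to\infty}\sqrt m\;\mathbb E\big[|\pi_n^{Mm}(\varphi)-\pi_n(\varphi)|^p\big]^{1/p}=\frac{\sigma_n}{\sqrt M}\,\sqrt2\,\Big(\frac{\Gamma((p+1)/2)}{\sqrt\pi}\Big)^{1/p}.$$ (b) If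 moreover $\limsup_{n\to\infty}\sigma_n^2=\infty$, then for no $p\ge1$ is $$\sup_{m\ge1}\sup_{n\ge0}\sqrt m\;\mathbb E\big[|\pi_n^{Mm}(\varphi)-\pi_n(\varphi)|^p\big]^{1/p}<\infty .$$ (c) Let $\alpha_N$ be the matrix of the local exchange particle filter (LEPF) with some $\theta\in\{1,\dots,M-1\}$, that is, $\alpha_N^{ij}=M^{-1}\mathbb I[\lfloor i/M\rfloor=\lfloor((j-\theta)\bmod N)/M\rfloor]$, $\alpha_\infty^{ij}=M^{-1}\mathbb I[\lfloor i/M\rfloor=\lfloor(j-\theta)/M\rfloor]$, $\beta=M-1+\theta$; or that of the independent bootstrap particle filters (IBPF), that is, $\alpha_N^{ij}=M^{-1}\mathbb I[\lfloor i/M\rfloor=\lfloor j/M\rfloor]$, $\alpha_\infty^{ij}$ given by the same formula, $\beta=M-1$. Assume $\limsup_{n\to\infty}\sigma_n^2=\infty$ and that there are $\delta,\epsilon\in[1,\infty)$ with $g_n(x)/g_n(y)\le\delta$ and $f(x,\cdot)\le\epsilon f(y,\cdot)$ for all $n\ge 0$ and $x,y\in\mathbb X$. Let $\widetilde W_n^k$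 be the common weight $W_n^i$ of the particles with $\lfloor i/M\rfloor=k$, $0\le k<m$. Then for every $p\ge1$ $$\limsup_{m\to\infty}\ \sup_{n\ge0}\ m^{p/2}\;\mathbb E\left[\left|\sqrt{\sum_{k}\Big(\frac{\widetilde W_n^k}{\sum_{l}\widetilde W_n^l}\Big)^2}\right|^p\right]=\infty .$$ -/

import Mathlib

open MeasureTheory ProbabilityTheory Filter Topology
open scoped ENNReal

noncomputable section

namespace LocalExchange

variable {X : Type*} [MeasurableSpace X]

/-! Filtering model: initial law `π₀`, transition kernel `f`, and potentials `g n x = g(x, yₙ)`. -/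

/-- The prediction filters `πₙ`: `π₀` is the initial law and
`πₙ₊₁(A) = ∫ gₙ(x) f(x, A) πₙ(dx) / ∫ gₙ dπₙ`. -/
def predFilter (π₀ : Measure X) (f : Kernel X X) (g : ℕ → X → ℝ) : ℕ → Measure X
  | 0 => π₀
  | n + 1 =>
    (∫⁻ x, ENNReal.ofReal (g n x) ∂(predFilter π₀ f g n))⁻¹ •
      ((predFilter π₀ f g n).withDensity fun x => ENNReal.ofReal (g n x)).bind f

/-- The unnormalised measures `γₙ = π₀ Q₁ ⋯ Qₙ`, where `Qₙ₊₁(x, A) = gₙ(x) f(x, A)`. -/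
def unnormFilter (π₀ : Measure X) (f : Kernel X X) (g : ℕ → X → ℝ) : ℕ → Measure X
  | 0 => π₀
  | n + 1 => ((unnormFilter π₀ f g n).withDensity fun x => ENNReal.ofReal (g n x)).bind f

/-! The particle algorithm. Particles carry the labels `0, …, N - 1`. -/

/-- The weights along a particle history `z` (`z n j` is particle `j` at time `n`): `W₀ = 1` and
`Wₙ₊₁ⁱ = ∑ⱼ αⁱʲ Wₙʲ gₙ(zₙʲ)`. -/
def weight {N : ℕ} (α : Matrix (Fin N) (Fin N) ℝ) (g : ℕ → X → ℝ) (z : ℕ → Fin N → X) :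
    ℕ → Fin N → ℝ
  | 0 => fun _ => 1
  | n + 1 => fun i => ∑ j, α i j * weight α g z n j * g n (z n j)

/-- The weighted particle approximation `∑ᵢ Wₙⁱ φ(zₙⁱ) / ∑ᵢ Wₙⁱ` of `πₙ(φ)`. -/
def estimate {N : ℕ} (α : Matrix (Fin N) (Fin N) ℝ) (g : ℕ → X → ℝ) (φ : X → ℝ)
    (z : ℕ → Fin N → X) (n : ℕ) : ℝ :=
  (∑ i, weight α g z n i * φ (z n i)) / ∑ i, weight α g z n i

/-- The sampling law of particle `i` at time `n + 1` given the history `z` up to time `n`: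
`(Wₙ₊₁ⁱ)⁻¹ ∑ⱼ αⁱʲ Wₙʲ gₙ(zₙʲ) f(zₙʲ, ·)`. -/
def proposal {N : ℕ} (α : Matrix (Fin N) (Fin N) ℝ) (f : Kernel X X) (g : ℕ → X → ℝ)
    (z : ℕ → Fin N → X) (n : ℕ) (i : Fin N) : Measure X :=
  (ENNReal.ofReal (weight α g z (n + 1) i))⁻¹ •
    ∑ j, ENNReal.ofReal (α i j * weight α g z n j * g n (z n j)) • f (z n j)

/-- The process `ζ` (`ζ n ω i` is particle `i` at time `n`) is produced by the particle algorithm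
with matrix `α`: the initial particles are i.i.d. with law `π₀` and, given `ζ₀, …, ζₙ`, the
particles at time `n + 1` are independent, particle `i` having law `proposal α f g ζ n i`. -/
structure IsParticleSystem [StandardBorelSpace X] [Nonempty X] {N : ℕ} (π₀ : Measure X)
    (f : Kernel X X) (g : ℕ → X → ℝ) (α : Matrix (Fin N) (Fin N) ℝ)
    {Ω : Type*} [MeasurableSpace Ω] (P : Measure Ω) [IsProbabilityMeasure P]
    (ζ : ℕ → Ω → Fin N → X) : Prop where
  measurable : ∀ n, Measurable (ζ n)
  initial : P.map (ζ 0) = Measure.pi fun _ : Fin N => π₀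
  transition : ∀ n, ∀ᵐ ω ∂P,
    condDistrib (ζ (n + 1)) (fun ω' (k : Fin (n + 1)) => ζ k ω') P (fun k => ζ k ω) =
      Measure.pi fun i => proposal α f g (fun k => ζ k ω) n i

/-- The `L_p` norm `𝔼[|πₙᴺ(φ) - πₙ(φ)|^p]^(1/p)` of the approximation error. -/
def lpError {N : ℕ} (π₀ : Measure X) (f : Kernel X X) (g : ℕ → X → ℝ)
    (α : Matrix (Fin N) (Fin N) ℝ) (φ : X → ℝ) {Ω : Type*} [MeasurableSpace Ω] (P : Measure Ω)
    (ζ : ℕ → Ω → Fin N → X) (p : ℝ) (n : ℕ) : ℝ≥0∞ :=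
  eLpNorm (fun ω => estimate α g φ (fun k => ζ k ω) n - ∫ x, φ x ∂(predFilter π₀ f g n))
    (ENNReal.ofReal p) P

/-- The structural hypotheses on the matrices `α m = α_N`, `N = M m`, `m ≥ 1`, with bandwidth `β`
and limiting doubly infinite matrix `αinf`. -/
structure IsLocalInteraction (M β : ℕ) (α : ∀ m : ℕ, Matrix (Fin (M * m)) (Fin (M * m)) ℝ)
    (αinf : ℤ → ℤ → ℝ) : Prop where
  one_le_bandwidth : 1 ≤ β
  doubly_stochastic : ∀ m, 1 ≤ m → α m ∈ doublyStochastic ℝ (Fin (M * m))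
  circulant : ∀ m, 1 ≤ m → ∀ (i j i' j' : Fin (M * m)) (z : ℤ),
    (i' : ℤ) ≡ i + z * M [ZMOD (M * m : ℕ)] → (j' : ℤ) ≡ j + z * M [ZMOD (M * m : ℕ)] →
      α m i j = α m i' j'
  banded : ∀ m, 1 ≤ m → 2 * β + 1 ≤ M * m → ∀ i j : Fin (M * m),
    (∀ l : ℤ, (β : ℤ) < |(i : ℤ) - j + l * (M * m : ℕ)|) → α m i j = 0
  similar : ∀ m, 1 ≤ m → 2 * β + 1 ≤ M * m → ∀ (i j : ℤ) (i' j' : Fin (M * m)),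
    (i' : ℤ) ≡ i [ZMOD (M * m : ℕ)] → (j' : ℤ) ≡ j [ZMOD (M * m : ℕ)] →
      αinf i j = if |i - j| ≤ (β : ℤ) then α m i' j' else 0

/-! The asymptotic variance. -/

/-- The operators `C₀`, `C₁` on functions on `X × X`: `C₀ h = h` and `(C₁ h)(x, y) = h(x, x)`;
here `C₁` is selected when the two labels of `s` coincide. -/
def coalesce (s : ℤ × ℤ) (h : X × X → ℝ) : X × X → ℝ :=
  fun z => if s.1 = s.2 then h (z.1, z.1) else h z

/-- The operator `Qₙ₊₁^{⊗2}`, where `Qₙ₊₁(x, dx') = gₙ(x) f(x, dx')`. -/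
def tensorQ (f : Kernel X X) (g : ℕ → X → ℝ) (n : ℕ) (h : X × X → ℝ) : X × X → ℝ :=
  fun z => g n z.1 * g n z.2 * ∫ z', h z' ∂((f z.1).prod (f z.2))

/-- `C_{ε₀} Q₁^{⊗2} C_{ε₁} ⋯ Qₙ^{⊗2} C_{εₙ} h`, where `εₖ` tells whether the two coordinates of
the path `s` agree at time `k`. -/
def tensorFlow (f : Kernel X X) (g : ℕ → X → ℝ) :
    (n : ℕ) → (Fin (n + 1) → ℤ × ℤ) → (X × X → ℝ) → X × X → ℝ
  | 0, s, h => coalesce (s 0) h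
  | n + 1, s, h =>
    tensorFlow f g n (Fin.init s) (tensorQ f g n (coalesce (s (Fin.last (n + 1))) h))

/-- The probability of the path `s` for the backward chain `(Iₖ, Jₖ)`, `k = n, …, 0`, which is
started from `(Iₙ, Jₙ) = (u, v)` and moves in both coordinates independently according to
`αinf`. -/
def pathProb (αinf : ℤ → ℤ → ℝ) (n : ℕ) (u v : ℤ) (s : Fin (n + 1) → ℤ × ℤ) : ℝ :=
  if s (Fin.last n) = (u, v) then
    ∏ k : Fin n, αinf (s k.succ).1 (s k.castSucc).1 * αinf (s k.succ).2 (s k.castSucc).2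
  else 0

/-- The expectation `𝔼_{u,v}[H((Iₖ, Jₖ)_{0 ≤ k ≤ n})]` for the backward chain. -/
def backwardExp (αinf : ℤ → ℤ → ℝ) (n : ℕ) (u v : ℤ) (H : (Fin (n + 1) → ℤ × ℤ) → ℝ) : ℝ :=
  ∑' s : Fin (n + 1) → ℤ × ℤ, pathProb αinf n u v s * H s

/-- The asymptotic variance `σₙ²`. -/
def asympVar (π₀ : Measure X) (f : Kernel X X) (g : ℕ → X → ℝ) (φ : X → ℝ) (M β : ℕ)
    (αinf : ℤ → ℤ → ℝ) : ℕ → ℝ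
  | 0 => ∫ x, (φ x - ∫ y, φ y ∂π₀) ^ 2 ∂π₀
  | n + 1 =>
    let φbar : X → ℝ := fun x => φ x - ∫ y, φ y ∂(predFilter π₀ f g (n + 1))
    1 / ((unnormFilter π₀ f g (n + 1)).real Set.univ ^ 2 * M) *
      ∑ u ∈ Finset.range M,
        ∑ v ∈ Finset.Icc (-(2 * (n + 1) * β : ℤ)) (2 * (n + 1) * β),
          backwardExp αinf (n + 1) u (u + v) fun s =>
            ∫ z, tensorFlow f g (n + 1) s (fun w => φbar w.1 * φbar w.2) z ∂(π₀.prod π₀)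

/-- The mixing condition: for some `δ, ε ∈ [1, ∞)`, `gₙ(x) / gₙ(y) ≤ δ` and
`f(x, ·) ≤ ε f(y, ·)` for all `n`, `x`, `y`. -/
def Mixing (f : Kernel X X) (g : ℕ → X → ℝ) : Prop :=
  ∃ δ ε : ℝ, 1 ≤ δ ∧ 1 ≤ ε ∧ (∀ n x y, g n x / g n y ≤ δ) ∧
    ∀ x y, f x ≤ ENNReal.ofReal ε • f y

/-! The local exchange particle filter (LEPF) and the independent bootstrap particle filters
(IBPF). The group of the particle with label `i` is `⌊i / M⌋`. -/

/-- The LEPF matrix of size `M m`: particle `i` may descend from `j` iff `(j - θ) mod M m` lies in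
the group of `i`. -/
def lepfMatrix (M θ m : ℕ) : Matrix (Fin (M * m)) (Fin (M * m)) ℝ :=
  fun i j => if (i : ℤ) / M = (((j : ℤ) - θ) % (M * m : ℕ)) / M then (M : ℝ)⁻¹ else 0

/-- The limiting doubly infinite LEPF matrix. -/
def lepfLimit (M θ : ℕ) : ℤ → ℤ → ℝ :=
  fun i j => if i / M = (j - θ) / M then (M : ℝ)⁻¹ else 0

/-- The IBPF matrix of size `M m`: ancestors are chosen inside the group. -/
def ibpfMatrix (M m : ℕ) : Matrix (Fin (M * m)) (Fin (M * m)) ℝ :=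
  fun i j => if (i : ℤ) / M = (j : ℤ) / M then (M : ℝ)⁻¹ else 0

/-- The limiting doubly infinite IBPF matrix. -/
def ibpfLimit (M : ℕ) : ℤ → ℤ → ℝ :=
  fun i j => if i / M = j / M then (M : ℝ)⁻¹ else 0

/-- The common weight of the particles in group `k`, read off from its first member `M k`. -/
def groupWeight {M m : ℕ} (hM : 0 < M) (α : Matrix (Fin (M * m)) (Fin (M * m)) ℝ)
    (g : ℕ → X → ℝ) (z : ℕ → Fin (M * m) → X) (n : ℕ) (k : Fin m) : ℝ :=
  weight α g z n ⟨M * k, Nat.mul_lt_mul_of_pos_left k.2 hM⟩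

/-- If the rows of `α` agree within groups, as for the LEPF and the IBPF, then so do the
weights. -/
theorem weight_eq_groupWeight {Y : Type*} {M m : ℕ} (hM : 0 < M) (α : Matrix (Fin (M * m)) (Fin (M * m)) ℝ)
    (hα : ∀ i i' : Fin (M * m), (i : ℤ) / M = (i' : ℤ) / M → α i = α i')
    (g : ℕ → Y → ℝ) (z : ℕ → Fin (M * m) → Y) (n : ℕ) (i : Fin (M * m)) (k : Fin m)
    (hk : (i : ℕ) / M = k) : weight α g z n i = groupWeight hM α g z n k := by
  cases n with
  | zero => rfl
  | succ n =>
    have h : α i = α ⟨M * k, Nat.mul_lt_mul_of_pos_left k.2 hM⟩ := by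
      apply hα
      norm_cast
      rw [hk, Nat.mul_div_cancel_left _ hM]
    simp only [groupWeight, weight, h]

/-- `m^{p/2} 𝔼[|√(∑ₖ (W̃ᵏ / ∑ₗ W̃ˡ)²)|^p]`, where `W̃ᵏ` is the weight of group `k` at time `n`. -/
def scaledWeightMoment {M m : ℕ} (hM : 0 < M) (α : Matrix (Fin (M * m)) (Fin (M * m)) ℝ)
    (g : ℕ → X → ℝ) {Ω : Type*} [MeasurableSpace Ω] (P : Measure Ω)
    (ζ : ℕ → Ω → Fin (M * m) → X) (p : ℝ) (n : ℕ) : ℝ≥0∞ :=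
  ENNReal.ofReal ((m : ℝ) ^ (p / 2)) *
    ∫⁻ ω, ENNReal.ofReal
      (|√(∑ k, (groupWeight hM α g (fun t => ζ t ω) n k /
          ∑ l, groupWeight hM α g (fun t => ζ t ω) n l) ^ 2)| ^ p) ∂P

end LocalExchange

end

/-!
The argument studies the weighted sums `∑ᵢ Wₙⁱ h(ζₙⁱ)` one time step at a time. The columns of the
matrix sum to one, so the conditional mean of such a sum given the preceding generation is the sum
for the propagated function `Qₙ h` (`sum_weight_mul_integral_proposal`), and given that generation
the terms are independent. No independence between distant particles is needed.

*Central limit theorem.* The characteristic function of a normalised weighted sum of a centred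
function is handled by induction on time (`exists_norm_charFun_sub_le`). One step is a conditional
central limit theorem. Its conditional variance is a quadratic statistic of the preceding generation
whose kernel is dominated by a doubly stochastic matrix, and such statistics concentrate
(`IsParticleSystem.integral_pairSum_sub_sq_le`). Hence the sum is nearly Gaussian with its own
variance, which is computed by following pairs of genealogies backwards: for large `m` these do not
wrap around the cycle of labels, distant pairs contribute zero, and the second moment is exactly
`N γₙ(1)² σₙ²` (`IsParticleSystem.integral_weightedSum_sq_eq_asympVar`). Hoeffding's inequality
gives exponential moments that are uniform in `N`, so all `L_p` norms converge. The denominator is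
linearised (`abs_sqrt_mul_div_sub_le`), which gives the limit `tendsto_sqrt_mul_lpError`; a bound on
the errors that is uniform in time then bounds all asymptotic variances
(`limsup_asympVar_ne_top`).

*Degeneracy of the weights.* Suppose that the moments of the inverse effective sample size are
bounded. Write the error as a telescoping sum of the ratios obtained by propagating numerator and
denominator backwards. Each increment has conditional mean zero up to its denominator, so it is
bounded by the inverse effective sample size times the range of the ratio, and by Doeblin's argument
this range decreases geometrically (`IsBoundedRatio.propagate`). Thus the mean error is of order
`m ^ (-1 / 2)` uniformly in time (`IsParticleSystem.integral_abs_ratio_sub_le`), which contradicts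
`limsup_asympVar_ne_top` if the asymptotic variances are unbounded. The independent filters are the
case `θ = 0` of local exchange, and `isLocalInteraction_lepf` verifies the structural hypotheses for
every `θ`.
-/


namespace LocalExchange

/-! ### Sums of functions of independent variables -/

theorem integrable_of_bounded {Y E : Type*} [MeasurableSpace Y] [NormedAddCommGroup E]
    [MeasurableSpace E] [BorelSpace E] [SecondCountableTopology E] {μ : Measure Y}
    [IsFiniteMeasure μ] {h : Y → E} (hm : Measurable h) {B : ℝ} (hB : ∀ y, ‖h y‖ ≤ B) :
    Integrable h μ :=
  Integrable.of_bound hm.aestronglyMeasurable B (ae_of_all _ hB)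

theorem memLp_of_bounded {Y : Type*} [MeasurableSpace Y] {μ : Measure Y} [IsFiniteMeasure μ]
    {h : Y → ℝ} (hm : Measurable h) {B : ℝ} (hB : ∀ y, |h y| ≤ B) (p : ℝ≥0∞) : MemLp h p μ :=
  MemLp.of_bound hm.aestronglyMeasurable B (ae_of_all _ hB)

theorem abs_integral_le_of_bounded {Y : Type*} [MeasurableSpace Y] {μ : Measure Y}
    [IsProbabilityMeasure μ] {h : Y → ℝ} {B : ℝ} (hB : ∀ y, |h y| ≤ B) :
    |∫ y, h y ∂μ| ≤ B := by
  simpa using norm_integral_le_of_norm_le_const (μ := μ) (f := h) (ae_of_all _ hB)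

theorem norm_prod_sub_prod_le {ι : Type*} (s : Finset ι) (a b : ι → ℂ)
    (ha : ∀ i ∈ s, ‖a i‖ ≤ 1) (hb : ∀ i ∈ s, ‖b i‖ ≤ 1) :
    ‖∏ i ∈ s, a i - ∏ i ∈ s, b i‖ ≤ ∑ i ∈ s, ‖a i - b i‖ := by
  classical
  induction s using Finset.induction_on with
  | empty => simp
  | insert i s hi ih =>
    rw [Finset.prod_insert hi, Finset.prod_insert hi, Finset.sum_insert hi]
    have h1 : ‖∏ j ∈ s, a j‖ ≤ 1 := by
      rw [norm_prod]
      exact Finset.prod_le_one (fun _ _ => norm_nonneg _)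
        fun j hj => ha j (Finset.mem_insert_of_mem hj)
    have h2 := ih (fun j hj => ha j (Finset.mem_insert_of_mem hj))
      fun j hj => hb j (Finset.mem_insert_of_mem hj)
    have h3 := hb i (Finset.mem_insert_self i s)
    calc ‖a i * ∏ j ∈ s, a j - b i * ∏ j ∈ s, b j‖
        = ‖(a i - b i) * ∏ j ∈ s, a j + b i * (∏ j ∈ s, a j - ∏ j ∈ s, b j)‖ := by ring_nf
      _ ≤ ‖a i - b i‖ * ‖∏ j ∈ s, a j‖ + ‖b i‖ * ‖∏ j ∈ s, a j - ∏ j ∈ s, b j‖ := by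
          refine (norm_add_le _ _).trans ?_
          rw [norm_mul, norm_mul]
      _ ≤ ‖a i - b i‖ * 1 + 1 * ∑ j ∈ s, ‖a j - b j‖ := by gcongr
      _ = _ := by ring

/-- The remainder in the second order expansion of the characteristic function of a variable
bounded by `D`. -/
noncomputable def charFunRemainder (D : ℝ) : ℝ :=
  (2 * D) ^ 3 * Real.exp (2 * D) + (D ^ 2) ^ 2 * Real.exp (D ^ 2)

/-- A bounded variable and the Gaussian law with the same mean and variance have close
characteristic functions, with an error of third order in the bound. -/
theorem norm_integral_exp_sub_exp_le {Y : Type*} [MeasurableSpace Y] {μ : Measure Y}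
    [IsProbabilityMeasure μ] {h : Y → ℝ} (hm : Measurable h) {D : ℝ} (hD : ∀ y, |h y| ≤ D) :
    ‖∫ y, Complex.exp (h y * Complex.I) ∂μ -
      Complex.exp ((∫ y, h y ∂μ : ℝ) * Complex.I - (Var[h; μ] / 2 : ℝ))‖ ≤ charFunRemainder D := by
  set m := ∫ y, h y ∂μ with hm_def
  set v := Var[h; μ] with hv_def
  have hD0 : 0 ≤ D := by
    have : Nonempty Y := nonempty_of_isProbabilityMeasure μ
    exact (abs_nonneg _).trans (hD (Classical.arbitrary Y))
  have hmD : |m| ≤ D := abs_integral_le_of_bounded hD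
  have hc : ∀ y, |h y - m| ≤ 2 * D := fun y =>
    (abs_sub _ _).trans (by linarith [hD y])
  have hv0 : 0 ≤ v := variance_nonneg _ _
  have hvD : v ≤ D ^ 2 := by
    refine (variance_le_expectation_sq hm.aestronglyMeasurable).trans ?_
    refine (le_abs_self _).trans (abs_integral_le_of_bounded fun y => ?_)
    simp only [Pi.pow_apply, abs_pow]
    exact pow_le_pow_left₀ (abs_nonneg _) (hD y) 2
  have hv : v = ∫ y, (h y - m) ^ 2 ∂μ := variance_eq_integral hm.aemeasurable
  have e1 : ∫ y, Complex.exp (h y * Complex.I) ∂μ =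
      Complex.exp (m * Complex.I) * ∫ y, Complex.exp ((h y - m : ℝ) * Complex.I) ∂μ := by
    rw [← integral_const_mul]
    congr 1 with y
    rw [← Complex.exp_add]
    push_cast
    ring_nf
  have e2 : Complex.exp ((m : ℂ) * Complex.I - (v / 2 : ℝ)) =
      Complex.exp (m * Complex.I) * Complex.exp (-(v / 2 : ℝ)) := by
    rw [← Complex.exp_add]; ring_nf
  rw [e1, e2, ← mul_sub, norm_mul, Complex.norm_exp_ofReal_mul_I, one_mul]
  -- Both sides are compared with `1 - v / 2`.
  have i1 : Integrable (fun y => Complex.exp ((h y - m : ℝ) * Complex.I)) μ := by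
    refine integrable_of_bounded (B := 1) (by fun_prop) fun y => ?_
    rw [Complex.norm_exp_ofReal_mul_I]
  have i2 : Integrable (fun y => ((h y - m : ℝ) : ℂ)) μ := by
    refine integrable_of_bounded (B := 2 * D) (by fun_prop) fun y => ?_
    rw [Complex.norm_real]; exact hc y
  have i3 : Integrable (fun y => (((h y - m) ^ 2 : ℝ) : ℂ)) μ := by
    refine integrable_of_bounded (B := (2 * D) ^ 2) (by fun_prop) fun y => ?_
    rw [Complex.norm_real, Real.norm_eq_abs, abs_pow]
    exact pow_le_pow_left₀ (abs_nonneg _) (hc y) 2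
  have i4 : Integrable (fun y => 1 + ((h y - m : ℝ) : ℂ) * Complex.I) μ :=
    (integrable_const _).add (i2.mul_const _)
  have i5 : Integrable (fun y => 1 + ((h y - m : ℝ) : ℂ) * Complex.I
      - (((h y - m) ^ 2 : ℝ) : ℂ) / 2) μ := i4.sub (i3.div_const _)
  have s1 : ‖∫ y, Complex.exp ((h y - m : ℝ) * Complex.I) ∂μ - (1 - v / 2)‖ ≤
      (2 * D) ^ 3 * Real.exp (2 * D) := by
    have : (1 - v / 2 : ℂ) = ∫ y, (1 + ((h y - m : ℝ) : ℂ) * Complex.I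
        - (((h y - m) ^ 2 : ℝ) : ℂ) / 2) ∂μ := by
      rw [integral_sub i4 (i3.div_const _),
        integral_add (integrable_const _) (i2.mul_const _), integral_mul_const, integral_div,
        integral_complex_ofReal, integral_complex_ofReal, ← hv,
        integral_sub (integrable_of_bounded hm hD) (integrable_const _)]
      simp [hm_def]
    rw [this, ← integral_sub i1 i5]
    refine (norm_integral_le_of_norm_le_const (C := (2 * D) ^ 3 * Real.exp (2 * D))
      (ae_of_all _ fun y => ?_)).trans (by simp)
    have := Complex.norm_exp_sub_sum_le_norm_mul_exp ((h y - m : ℝ) * Complex.I) 3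
    have n1 : ‖((h y - m : ℝ) : ℂ) * Complex.I‖ = |h y - m| := by
      rw [norm_mul, Complex.norm_I, mul_one, Complex.norm_real, Real.norm_eq_abs]
    rw [n1] at this
    have hs : ∑ k ∈ Finset.range 3, (((h y - m : ℝ) : ℂ) * Complex.I) ^ k / (k.factorial : ℂ) =
        1 + ((h y - m : ℝ) : ℂ) * Complex.I - (((h y - m) ^ 2 : ℝ) : ℂ) / 2 := by
      simp [Finset.sum_range_succ, mul_pow, Nat.factorial]
      ring
    rw [hs] at this
    refine this.trans ?_
    gcongr <;> exact hc y
  have s2 : ‖(1 - v / 2 : ℂ) - Complex.exp (-(v / 2 : ℝ))‖ ≤ (D ^ 2) ^ 2 * Real.exp (D ^ 2) := by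
    have := Complex.norm_exp_sub_sum_le_norm_mul_exp (-(v / 2 : ℝ) : ℂ) 2
    have n1 : ‖(-(v / 2 : ℝ) : ℂ)‖ = v / 2 := by
      rw [norm_neg, Complex.norm_real, Real.norm_of_nonneg (by positivity)]
    rw [n1] at this
    have hs : ∑ k ∈ Finset.range 2, (-(v / 2 : ℝ) : ℂ) ^ k / (k.factorial : ℂ) = 1 - v / 2 := by
      simp [Finset.sum_range_succ]
      ring
    rw [hs, norm_sub_rev] at this
    refine this.trans ?_
    gcongr <;> linarith
  calc _ = ‖(∫ y, Complex.exp ((h y - m : ℝ) * Complex.I) ∂μ - (1 - v / 2)) +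
        ((1 - v / 2 : ℂ) - Complex.exp (-(v / 2 : ℝ)))‖ := by
        rw [sub_add_sub_cancel]
    _ ≤ _ := (norm_add_le _ _).trans (add_le_add s1 s2)

variable {ι X : Type*} [Fintype ι] [MeasurableSpace X]

/-- Gaussian approximation of the characteristic function of a sum of independent variables. -/
theorem norm_integral_pi_exp_sub_exp_le (μ : ι → Measure X) [∀ i, IsProbabilityMeasure (μ i)]
    {h : ι → X → ℝ} (hm : ∀ i, Measurable (h i)) {D : ℝ} (hD : ∀ i y, |h i y| ≤ D) :
    ‖∫ y, Complex.exp ((∑ i, h i (y i) : ℝ) * Complex.I) ∂(Measure.pi μ) -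
      Complex.exp ((∑ i, ∫ y, h i y ∂μ i : ℝ) * Complex.I -
        ((∑ i, Var[h i; μ i]) / 2 : ℝ))‖ ≤ Fintype.card ι * charFunRemainder D := by
  have e1 : ∀ y : ι → X, Complex.exp ((∑ i, h i (y i) : ℝ) * Complex.I) =
      ∏ i, Complex.exp (h i (y i) * Complex.I) := fun y => by
    rw [← Complex.exp_sum, Complex.ofReal_sum, Finset.sum_mul]
  have e2 : Complex.exp ((∑ i, ∫ y, h i y ∂μ i : ℝ) * Complex.I -
        ((∑ i, Var[h i; μ i]) / 2 : ℝ)) =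
      ∏ i, Complex.exp ((∫ y, h i y ∂μ i : ℝ) * Complex.I - (Var[h i; μ i] / 2 : ℝ)) := by
    rw [← Complex.exp_sum, Finset.sum_sub_distrib, Finset.sum_div, Complex.ofReal_sum,
      Complex.ofReal_sum, Finset.sum_mul]
  simp_rw [e1]
  rw [e2, integral_fintype_prod_eq_prod (fun i (y : X) => Complex.exp (h i y * Complex.I))]
  refine (norm_prod_sub_prod_le _ _ _ ?_ ?_).trans ?_
  · intro i _
    refine (norm_integral_le_of_norm_le_const (C := 1) (ae_of_all _ fun y => ?_)).trans (by simp)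
    rw [Complex.norm_exp_ofReal_mul_I]
  · intro i _
    rw [Complex.norm_exp]
    have : 0 ≤ Var[h i; μ i] := variance_nonneg _ _
    simp only [Complex.sub_re, Complex.mul_re, Complex.ofReal_re, Complex.I_re, mul_zero,
      Complex.ofReal_im, Complex.I_im, zero_mul, sub_zero, Real.exp_le_one_iff]
    linarith
  · refine (Finset.sum_le_sum fun i _ => norm_integral_exp_sub_exp_le (hm i) (hD i)).trans ?_
    simp

/-- Hoeffding's bound for the exponential moment of a sum of independent bounded variables. -/
theorem integral_pi_exp_sum_le (μ : ι → Measure X) [∀ i, IsProbabilityMeasure (μ i)]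
    {h : ι → X → ℝ} (hm : ∀ i, Measurable (h i)) {D : ℝ} (hD : ∀ i y, |h i y| ≤ D) :
    ∫ y, Real.exp (∑ i, h i (y i)) ∂(Measure.pi μ) ≤
      Real.exp (∑ i, ∫ y, h i y ∂μ i + Fintype.card ι * (D ^ 2 / 2)) := by
  simp_rw [Real.exp_sum]
  rw [integral_fintype_prod_eq_prod (fun i (y : X) => Real.exp (h i y))]
  have : ∀ i, ∫ y, Real.exp (h i y) ∂μ i ≤ Real.exp (∫ y, h i y ∂μ i + D ^ 2 / 2) := by
    intro i
    have hs := (hasSubgaussianMGF_of_mem_Icc (μ := μ i) (hm i).aemeasurable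
      (ae_of_all _ fun y => abs_le.1 (hD i y))).mgf_le 1
    have hD0 : 0 ≤ D := by
      have : Nonempty X := nonempty_of_isProbabilityMeasure (μ i)
      exact (abs_nonneg _).trans (hD i (Classical.arbitrary X))
    simp only [mgf, one_mul, Real.exp_sub, integral_div] at hs
    rw [div_le_iff₀ (Real.exp_pos _), ← Real.exp_add] at hs
    refine hs.trans (le_of_eq ?_)
    congr 1
    simp only [NNReal.coe_pow, NNReal.coe_div, coe_nnnorm, Real.norm_eq_abs, NNReal.coe_ofNat]
    rw [abs_of_nonneg (by linarith)]
    ring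
  refine (Finset.prod_le_prod (fun i _ => integral_nonneg fun y => (Real.exp_pos _).le)
    fun i _ => this i).trans (le_of_eq ?_)
  rw [← Real.exp_sum, Finset.sum_add_distrib]
  simp

/-- A double sum over independent variables has variance of the order of the number of variables
if its kernel is dominated by a doubly stochastic matrix: two terms are uncorrelated unless they
share a variable. -/
theorem variance_pi_sum_sum_le [DecidableEq ι] (μ : ι → Measure X)
    [∀ i, IsProbabilityMeasure (μ i)] {c : Matrix ι ι ℝ} (hc : c ∈ doublyStochastic ℝ ι)
    {F : ι → ι → X × X → ℝ} (hm : ∀ i l, Measurable (F i l)) {B : ℝ}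
    (hB : ∀ i l z, |F i l z| ≤ B * c i l) :
    Var[fun y => ∑ i, ∑ l, F i l (y i, y l); Measure.pi μ] ≤ 16 * B ^ 2 * Fintype.card ι := by
  have hc0 : ∀ i l, 0 ≤ c i l := fun i l => nonneg_of_mem_doublyStochastic hc
  have hrow := sum_row_of_mem_doublyStochastic hc
  have hcol := sum_col_of_mem_doublyStochastic hc
  set G : ι × ι → (ι → X) → ℝ := fun p y => F p.1 p.2 (y p.1, y p.2) with hG
  have hGm : ∀ p, Measurable (G p) := fun p => (hm p.1 p.2).comp (by fun_prop)
  have hGB : ∀ p y, |G p y| ≤ B * c p.1 p.2 := fun p y => hB _ _ _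
  have hGL : ∀ p, MemLp (G p) 2 (Measure.pi μ) := fun p => memLp_of_bounded (hGm p) (hGB p) 2
  have e : (fun y : ι → X => ∑ i, ∑ l, F i l (y i, y l)) = fun y => ∑ p, G p y := by
    ext y
    rw [Fintype.sum_prod_type]
  have hcov : ∀ p q : ι × ι, cov[G p, G q; Measure.pi μ] ≤ 4 * B ^ 2 * (c p.1 p.2 * c q.1 q.2) := by
    intro p q
    have hc1 : ∀ p y, |G p y - ∫ z, G p z ∂Measure.pi μ| ≤ 2 * (B * c p.1 p.2) := fun p y => by
      have := abs_integral_le_of_bounded (μ := Measure.pi μ) (hGB p)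
      exact (abs_sub _ _).trans (by linarith [hGB p y])
    refine (le_abs_self _).trans ((abs_integral_le_of_bounded
      (B := (2 * (B * c p.1 p.2)) * (2 * (B * c q.1 q.2))) fun y => ?_).trans (le_of_eq (by ring)))
    rw [abs_mul]
    exact mul_le_mul (hc1 p y) (hc1 q y) (abs_nonneg _) ((abs_nonneg _).trans (hc1 p y))
  have hind : iIndepFun (fun i (y : ι → X) => y i) (Measure.pi μ) :=
    iIndepFun_pi (X := fun _ x => x) fun i => aemeasurable_id
  have hcov0 : ∀ p q : ι × ι, p.1 ≠ q.1 → p.1 ≠ q.2 → p.2 ≠ q.1 → p.2 ≠ q.2 →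
      cov[G p, G q; Measure.pi μ] = 0 := by
    intro p q h1 h2 h3 h4
    have := (hind.indepFun_prodMk_prodMk (fun i => measurable_pi_apply i) p.1 p.2 q.1 q.2
      h1 h2 h3 h4).comp (hm p.1 p.2) (hm q.1 q.2)
    exact this.covariance_eq_zero (hGL p) (hGL q)
  -- The bound on a covariance, restricted to the pairs of terms that share a variable.
  have hcov' : ∀ p q : ι × ι, cov[G p, G q; Measure.pi μ] ≤ 4 * B ^ 2 * c p.1 p.2 *
      ((if q.1 = p.1 then c q.1 q.2 else 0) + (if q.2 = p.1 then c q.1 q.2 else 0) +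
       (if q.1 = p.2 then c q.1 q.2 else 0) + (if q.2 = p.2 then c q.1 q.2 else 0)) := by
    intro p q
    have k1 : ∀ (P : Prop) [Decidable P], 0 ≤ if P then c q.1 q.2 else 0 := fun P _ => by
      split_ifs <;> simp [hc0]
    by_cases h : p.1 ≠ q.1 ∧ p.1 ≠ q.2 ∧ p.2 ≠ q.1 ∧ p.2 ≠ q.2
    · rw [hcov0 p q h.1 h.2.1 h.2.2.1 h.2.2.2]
      have := hc0 p.1 p.2
      have := k1 (q.1 = p.1)
      have := k1 (q.2 = p.1)
      have := k1 (q.1 = p.2)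
      have := k1 (q.2 = p.2)
      positivity
    · refine (hcov p q).trans ?_
      rw [← mul_assoc]
      have := hc0 p.1 p.2
      refine mul_le_mul_of_nonneg_left ?_ (by positivity)
      have h1 := k1 (q.1 = p.1)
      have h2 := k1 (q.2 = p.1)
      have h3 := k1 (q.1 = p.2)
      have h4 := k1 (q.2 = p.2)
      have : p.1 = q.1 ∨ p.1 = q.2 ∨ p.2 = q.1 ∨ p.2 = q.2 := by tauto
      rcases this with h | h | h | h
      · rw [if_pos h.symm] at h1 ⊢; linarith
      · rw [if_pos h.symm] at h2 ⊢; linarith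
      · rw [if_pos h.symm] at h3 ⊢; linarith
      · rw [if_pos h.symm] at h4 ⊢; linarith
  rw [e, variance_fun_sum hGL]
  refine (Finset.sum_le_sum fun p _ => Finset.sum_le_sum fun q _ => hcov' p q).trans ?_
  have hs1 : ∀ a, ∑ q : ι × ι, (if q.1 = a then c q.1 q.2 else 0) = 1 := fun a => by
    rw [Fintype.sum_prod_type, Finset.sum_eq_single a]
    · simpa using hrow a
    · intro b _ hb; simp [hb]
    · simp
  have hs2 : ∀ a, ∑ q : ι × ι, (if q.2 = a then c q.1 q.2 else 0) = 1 := fun a => by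
    rw [Fintype.sum_prod_type]
    simpa using hcol a
  simp_rw [← Finset.mul_sum, Finset.sum_add_distrib, hs1, hs2]
  rw [← Finset.sum_mul, ← Finset.mul_sum, Fintype.sum_prod_type]
  simp only [hrow, Finset.sum_const, Finset.card_univ, nsmul_eq_mul]
  exact le_of_eq (by ring)

end LocalExchange

namespace LocalExchange

/-! ### Convergence of absolute moments to those of a Gaussian law -/

theorem exists_rpow_abs_le_exp (q : ℝ) (hq : 0 ≤ q) :
    ∃ C : ℝ, 0 ≤ C ∧ ∀ x : ℝ, |x| ^ q ≤ C * (Real.exp x + Real.exp (-x)) := by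
  refine ⟨1 + (⌈q⌉₊.factorial : ℝ), by positivity, fun x => ?_⟩
  have h1 : |x| ^ q ≤ 1 + |x| ^ ⌈q⌉₊ := by
    rcases le_total |x| 1 with h | h
    · have := Real.rpow_le_one (abs_nonneg x) h hq
      have : 0 ≤ |x| ^ ⌈q⌉₊ := by positivity
      linarith
    · have := Real.rpow_le_rpow_of_exponent_le h (Nat.le_ceil q)
      rw [Real.rpow_natCast] at this
      linarith
  have h2 : |x| ^ ⌈q⌉₊ ≤ ⌈q⌉₊.factorial * Real.exp |x| := by
    have := Real.pow_div_factorial_le_exp |x| (abs_nonneg x) ⌈q⌉₊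
    rwa [div_le_iff₀ (by positivity), mul_comm] at this
  have h3 : 1 ≤ Real.exp |x| := Real.one_le_exp (abs_nonneg x)
  have h4 : Real.exp |x| ≤ Real.exp x + Real.exp (-x) := by
    have := Real.exp_pos x
    have := Real.exp_pos (-x)
    rcases abs_choice x with h | h <;> rw [h] <;> linarith
  calc |x| ^ q ≤ (1 + ⌈q⌉₊.factorial) * Real.exp |x| := by linarith
    _ ≤ _ := by gcongr

/-- `X` has exponential moments of both signs, bounded by `K`. -/
structure HasExpBound {Ω : Type*} [MeasurableSpace Ω] (X : Ω → ℝ) (P : Measure Ω) (K : ℝ) :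
    Prop where
  measurable : Measurable X
  integrable_exp : Integrable (fun ω => Real.exp (X ω)) P
  integrable_exp_neg : Integrable (fun ω => Real.exp (-X ω)) P
  integral_exp_le : ∫ ω, Real.exp (X ω) ∂P ≤ K
  integral_exp_neg_le : ∫ ω, Real.exp (-X ω) ∂P ≤ K

theorem HasExpBound.integrable_rpow {Ω : Type*} [MeasurableSpace Ω] {X : Ω → ℝ} {P : Measure Ω}
    {K : ℝ} (h : HasExpBound X P K) {q : ℝ} (hq : 0 ≤ q) : Integrable (fun ω => |X ω| ^ q) P := by
  obtain ⟨C, -, hC⟩ := exists_rpow_abs_le_exp q hq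
  have hm := h.measurable
  refine ((h.integrable_exp.add h.integrable_exp_neg).const_mul C).mono'
    (by fun_prop) (ae_of_all _ fun ω => ?_)
  rw [Real.norm_of_nonneg (by positivity)]
  exact hC _

/-- Bounded exponential moments bound all absolute moments. -/
theorem exists_integral_rpow_le (q : ℝ) (hq : 0 ≤ q) (K : ℝ) : ∃ L : ℝ, 0 ≤ L ∧
    ∀ {Ω : Type*} [MeasurableSpace Ω] (X : Ω → ℝ) (P : Measure Ω),
      HasExpBound X P K → ∫ ω, |X ω| ^ q ∂P ≤ L := by
  obtain ⟨C, hC0, hC⟩ := exists_rpow_abs_le_exp q hq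
  refine ⟨C * (|K| + |K|), by positivity, fun X P h => ?_⟩
  calc ∫ ω, |X ω| ^ q ∂P ≤ ∫ ω, C * (Real.exp (X ω) + Real.exp (-X ω)) ∂P :=
        integral_mono (h.integrable_rpow hq)
          ((h.integrable_exp.add h.integrable_exp_neg).const_mul C) fun ω => hC _
    _ = C * (∫ ω, Real.exp (X ω) ∂P + ∫ ω, Real.exp (-X ω) ∂P) := by
        rw [integral_const_mul, integral_add h.integrable_exp h.integrable_exp_neg]
    _ ≤ C * (|K| + |K|) := by
        have := h.integral_exp_le.trans (le_abs_self K)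
        have := h.integral_exp_neg_le.trans (le_abs_self K)
        gcongr

theorem HasExpBound.memLp {Ω : Type*} [MeasurableSpace Ω] {X : Ω → ℝ} {P : Measure Ω}
    {K : ℝ} (h : HasExpBound X P K) {q : ℝ} (hq : 0 < q) : MemLp X (ENNReal.ofReal q) P := by
  rw [← integrable_norm_rpow_iff h.measurable.aestronglyMeasurable (by simpa using hq) (by simp),
    ENNReal.toReal_ofReal hq.le]
  exact h.integrable_rpow hq.le

theorem HasExpBound.eLpNorm_eq {Ω : Type*} [MeasurableSpace Ω] {X : Ω → ℝ} {P : Measure Ω}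
    {K : ℝ} (h : HasExpBound X P K) {q : ℝ} (hq : 0 < q) :
    eLpNorm X (ENNReal.ofReal q) P = ENNReal.ofReal ((∫ ω, |X ω| ^ q ∂P) ^ (1 / q)) := by
  rw [MemLp.eLpNorm_eq_integral_rpow_norm (by simpa using hq) (by simp) (h.memLp hq),
    ENNReal.toReal_ofReal hq.le, one_div]
  rfl

theorem exists_eLpNorm_le (q : ℝ) (hq : 0 < q) (K : ℝ) : ∃ L : ℝ, 0 ≤ L ∧
    ∀ {Ω : Type*} [MeasurableSpace Ω] (X : Ω → ℝ) (P : Measure Ω),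
      HasExpBound X P K → eLpNorm X (ENNReal.ofReal q) P ≤ ENNReal.ofReal L := by
  obtain ⟨L, hL0, hL⟩ := exists_integral_rpow_le q hq.le K
  refine ⟨L ^ (1 / q), by positivity, fun X P h => ?_⟩
  rw [h.eLpNorm_eq hq]
  gcongr
  exact hL X P h

theorem integral_rpow_abs_gaussianReal {v : NNReal} (hv : v ≠ 0) {p : ℝ} (hp : 1 ≤ p) :
    ∫ x, |x| ^ p ∂(gaussianReal 0 v) =
      (2 * (v : ℝ)) ^ (p / 2) * (Real.Gamma ((p + 1) / 2) / √Real.pi) := by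
  have hv0 : (0 : ℝ) < v := by positivity
  rw [integral_gaussianReal_eq_integral_smul hv]
  have e : ∀ x : ℝ, gaussianPDFReal 0 v x • |x| ^ p =
      (fun y : ℝ => (√(2 * Real.pi * v))⁻¹ * (y ^ p * Real.exp (-(2 * (v : ℝ))⁻¹ * y ^ (2 : ℝ))))
        |x| := by
    intro x
    simp only [gaussianPDFReal, sub_zero, smul_eq_mul, Real.rpow_two, sq_abs]
    rw [show -(2 * (v : ℝ))⁻¹ * x ^ 2 = -x ^ 2 / (2 * v) by ring]
    ring
  rw [integral_congr_ae (ae_of_all _ e), integral_comp_abs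
    (f := fun y : ℝ => (√(2 * Real.pi * v))⁻¹ *
      (y ^ p * Real.exp (-(2 * (v : ℝ))⁻¹ * y ^ (2 : ℝ)))), integral_const_mul,
    integral_rpow_mul_exp_neg_mul_rpow (by norm_num) (by linarith) (by positivity),
    Real.inv_rpow (by positivity), ← Real.rpow_neg (by positivity),
    show -(-(p + 1) / 2) = p / 2 + 1 / 2 by ring, Real.rpow_add (by positivity),
    ← Real.sqrt_eq_rpow, show 2 * Real.pi * (v : ℝ) = (2 * v) * Real.pi by ring,
    Real.sqrt_mul (by positivity)]
  have : √(2 * (v : ℝ)) ≠ 0 := by positivity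
  have : √Real.pi ≠ 0 := by positivity
  field_simp

theorem hasExpBound_gaussianReal (v : NNReal) :
    HasExpBound id (gaussianReal 0 v) (Real.exp (v / 2)) := by
  have h := mgf_gaussianReal (p := gaussianReal 0 v) (X := id) (μ := 0) (v := v) Measure.map_id
  have h1 := h 1
  have h2 := h (-1)
  simp only [mgf, id, one_mul, neg_mul, zero_mul, zero_add, one_pow, mul_one, even_two,
    Even.neg_pow] at h1 h2
  refine ⟨measurable_id, by simpa using integrable_exp_mul_gaussianReal (μ := 0) (v := v) 1,
    by simpa using integrable_exp_mul_gaussianReal (μ := 0) (v := v) (-1), h1.le, h2.le⟩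

/-- Truncating `|x| ^ p` at height `k` costs at most `|x| ^ (2 p) / k`. -/
theorem HasExpBound.abs_integral_rpow_sub_min_le {Ω : Type*} [MeasurableSpace Ω] {Y : Ω → ℝ}
    {Q : Measure Ω} [IsProbabilityMeasure Q] {K b : ℝ} (h : HasExpBound Y Q K) {p : ℝ}
    (hp : 0 < p) (hb : ∫ ω, |Y ω| ^ (2 * p) ∂Q ≤ b) {k : ℝ} (hk : 0 < k) :
    |∫ ω, |Y ω| ^ p ∂Q - ∫ ω, min (|Y ω| ^ p) k ∂Q| ≤ b / k := by
  have trunc : ∀ x : ℝ, |(|x| ^ p - min (|x| ^ p) k)| ≤ |x| ^ (2 * p) / k := by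
    intro x
    have h0 : 0 ≤ |x| ^ p := by positivity
    have h2 : |x| ^ (2 * p) = |x| ^ p * |x| ^ p := by
      rw [two_mul, Real.rpow_add' (abs_nonneg x) (by linarith)]
    rw [h2]
    rcases le_total (|x| ^ p) k with h | h
    · rw [min_eq_left h, sub_self, abs_zero]; positivity
    · rw [min_eq_right h, abs_of_nonneg (by linarith), le_div_iff₀ hk]
      nlinarith
  have hm := h.measurable
  have i1 := h.integrable_rpow hp.le
  have i2 : Integrable (fun ω => min (|Y ω| ^ p) k) Q := by
    refine integrable_of_bounded (B := k) (by fun_prop) fun ω => ?_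
    rw [Real.norm_of_nonneg (by positivity)]
    exact min_le_right _ _
  have i3 := h.integrable_rpow (q := 2 * p) (by linarith)
  rw [← integral_sub i1 i2]
  refine (abs_integral_le_integral_abs).trans ?_
  refine (integral_mono (i1.sub i2).abs (i3.div_const k) fun ω => trunc _).trans ?_
  rw [integral_div]
  gcongr

/-- Convergence of characteristic functions to a Gaussian one and bounded exponential moments give
convergence of all `L_p` norms. -/
theorem tendsto_eLpNorm_of_tendsto_charFun {Ω : ℕ → Type*} [∀ m, MeasurableSpace (Ω m)]
    (P : ∀ m, Measure (Ω m)) [∀ m, IsProbabilityMeasure (P m)] (X : ∀ m, Ω m → ℝ) {K : ℝ}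
    (hX : ∀ m, HasExpBound (X m) (P m) K) {v : NNReal} (hv : v ≠ 0)
    (hchar : ∀ t : ℝ, Tendsto (fun m => ∫ ω, Complex.exp ((t * X m ω : ℝ) * Complex.I) ∂(P m)) atTop
      (𝓝 (Complex.exp ((-(t ^ 2 * v / 2) : ℝ))))) {p : ℝ} (hp : 1 ≤ p) :
    Tendsto (fun m => eLpNorm (X m) (ENNReal.ofReal p) (P m)) atTop
      (𝓝 (ENNReal.ofReal (√(2 * v) * (Real.Gamma ((p + 1) / 2) / √Real.pi) ^ (1 / p)))) := by
  have hp0 : 0 < p := by linarith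
  have hXm : ∀ m, Measurable (X m) := fun m => (hX m).measurable
  let ν : ℕ → ProbabilityMeasure ℝ := fun m =>
    ⟨(P m).map (X m), Measure.isProbabilityMeasure_map (hXm m).aemeasurable⟩
  let ν₀ : ProbabilityMeasure ℝ := ⟨gaussianReal 0 v, inferInstance⟩
  have hweak : Tendsto ν atTop (𝓝 ν₀) := by
    refine ProbabilityMeasure.tendsto_iff_tendsto_charFun.2 fun t => ?_
    simp only [ν, ν₀, ProbabilityMeasure.coe_mk, charFun_gaussianReal]
    have e : Complex.exp (t * (0 : ℝ) * Complex.I - v * t ^ 2 / 2) =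
        Complex.exp ((-(t ^ 2 * v / 2) : ℝ)) := by
      congr 1; push_cast; ring
    rw [e]
    convert! hchar t using 2 with m
    rw [charFun_apply_real, integral_map (hXm m).aemeasurable (by fun_prop)]
    push_cast
    rfl
  obtain ⟨L, hL0, hL⟩ := exists_integral_rpow_le (2 * p) (by linarith) K
  obtain ⟨L₀, hL₀0, hL₀⟩ := exists_integral_rpow_le (2 * p) (by linarith) (Real.exp (v / 2))
  have hmom : Tendsto (fun m => ∫ ω, |X m ω| ^ p ∂(P m)) atTop
      (𝓝 (∫ x, |x| ^ p ∂(gaussianReal 0 v))) := by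
    rw [Metric.tendsto_atTop]
    intro ε hε
    -- Truncation at height `k` changes either moment by less than `ε / 4`.
    set k : ℝ := 4 * (L + L₀ + 1) / ε with hk
    have hk0 : 0 < k := by positivity
    let F : BoundedContinuousFunction ℝ ℝ := BoundedContinuousFunction.ofNormedAddCommGroup
      (fun x => min (|x| ^ p) k)
      ((continuous_abs.rpow_const fun x => Or.inr hp0.le).min continuous_const) k fun x => by
        rw [Real.norm_of_nonneg (by positivity)]
        exact min_le_right _ _
    have hF := (ProbabilityMeasure.tendsto_iff_forall_integral_tendsto.1 hweak) F
    rw [Metric.tendsto_atTop] at hF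
    obtain ⟨m₀, hm₀⟩ := hF (ε / 2) (by positivity)
    refine ⟨m₀, fun m hm => ?_⟩
    have h1 := hm₀ m hm
    have hFm : ∫ x, F x ∂(ν m : Measure ℝ) = ∫ ω, min (|X m ω| ^ p) k ∂(P m) := by
      simp only [ν, ProbabilityMeasure.coe_mk]
      rw [integral_map (hXm m).aemeasurable F.continuous.measurable.aestronglyMeasurable]
      rfl
    have hF0 : ∫ x, F x ∂(ν₀ : Measure ℝ) = ∫ x, min (|x| ^ p) k ∂(gaussianReal 0 v) := rfl
    rw [hFm, hF0, Real.dist_eq] at h1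
    have h2 := (hX m).abs_integral_rpow_sub_min_le hp0 (hL _ _ (hX m)) hk0
    have h3 := (hasExpBound_gaussianReal v).abs_integral_rpow_sub_min_le hp0
      (hL₀ _ _ (hasExpBound_gaussianReal v)) hk0
    simp only [id] at h3
    have h4 : L / k + L₀ / k < ε / 2 := by
      rw [← add_div, div_lt_iff₀ hk0, hk]
      field_simp
      linarith
    rw [Real.dist_eq]
    rw [abs_lt] at h1 ⊢
    rw [abs_le] at h2 h3
    constructor <;> linarith [h1.1, h1.2, h2.1, h2.2, h3.1, h3.2]
  have hval : √(2 * v) * (Real.Gamma ((p + 1) / 2) / √Real.pi) ^ (1 / p) =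
      (∫ x, |x| ^ p ∂(gaussianReal 0 v)) ^ (1 / p) := by
    have hG : 0 < Real.Gamma ((p + 1) / 2) := Real.Gamma_pos_of_pos (by linarith)
    rw [integral_rpow_abs_gaussianReal hv hp, Real.mul_rpow (by positivity) (by positivity),
      ← Real.rpow_mul (by positivity), Real.sqrt_eq_rpow]
    congr 2
    field_simp
  rw [hval]
  have : ∀ m, eLpNorm (X m) (ENNReal.ofReal p) (P m) =
      ENNReal.ofReal ((∫ ω, |X m ω| ^ p ∂(P m)) ^ (1 / p)) := fun m => (hX m).eLpNorm_eq hp0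
  simp_rw [this]
  exact ENNReal.tendsto_ofReal (hmom.rpow_const (Or.inr (by positivity)))

end LocalExchange

namespace LocalExchange

/-! ### The Feynman–Kac flow -/

variable {X : Type*} [MeasurableSpace X]

/-- The potentials `g n` are measurable, positive and bounded by the constants `C n`. -/
structure IsPotential (g : ℕ → X → ℝ) (C : ℕ → ℝ) : Prop where
  measurable : ∀ n, Measurable (g n)
  pos : ∀ n x, 0 < g n x
  le : ∀ n x, g n x ≤ C n

/-- The operator `Qₙ₊₁ h (x) = gₙ(x) ∫ h(y) f(x, dy)`. -/
noncomputable def propagate (f : Kernel X X) (g : ℕ → X → ℝ) (n : ℕ) (h : X → ℝ) : X → ℝ :=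
  fun x => g n x * ∫ y, h y ∂(f x)

variable {π₀ : Measure X} {f : Kernel X X} {g : ℕ → X → ℝ} {C : ℕ → ℝ}

theorem IsPotential.bound_nonneg [Nonempty X] (hg : IsPotential g C) (n : ℕ) : 0 ≤ C n :=
  ((hg.pos n (Classical.arbitrary X)).le).trans (hg.le n _)

theorem measurable_propagate (hg : IsPotential g C) (n : ℕ) {h : X → ℝ}
    (hm : Measurable h) : Measurable (propagate f g n h) :=
  (hg.measurable n).mul hm.stronglyMeasurable.integral_kernel.measurable

theorem abs_propagate_le [IsMarkovKernel f] (hg : IsPotential g C) (n : ℕ) {h : X → ℝ} {B : ℝ}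
    (hB : ∀ x, |h x| ≤ B) (x : X) : |propagate f g n h x| ≤ C n * B := by
  rw [propagate, abs_mul, abs_of_pos (hg.pos n x)]
  exact mul_le_mul (hg.le n x) (abs_integral_le_of_bounded hB) (abs_nonneg _)
    ((hg.pos n x).le.trans (hg.le n x))

theorem isFiniteMeasure_withDensity_potential (hg : IsPotential g C) (n : ℕ) (μ : Measure X)
    [IsFiniteMeasure μ] : IsFiniteMeasure (μ.withDensity fun x => ENNReal.ofReal (g n x)) :=
  isFiniteMeasure_withDensity_ofReal (integrable_of_bounded (B := C n) (hg.measurable n) fun x => by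
    rw [Real.norm_of_nonneg (hg.pos n x).le]; exact hg.le n x).2

theorem isFiniteMeasure_unnormFilter [IsProbabilityMeasure π₀] [IsMarkovKernel f]
    (hg : IsPotential g C) (n : ℕ) : IsFiniteMeasure (unnormFilter π₀ f g n) := by
  induction n with
  | zero => exact inferInstanceAs (IsFiniteMeasure π₀)
  | succ n ih =>
    have := isFiniteMeasure_withDensity_potential hg n (unnormFilter π₀ f g n)
    exact inferInstanceAs (IsFiniteMeasure
      (((unnormFilter π₀ f g n).withDensity fun x => ENNReal.ofReal (g n x)).bind f))

theorem integral_bind_withDensity [IsMarkovKernel f] (hg : IsPotential g C) (n : ℕ)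
    (μ : Measure X) [IsFiniteMeasure μ] {h : X → ℝ} (hm : Measurable h) {B : ℝ}
    (hB : ∀ x, |h x| ≤ B) :
    ∫ x, h x ∂((μ.withDensity fun x => ENNReal.ofReal (g n x)).bind f) =
      ∫ x, propagate f g n h x ∂μ := by
  have := isFiniteMeasure_withDensity_potential hg n μ
  rw [← Measure.snd_compProd, Measure.snd, integral_map measurable_snd.aemeasurable
      hm.aestronglyMeasurable, Measure.integral_compProd
      (integrable_of_bounded (B := B) (by fun_prop) fun q => hB q.2),
    integral_withDensity_eq_integral_toReal_smul (hg.measurable n).ennreal_ofReal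
      (ae_of_all _ fun x => ENNReal.ofReal_lt_top)]
  congr 1 with x
  rw [ENNReal.toReal_ofReal (hg.pos n x).le]
  rfl

theorem integral_unnormFilter_succ [IsProbabilityMeasure π₀] [IsMarkovKernel f]
    (hg : IsPotential g C) (n : ℕ) {h : X → ℝ} (hm : Measurable h) {B : ℝ}
    (hB : ∀ x, |h x| ≤ B) :
    ∫ x, h x ∂(unnormFilter π₀ f g (n + 1)) =
      ∫ x, propagate f g n h x ∂(unnormFilter π₀ f g n) := by
  have := isFiniteMeasure_unnormFilter (π₀ := π₀) (f := f) hg n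
  exact integral_bind_withDensity hg n _ hm hB

theorem unnormFilter_univ_succ [IsMarkovKernel f] (n : ℕ) :
    unnormFilter π₀ f g (n + 1) Set.univ =
      ∫⁻ x, ENNReal.ofReal (g n x) ∂(unnormFilter π₀ f g n) := by
  rw [unnormFilter, Measure.bind_apply MeasurableSet.univ f.aemeasurable]
  simp

theorem unnormFilter_univ_ne_zero [IsProbabilityMeasure π₀] [IsMarkovKernel f]
    (hg : IsPotential g C) (n : ℕ) : unnormFilter π₀ f g n Set.univ ≠ 0 := by
  induction n with
  | zero => simp [unnormFilter]
  | succ n ih =>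
    rw [unnormFilter_univ_succ, Ne, lintegral_eq_zero_iff (hg.measurable n).ennreal_ofReal]
    intro h
    refine ih ?_
    have h' : ∀ᵐ x ∂(unnormFilter π₀ f g n), False := h.mono fun x hx =>
      absurd hx (by simpa using hg.pos n x)
    simpa [ae_iff] using h'

theorem unnormFilter_real_univ_pos [IsProbabilityMeasure π₀] [IsMarkovKernel f]
    (hg : IsPotential g C) (n : ℕ) : 0 < (unnormFilter π₀ f g n).real Set.univ := by
  have := isFiniteMeasure_unnormFilter (π₀ := π₀) (f := f) hg n
  exact ENNReal.toReal_pos (unnormFilter_univ_ne_zero hg n) (measure_ne_top _ _)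

theorem predFilter_eq [IsProbabilityMeasure π₀] [IsMarkovKernel f]
    (hg : IsPotential g C) (n : ℕ) :
    predFilter π₀ f g n = (unnormFilter π₀ f g n Set.univ)⁻¹ • unnormFilter π₀ f g n := by
  induction n with
  | zero => simp [predFilter, unnormFilter]
  | succ n ih =>
    have := isFiniteMeasure_unnormFilter (π₀ := π₀) (f := f) hg n
    have h0 := unnormFilter_univ_ne_zero (π₀ := π₀) (f := f) hg n
    have ht : unnormFilter π₀ f g n Set.univ ≠ ∞ := measure_ne_top _ _
    rw [predFilter, ih, unnormFilter_univ_succ, lintegral_smul_measure, withDensity_smul_measure,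
      unnormFilter]
    have e : ∀ c : ℝ≥0∞, ∀ μ : Measure X, (c • μ).bind f = c • μ.bind f := fun c μ => by
      simp
    rw [e, smul_smul]
    congr 1
    rw [smul_eq_mul, ENNReal.mul_inv (Or.inl (ENNReal.inv_ne_zero.2 ht))
      (Or.inl (ENNReal.inv_ne_top.2 h0)),
      inv_inv, mul_right_comm, ENNReal.mul_inv_cancel h0 ht, one_mul]

theorem integral_predFilter [IsProbabilityMeasure π₀] [IsMarkovKernel f]
    (hg : IsPotential g C) (n : ℕ) (h : X → ℝ) :
    ∫ x, h x ∂(predFilter π₀ f g n) =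
      (∫ x, h x ∂(unnormFilter π₀ f g n)) / (unnormFilter π₀ f g n).real Set.univ := by
  rw [predFilter_eq hg, integral_smul_measure, ENNReal.toReal_inv, smul_eq_mul, div_eq_inv_mul]
  rfl

/-- The centred test function has mean zero under the unnormalised measure. -/
theorem integral_sub_predFilter [IsProbabilityMeasure π₀] [IsMarkovKernel f]
    (hg : IsPotential g C) (n : ℕ) {φ : X → ℝ} (hφ : Measurable φ) {B : ℝ} (hB : ∀ x, |φ x| ≤ B) :
    ∫ x, (φ x - ∫ y, φ y ∂(predFilter π₀ f g n)) ∂(unnormFilter π₀ f g n) = 0 := by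
  have hγpos := unnormFilter_real_univ_pos (π₀ := π₀) (f := f) hg n
  have hfin := isFiniteMeasure_unnormFilter (π₀ := π₀) (f := f) hg n
  rw [integral_sub (integrable_of_bounded hφ hB) (integrable_const _), integral_predFilter hg]
  simp only [integral_const, smul_eq_mul]
  field_simp
  simp

/-! ### Weights and proposals along a particle history -/

variable {N : ℕ} {α : Matrix (Fin N) (Fin N) ℝ}

/-- The bound `C 0 * ⋯ * C (n - 1)` on the weights at time `n`. -/
noncomputable def weightBound (C : ℕ → ℝ) (n : ℕ) : ℝ := ∏ k ∈ Finset.range n, C k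

theorem weightBound_succ (C : ℕ → ℝ) (n : ℕ) : weightBound C (n + 1) = weightBound C n * C n :=
  Finset.prod_range_succ _ _

theorem weight_congr {Y : Type*} (α : Matrix (Fin N) (Fin N) ℝ) (g : ℕ → Y → ℝ)
    {z z' : ℕ → Fin N → Y} {n : ℕ}
    (h : ∀ k < n, z k = z' k) : weight α g z n = weight α g z' n := by
  induction n with
  | zero => rfl
  | succ n ih =>
    ext i
    simp only [weight]
    rw [ih fun k hk => h k (by omega), h n (by omega)]

theorem measurable_weight (hg : IsPotential g C) (α : Matrix (Fin N) (Fin N) ℝ) (n : ℕ)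
    (i : Fin N) : Measurable fun z : ℕ → Fin N → X => weight α g z n i := by
  induction n generalizing i with
  | zero => exact measurable_const
  | succ n ih =>
    simp only [weight]
    refine Finset.measurable_sum _ fun j _ => ((ih j).const_mul _).mul ?_
    exact (hg.measurable n).comp (by fun_prop)

theorem weight_pos (hg : IsPotential g C) (hα : α ∈ doublyStochastic ℝ (Fin N))
    (z : ℕ → Fin N → X) (n : ℕ) (i : Fin N) : 0 < weight α g z n i := by
  induction n generalizing i with
  | zero => exact one_pos
  | succ n ih =>
    simp only [weight]
    have h0 : ∀ j, 0 ≤ α i j * weight α g z n j * g n (z n j) := fun j =>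
      mul_nonneg (mul_nonneg (nonneg_of_mem_doublyStochastic hα) (ih j).le) (hg.pos n _).le
    refine (Finset.sum_nonneg fun j _ => h0 j).lt_of_ne' fun h => ?_
    rw [Finset.sum_eq_zero_iff_of_nonneg fun j _ => h0 j] at h
    have hr := sum_row_of_mem_doublyStochastic hα i
    rw [Finset.sum_eq_zero fun j hj => ?_] at hr
    · exact zero_ne_one hr
    · have := h j hj
      simpa [(ih j).ne', (hg.pos n (z n j)).ne'] using this

theorem weight_le [Nonempty X] (hg : IsPotential g C) (hα : α ∈ doublyStochastic ℝ (Fin N))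
    (z : ℕ → Fin N → X) (n : ℕ) (i : Fin N) : weight α g z n i ≤ weightBound C n := by
  induction n generalizing i with
  | zero => simp [weight, weightBound]
  | succ n ih =>
    simp only [weight, weightBound_succ]
    have hK : 0 ≤ weightBound C n := (weight_pos hg hα z n i).le.trans (ih i)
    calc ∑ j, α i j * weight α g z n j * g n (z n j)
        ≤ ∑ j, α i j * (weightBound C n * C n) := by
          refine Finset.sum_le_sum fun j _ => ?_
          rw [mul_assoc]
          refine mul_le_mul_of_nonneg_left ?_ (nonneg_of_mem_doublyStochastic hα)
          exact mul_le_mul (ih j) (hg.le n _) (hg.pos n _).le hK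
      _ = _ := by rw [← Finset.sum_mul, sum_row_of_mem_doublyStochastic hα, one_mul]

theorem isProbabilityMeasure_proposal [IsMarkovKernel f] (hg : IsPotential g C)
    (hα : α ∈ doublyStochastic ℝ (Fin N)) (z : ℕ → Fin N → X) (n : ℕ) (i : Fin N) :
    IsProbabilityMeasure (proposal α f g z n i) := by
  have hw := weight_pos hg hα z (n + 1) i
  refine ⟨?_⟩
  rw [proposal, Measure.smul_apply, Measure.finsetSum_apply]
  simp only [Measure.smul_apply, measure_univ, smul_eq_mul, mul_one]
  rw [← ENNReal.ofReal_sum_of_nonneg fun j _ => mul_nonneg (mul_nonneg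
    (nonneg_of_mem_doublyStochastic hα) (weight_pos hg hα z n j).le) (hg.pos n _).le]
  exact ENNReal.inv_mul_cancel (by simpa [weight] using hw) ENNReal.ofReal_ne_top

/-- The weighted mean of a test function under the proposal. -/
theorem weight_mul_integral_proposal [IsMarkovKernel f] (hg : IsPotential g C)
    (hα : α ∈ doublyStochastic ℝ (Fin N)) (z : ℕ → Fin N → X) (n : ℕ) (i : Fin N) {h : X → ℝ}
    (hm : Measurable h) {B : ℝ} (hB : ∀ x, |h x| ≤ B) :
    weight α g z (n + 1) i * ∫ x, h x ∂(proposal α f g z n i) =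
      ∑ j, α i j * weight α g z n j * propagate f g n h (z n j) := by
  have hw := weight_pos hg hα z (n + 1) i
  rw [proposal, integral_smul_measure, integral_finsetSum_measure fun j _ =>
    (integrable_of_bounded hm hB).smul_measure ENNReal.ofReal_ne_top, ENNReal.toReal_inv,
    ENNReal.toReal_ofReal hw.le, smul_eq_mul, ← mul_assoc, mul_inv_cancel₀ hw.ne', one_mul]
  refine Finset.sum_congr rfl fun j _ => ?_
  rw [integral_smul_measure, ENNReal.toReal_ofReal (mul_nonneg (mul_nonneg
    (nonneg_of_mem_doublyStochastic hα) (weight_pos hg hα z n j).le) (hg.pos n _).le), propagate,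
    smul_eq_mul]
  ring

/-- The conditional law of the particles at time `n + 1` given the history `z`. -/
noncomputable def nextLaw (α : Matrix (Fin N) (Fin N) ℝ) (f : Kernel X X) (g : ℕ → X → ℝ)
    (z : ℕ → Fin N → X) (n : ℕ) : Measure (Fin N → X) :=
  Measure.pi fun i => proposal α f g z n i

variable [StandardBorelSpace X] [Nonempty X] {Ω : Type*} [MeasurableSpace Ω] {P : Measure Ω}
  [IsProbabilityMeasure P] {ζ : ℕ → Ω → Fin N → X}

theorem IsParticleSystem.measurable_path (hS : IsParticleSystem π₀ f g α P ζ) :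
    Measurable fun ω k => ζ k ω :=
  measurable_pi_lambda _ fun k => hS.measurable k

/-- Disintegration of the law of the particles up to time `n + 1` along the history up to time `n`.
The history is an infinite sequence of which `G` uses only the first `n + 1` terms. -/
theorem IsParticleSystem.integrable_and_integral_succ (hS : IsParticleSystem π₀ f g α P ζ)
    (n : ℕ) {E : Type*} [NormedAddCommGroup E] [NormedSpace ℝ E] [MeasurableSpace E] [BorelSpace E]
    [SecondCountableTopology E] {G : (ℕ → Fin N → X) → (Fin N → X) → E}
    (hG : Measurable (Function.uncurry G))
    (hdep : ∀ z z' : ℕ → Fin N → X, (∀ k ≤ n, z k = z' k) → G z = G z')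
    (hint : Integrable (fun ω => G (fun k => ζ k ω) (ζ (n + 1) ω)) P) :
    Integrable (fun ω => ∫ y, G (fun k => ζ k ω) y ∂(nextLaw α f g (fun k => ζ k ω) n)) P ∧
    ∫ ω, G (fun k => ζ k ω) (ζ (n + 1) ω) ∂P =
      ∫ ω, ∫ y, G (fun k => ζ k ω) y ∂(nextLaw α f g (fun k => ζ k ω) n) ∂P := by
  let hist : Ω → Fin (n + 1) → Fin N → X := fun ω k => ζ k ω
  -- A finite history is continued by repeating its last term.
  let ext : (Fin (n + 1) → Fin N → X) → ℕ → Fin N → X :=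
    fun h k => h ⟨min k n, by omega⟩
  have hext : Measurable ext := measurable_pi_lambda _ fun k => measurable_pi_apply _
  have hhist : Measurable hist := measurable_pi_lambda _ fun k => hS.measurable k
  let F : (Fin (n + 1) → Fin N → X) × (Fin N → X) → E := fun q => G (ext q.1) q.2
  have hF : Measurable F := hG.comp ((hext.comp measurable_fst).prodMk measurable_snd)
  have hGF : ∀ ω, G (fun k => ζ k ω) = fun y => F (hist ω, y) := fun ω =>
    hdep (fun k => ζ k ω) (ext (hist ω)) fun k hk => by
      simp only [ext, hist, min_eq_left hk]
  have hpair : Measurable fun ω => (hist ω, ζ (n + 1) ω) := hhist.prodMk (hS.measurable _)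
  simp_rw [hGF] at hint ⊢
  have hint' : Integrable F (P.map fun ω => (hist ω, ζ (n + 1) ω)) :=
    (integrable_map_measure hF.aestronglyMeasurable hpair.aemeasurable).2 hint
  have e1 : ∫ ω, F (hist ω, ζ (n + 1) ω) ∂P = ∫ q, F q ∂(P.map fun ω => (hist ω, ζ (n + 1) ω)) :=
    (integral_map hpair.aemeasurable hF.aestronglyMeasurable).symm
  rw [e1, ← compProd_map_condDistrib (hS.measurable (n + 1)).aemeasurable] at *
  have hae : (fun ω => ∫ y, F (hist ω, y) ∂(condDistrib (ζ (n + 1)) hist P (hist ω))) =ᵐ[P]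
      fun ω => ∫ y, F (hist ω, y) ∂(nextLaw α f g (fun k => ζ k ω) n) := by
    filter_upwards [hS.transition n] with ω hω
    simp only [nextLaw]
    rw [← hω]
  refine ⟨((Integrable.integral_compProd hint').comp_measurable hhist).congr hae, ?_⟩
  rw [Measure.integral_compProd hint', integral_map hhist.aemeasurable
    (hF.stronglyMeasurable.integral_condDistrib.aestronglyMeasurable)]
  exact integral_congr_ae hae

theorem IsParticleSystem.integrable_succ (hS : IsParticleSystem π₀ f g α P ζ) (n : ℕ) {E : Type*}
    [NormedAddCommGroup E] [NormedSpace ℝ E] [MeasurableSpace E] [BorelSpace E]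
    [SecondCountableTopology E] {G : (ℕ → Fin N → X) → (Fin N → X) → E}
    (hG : Measurable (Function.uncurry G))
    (hdep : ∀ z z' : ℕ → Fin N → X, (∀ k ≤ n, z k = z' k) → G z = G z')
    (hint : Integrable (fun ω => G (fun k => ζ k ω) (ζ (n + 1) ω)) P) :
    Integrable (fun ω => ∫ y, G (fun k => ζ k ω) y ∂(nextLaw α f g (fun k => ζ k ω) n)) P :=
  (hS.integrable_and_integral_succ n hG hdep hint).1

/-- Integration over the particles at time `n + 1`, given the history. -/
theorem IsParticleSystem.integral_succ (hS : IsParticleSystem π₀ f g α P ζ) (n : ℕ) {E : Type*}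
    [NormedAddCommGroup E] [NormedSpace ℝ E] [MeasurableSpace E] [BorelSpace E]
    [SecondCountableTopology E] {G : (ℕ → Fin N → X) → (Fin N → X) → E}
    (hG : Measurable (Function.uncurry G))
    (hdep : ∀ z z' : ℕ → Fin N → X, (∀ k ≤ n, z k = z' k) → G z = G z')
    (hint : Integrable (fun ω => G (fun k => ζ k ω) (ζ (n + 1) ω)) P) :
    ∫ ω, G (fun k => ζ k ω) (ζ (n + 1) ω) ∂P =
      ∫ ω, ∫ y, G (fun k => ζ k ω) y ∂(nextLaw α f g (fun k => ζ k ω) n) ∂P :=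
  (hS.integrable_and_integral_succ n hG hdep hint).2

theorem IsParticleSystem.integral_zero (hS : IsParticleSystem π₀ f g α P ζ) {E : Type*}
    [NormedAddCommGroup E] [NormedSpace ℝ E] [MeasurableSpace E] [BorelSpace E]
    [SecondCountableTopology E] {G : (Fin N → X) → E} (hG : Measurable G) :
    ∫ ω, G (ζ 0 ω) ∂P = ∫ y, G y ∂(Measure.pi fun _ : Fin N => π₀) := by
  rw [← hS.initial, integral_map (hS.measurable 0).aemeasurable hG.aestronglyMeasurable]

end LocalExchange

namespace LocalExchange

/-! ### One step of the algorithm: linear statistics -/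

variable {X : Type*} [MeasurableSpace X] {π₀ : Measure X} {f : Kernel X X} {g : ℕ → X → ℝ}
  {C : ℕ → ℝ} {N : ℕ} {α : Matrix (Fin N) (Fin N) ℝ}

/-- The weighted sum `∑ᵢ Wₙⁱ h(zₙⁱ)`. -/
noncomputable def weightedSum (α : Matrix (Fin N) (Fin N) ℝ) (g : ℕ → X → ℝ) (h : X → ℝ)
    (z : ℕ → Fin N → X) (n : ℕ) : ℝ :=
  ∑ i, weight α g z n i * h (z n i)

theorem measurable_weightedSum (hg : IsPotential g C) (α : Matrix (Fin N) (Fin N) ℝ) {h : X → ℝ}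
    (hm : Measurable h) (n : ℕ) : Measurable fun z : ℕ → Fin N → X => weightedSum α g h z n :=
  Finset.measurable_sum _ fun i _ => (measurable_weight hg α n i).mul (hm.comp (by fun_prop))

theorem abs_weightedSum_le [Nonempty X] (hg : IsPotential g C)
    (hα : α ∈ doublyStochastic ℝ (Fin N)) {h : X → ℝ} {B : ℝ} (hB : ∀ x, |h x| ≤ B)
    (z : ℕ → Fin N → X) (n : ℕ) : |weightedSum α g h z n| ≤ N * (weightBound C n * B) := by
  refine (Finset.abs_sum_le_sum_abs _ _).trans ?_
  refine (Finset.sum_le_card_nsmul _ _ (weightBound C n * B) fun i _ => ?_).trans (by simp)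
  rw [abs_mul, abs_of_pos (weight_pos hg hα z n i)]
  have h1 := weight_le hg hα z n i
  exact mul_le_mul h1 (hB _) (abs_nonneg _) ((weight_pos hg hα z n i).le.trans h1)

theorem abs_weight_mul_le [Nonempty X] (hg : IsPotential g C)
    (hα : α ∈ doublyStochastic ℝ (Fin N)) {h : X → ℝ} {B : ℝ} (hB : ∀ x, |h x| ≤ B)
    (z : ℕ → Fin N → X) (n : ℕ) (i : Fin N) (x : X) :
    |weight α g z n i * h x| ≤ weightBound C n * B := by
  rw [abs_mul, abs_of_pos (weight_pos hg hα z n i)]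
  have h1 := weight_le hg hα z n i
  exact mul_le_mul h1 (hB _) (abs_nonneg _) ((weight_pos hg hα z n i).le.trans h1)

/-- Since the columns of `α` sum to one, the conditional mean of a weighted sum is the weighted sum
of the propagated test function. -/
theorem sum_weight_mul_integral_proposal [IsMarkovKernel f] (hg : IsPotential g C)
    (hα : α ∈ doublyStochastic ℝ (Fin N)) (z : ℕ → Fin N → X) (n : ℕ) {h : X → ℝ}
    (hm : Measurable h) {B : ℝ} (hB : ∀ x, |h x| ≤ B) :
    ∑ i, weight α g z (n + 1) i * ∫ x, h x ∂(proposal α f g z n i) =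
      weightedSum α g (propagate f g n h) z n := by
  simp_rw [weight_mul_integral_proposal hg hα z n _ hm hB]
  rw [Finset.sum_comm]
  refine Finset.sum_congr rfl fun j _ => ?_
  simp_rw [mul_assoc]
  rw [← Finset.sum_mul, sum_col_of_mem_doublyStochastic hα, one_mul]

theorem uncurry_weight_measurable (hg : IsPotential g C) (α : Matrix (Fin N) (Fin N) ℝ)
    {h : X → ℝ} (hm : Measurable h) (n : ℕ) :
    Measurable fun q : (ℕ → Fin N → X) × (Fin N → X) => ∑ i, weight α g q.1 n i * h (q.2 i) :=
  Finset.measurable_sum _ fun i _ => ((measurable_weight hg α n i).comp measurable_fst).mul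
    (hm.comp (by fun_prop))

section ParticleSystem

variable [StandardBorelSpace X] [Nonempty X] {Ω : Type*} [MeasurableSpace Ω] {P : Measure Ω}
  [IsProbabilityMeasure P] {ζ : ℕ → Ω → Fin N → X}

theorem IsParticleSystem.measurable_weightedSum (hS : IsParticleSystem π₀ f g α P ζ)
    (hg : IsPotential g C) {h : X → ℝ} (hm : Measurable h) (n : ℕ) :
    Measurable fun ω => weightedSum α g h (fun k => ζ k ω) n :=
  (LocalExchange.measurable_weightedSum hg α hm n).comp hS.measurable_path

variable [IsProbabilityMeasure π₀] [IsMarkovKernel f]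

/-- A sub-Gaussian bound for the fluctuations of weighted sums: by Hoeffding's inequality each time
step contributes a factor, and the conditional mean is a weighted sum of the preceding
generation. -/
theorem IsParticleSystem.integral_exp_weightedSum_le (hS : IsParticleSystem π₀ f g α P ζ)
    (hg : IsPotential g C) (hα : α ∈ doublyStochastic ℝ (Fin N)) (s : ℝ)
    (n : ℕ) {h : X → ℝ} (hm : Measurable h) {B : ℝ} (hB : ∀ x, |h x| ≤ B) :
    ∫ ω, Real.exp (s * (weightedSum α g h (fun k => ζ k ω) n -
      N * ∫ x, h x ∂(unnormFilter π₀ f g n))) ∂P ≤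
        Real.exp ((n + 1) * (N * ((s * (weightBound C n * B)) ^ 2 / 2))) := by
  induction n generalizing h B with
  | zero =>
    have e := hS.integral_zero (G := fun y => Real.exp (s * (∑ i, 1 * h (y i) -
      N * ∫ x, h x ∂(unnormFilter π₀ f g 0)))) (by fun_prop)
    simp only [weightedSum, weight]
    rw [e]
    have := integral_pi_exp_sum_le (fun _ : Fin N => π₀) (h := fun _ x => s * h x)
      (fun _ => by fun_prop) (D := |s| * B) fun _ x => by
        rw [abs_mul]; exact mul_le_mul_of_nonneg_left (hB x) (abs_nonneg _)
    simp only [one_mul, mul_sub, Real.exp_sub, integral_div, Finset.mul_sum]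
    rw [div_le_iff₀ (Real.exp_pos _), ← Real.exp_add]
    refine this.trans (le_of_eq ?_)
    simp only [integral_const_mul, Finset.sum_const, Finset.card_univ, Fintype.card_fin,
      nsmul_eq_mul, unnormFilter, weightBound, Finset.range_zero, Finset.prod_empty, mul_pow,
      sq_abs]
    congr 1
    simp
    ring
  | succ n ih =>
    set γ := ∫ x, h x ∂(unnormFilter π₀ f g (n + 1)) with hγ
    have hγ' : γ = ∫ x, propagate f g n h x ∂(unnormFilter π₀ f g n) :=
      integral_unnormFilter_succ hg n hm hB
    have hB0 : 0 ≤ B := (abs_nonneg _).trans (hB (Classical.arbitrary X))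
    have hK0 : 0 ≤ weightBound C n := Finset.prod_nonneg fun k _ => hg.bound_nonneg k
    have hbd : ∀ (n : ℕ) {h : X → ℝ}, Measurable h → ∀ {B : ℝ}, (∀ x, |h x| ≤ B) → ∀ c : ℝ,
        Integrable (fun ω => Real.exp (s * (weightedSum α g h (fun k => ζ k ω) n - c))) P := by
      intro n h hm B hB c
      refine integrable_of_bounded (B := Real.exp (|s| * (N * (weightBound C n * B) + |c|)))
        ((Real.measurable_exp.comp (((hS.measurable_weightedSum hg hm n).sub_const c).const_mul s)))
        fun ω => ?_
      rw [Real.norm_of_nonneg (Real.exp_pos _).le, Real.exp_le_exp]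
      refine (le_abs_self _).trans ?_
      rw [abs_mul]
      refine mul_le_mul_of_nonneg_left ((abs_sub _ _).trans ?_) (abs_nonneg _)
      gcongr
      exact abs_weightedSum_le hg hα hB _ n
    have e := hS.integral_succ n (G := fun z y => Real.exp (s * (∑ i, weight α g z (n + 1) i *
      h (y i) - N * γ)))
      (Real.measurable_exp.comp (((uncurry_weight_measurable hg α hm (n + 1)).sub_const _).const_mul
        s)) (fun z z' hz => by
          rw [weight_congr α g (n := n + 1) fun k hk => hz k (by omega)]) (hbd (n + 1) hm hB _)
    simp only [weightedSum] at ih ⊢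
    rw [e]
    have inner : ∀ z : ℕ → Fin N → X,
        ∫ y, Real.exp (s * (∑ i, weight α g z (n + 1) i * h (y i) - N * γ)) ∂(nextLaw α f g z n) ≤
        Real.exp (s * (weightedSum α g (propagate f g n h) z n - N * γ)) *
          Real.exp (N * ((s * (weightBound C (n + 1) * B)) ^ 2 / 2)) := by
      intro z
      have := fun i => isProbabilityMeasure_proposal (f := f) hg hα z n i
      have h1 := integral_pi_exp_sum_le (fun i : Fin N => proposal α f g z n i)
        (h := fun i x => s * (weight α g z (n + 1) i * h x))
        (fun _ => by fun_prop) (D := |s| * (weightBound C (n + 1) * B)) fun i x => by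
          rw [abs_mul]
          exact mul_le_mul_of_nonneg_left (abs_weight_mul_le hg hα hB z (n + 1) i x) (abs_nonneg _)
      simp only [mul_sub, Real.exp_sub, integral_div, Finset.mul_sum]
      rw [div_mul_eq_mul_div, div_le_div_iff_of_pos_right (Real.exp_pos _), ← Real.exp_add]
      refine h1.trans (le_of_eq ?_)
      simp_rw [integral_const_mul]
      rw [← Finset.mul_sum, sum_weight_mul_integral_proposal hg hα z n hm hB]
      simp only [Fintype.card_fin, mul_pow, sq_abs]
    have hCB : ∀ x, |propagate f g n h x| ≤ C n * B := abs_propagate_le hg n hB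
    calc _ ≤ ∫ ω, Real.exp (s * (weightedSum α g (propagate f g n h) (fun k => ζ k ω) n - N * γ)) *
          Real.exp (N * ((s * (weightBound C (n + 1) * B)) ^ 2 / 2)) ∂P := by
          refine integral_mono_of_nonneg (ae_of_all _ fun ω => integral_nonneg fun y =>
            (Real.exp_pos _).le) ?_ (ae_of_all _ fun ω => inner _)
          exact (hbd n (measurable_propagate hg n hm) hCB _).mul_const _
      _ ≤ Real.exp ((n + 1) * (N * ((s * (weightBound C n * (C n * B))) ^ 2 / 2))) *
          Real.exp (N * ((s * (weightBound C (n + 1) * B)) ^ 2 / 2)) := by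
          rw [integral_mul_const, hγ']
          gcongr
          exact ih (measurable_propagate hg n hm) hCB
      _ = _ := by
          rw [← Real.exp_add, weightBound_succ]
          congr 1
          push_cast
          ring

end ParticleSystem

end LocalExchange

namespace LocalExchange

/-! ### One step of the algorithm: quadratic statistics -/

variable {X : Type*} [MeasurableSpace X] {π₀ : Measure X} {f : Kernel X X} {g : ℕ → X → ℝ}
  {C : ℕ → ℝ} {N : ℕ} {α : Matrix (Fin N) (Fin N) ℝ}

theorem measurable_coalesce (s : ℤ × ℤ) {h : X × X → ℝ} (hm : Measurable h) :
    Measurable (coalesce s h) := by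
  unfold coalesce
  split_ifs
  · exact hm.comp (by fun_prop)
  · exact hm

theorem abs_coalesce_le {Y : Type*} (s : ℤ × ℤ) {h : Y × Y → ℝ} {B : ℝ} (hB : ∀ q, |h q| ≤ B)
    (q : Y × Y) :
    |coalesce s h q| ≤ B := by
  unfold coalesce
  split_ifs
  · exact hB _
  · exact hB _

theorem measurable_tensorQ [IsMarkovKernel f] (hg : IsPotential g C) (n : ℕ) {h : X × X → ℝ}
    (hm : Measurable h) : Measurable (tensorQ f g n h) := by
  refine (((hg.measurable n).comp measurable_fst).mul
    ((hg.measurable n).comp measurable_snd)).mul ?_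
  have h1 := (hm.stronglyMeasurable.integral_kernel (κ := (f.comap Prod.fst measurable_fst) ×ₖ
    (f.comap Prod.snd measurable_snd))).measurable
  simp only [Kernel.prod_apply, Kernel.comap_apply] at h1
  exact h1

theorem abs_tensorQ_le [IsMarkovKernel f] (hg : IsPotential g C) (n : ℕ) {h : X × X → ℝ}
    {B : ℝ} (hB : ∀ q, |h q| ≤ B) (q : X × X) : |tensorQ f g n h q| ≤ C n ^ 2 * B := by
  have h1 := hg.pos n q.1
  have h2 := hg.pos n q.2
  have h3 := hg.le n q.1
  have h4 := hg.le n q.2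
  rw [tensorQ, abs_mul, abs_of_pos (mul_pos h1 h2), sq]
  exact mul_le_mul (mul_le_mul h3 h4 h2.le (h1.le.trans h3)) (abs_integral_le_of_bounded hB)
    (abs_nonneg _) (mul_nonneg (h1.le.trans h3) (h1.le.trans h3))

/-- The joint law of two coordinates of a product measure; the coordinates may coincide. -/
theorem integral_pi_pair (μ : Fin N → Measure X) [∀ i, IsProbabilityMeasure (μ i)] (i l : Fin N)
    {h : X × X → ℝ} (hm : Measurable h) :
    ∫ y, h (y i, y l) ∂(Measure.pi μ) = ∫ q, coalesce (i, l) h q ∂((μ i).prod (μ l)) := by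
  by_cases hil : i = l
  · subst hil
    have hd : Measurable fun x : X => h (x, x) := hm.comp (by fun_prop)
    simp only [coalesce, if_true]
    have e1 := integral_comp_eval (μ := μ) (i := i) (f := fun x => h (x, x))
      hd.aestronglyMeasurable
    have e2 := integral_fun_fst (μ := μ i) (ν := μ i) (f := fun x => h (x, x))
    rw [e1, e2]
    simp
  · have hne : ¬ ((i : ℕ) : ℤ) = (l : ℕ) := by
      simpa [Fin.ext_iff] using hil
    simp only [coalesce, hne, if_false]
    have hind : iIndepFun (fun i (y : Fin N → X) => y i) (Measure.pi μ) :=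
      iIndepFun_pi (X := fun _ x => x) fun i => aemeasurable_id
    have e := (hind.indepFun hil).map_prod_eq_prod_map_map (measurable_pi_apply i).aemeasurable
      (measurable_pi_apply l).aemeasurable
    have ei : ∀ i, (Measure.pi μ).map (fun y : Fin N → X => y i) = μ i := fun i =>
      (measurePreserving_eval μ i).map_eq
    rw [ei, ei] at e
    rw [← e, integral_map (by fun_prop) hm.aestronglyMeasurable]

/-- The weighted mean of a function of two independent draws from the proposals. -/
theorem weight_mul_weight_mul_integral_prod [IsMarkovKernel f] (hg : IsPotential g C)
    (hα : α ∈ doublyStochastic ℝ (Fin N)) (z : ℕ → Fin N → X) (n : ℕ) (i l : Fin N)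
    {h : X × X → ℝ} (hm : Measurable h) {B : ℝ} (hB : ∀ q, |h q| ≤ B) :
    weight α g z (n + 1) i * weight α g z (n + 1) l *
        ∫ q, h q ∂((proposal α f g z n i).prod (proposal α f g z n l)) =
      ∑ j, ∑ j', α i j * α l j' *
        (weight α g z n j * weight α g z n j' * tensorQ f g n h (z n j, z n j')) := by
  have := fun i => isProbabilityMeasure_proposal (f := f) hg hα z n i
  have hin : ∀ (μ : Measure X) [IsProbabilityMeasure μ],
      Measurable fun x => ∫ y, h (x, y) ∂μ := fun μ _ =>
    hm.stronglyMeasurable.integral_prod_right'.measurable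
  have hinB : ∀ (μ : Measure X) [IsProbabilityMeasure μ] (x : X), |∫ y, h (x, y) ∂μ| ≤ B :=
    fun μ _ x => abs_integral_le_of_bounded fun y => hB _
  have step : ∀ x, weight α g z (n + 1) l * ∫ y, h (x, y) ∂(proposal α f g z n l) =
      ∑ j', α l j' * weight α g z n j' * (g n (z n j') * ∫ y, h (x, y) ∂(f (z n j'))) := fun x =>
    weight_mul_integral_proposal hg hα z n l (h := fun y => h (x, y)) (hm.comp (by fun_prop))
      fun y => hB _
  rw [integral_prod _ (integrable_of_bounded hm hB), mul_comm (weight α g z (n + 1) i), mul_assoc,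
    weight_mul_integral_proposal hg hα z n i (hin _) (hinB _), Finset.mul_sum]
  refine Finset.sum_congr rfl fun j _ => ?_
  have : weight α g z (n + 1) l * ∫ x, ∫ y, h (x, y) ∂(proposal α f g z n l) ∂(f (z n j)) =
      ∑ j', α l j' * weight α g z n j' * (g n (z n j') *
        ∫ q, h q ∂((f (z n j)).prod (f (z n j')))) := by
    rw [← integral_const_mul]
    simp_rw [step]
    rw [integral_finsetSum _ fun j' _ => ((integrable_of_bounded (hin _) (hinB _)).const_mul
      _).const_mul _]
    refine Finset.sum_congr rfl fun j' _ => ?_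
    rw [integral_const_mul, integral_const_mul, integral_prod _ (integrable_of_bounded hm hB)]
  calc _ = α i j * weight α g z n j * g n (z n j) * (weight α g z (n + 1) l *
        ∫ x, ∫ y, h (x, y) ∂(proposal α f g z n l) ∂(f (z n j))) := by
        rw [propagate]; ring
    _ = _ := by
        rw [this, Finset.mul_sum]
        refine Finset.sum_congr rfl fun j' _ => ?_
        rw [tensorQ]; ring

theorem weight_mul_weight_mul_integral_nextLaw [IsMarkovKernel f] (hg : IsPotential g C)
    (hα : α ∈ doublyStochastic ℝ (Fin N)) (z : ℕ → Fin N → X) (n : ℕ) (i l : Fin N)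
    {h : X × X → ℝ} (hm : Measurable h) {B : ℝ} (hB : ∀ q, |h q| ≤ B) :
    weight α g z (n + 1) i * weight α g z (n + 1) l * ∫ y, h (y i, y l) ∂(nextLaw α f g z n) =
      ∑ j, ∑ j', α i j * α l j' * (weight α g z n j * weight α g z n j' *
        tensorQ f g n (coalesce (i, l) h) (z n j, z n j')) := by
  have := fun i => isProbabilityMeasure_proposal (f := f) hg hα z n i
  rw [nextLaw, integral_pi_pair _ i l hm, weight_mul_weight_mul_integral_prod hg hα z n i l
    (measurable_coalesce _ hm) (abs_coalesce_le _ hB)]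

/-- The quadratic statistic `∑ᵢₗ Wₙⁱ Wₙˡ Hᵢₗ(zₙⁱ, zₙˡ)`. -/
noncomputable def pairSum (α : Matrix (Fin N) (Fin N) ℝ) (g : ℕ → X → ℝ)
    (H : Fin N → Fin N → X × X → ℝ) (z : ℕ → Fin N → X) (n : ℕ) : ℝ :=
  ∑ i, ∑ l, weight α g z n i * weight α g z n l * H i l (z n i, z n l)

/-- The kernel of the conditional mean of a quadratic statistic, which is again quadratic. -/
noncomputable def pairStep (α : Matrix (Fin N) (Fin N) ℝ) (f : Kernel X X) (g : ℕ → X → ℝ) (n : ℕ)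
    (H : Fin N → Fin N → X × X → ℝ) : Fin N → Fin N → X × X → ℝ :=
  fun j j' q => ∑ i, ∑ l, α i j * α l j' * tensorQ f g n (coalesce (i, l) (H i l)) q

theorem measurable_pairStep [IsMarkovKernel f] (hg : IsPotential g C)
    (α : Matrix (Fin N) (Fin N) ℝ) (n : ℕ)
    {H : Fin N → Fin N → X × X → ℝ} (hm : ∀ i l, Measurable (H i l)) (j j' : Fin N) :
    Measurable (pairStep α f g n H j j') :=
  Finset.measurable_sum _ fun _ _ => Finset.measurable_sum _ fun _ _ =>
    (measurable_tensorQ hg n (measurable_coalesce _ (hm _ _))).const_mul _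

/-- Domination by a multiple of a doubly stochastic matrix `c` is inherited, with the matrix
`αᵀ c α` in place of `c`. -/
theorem abs_pairStep_le [IsMarkovKernel f] (hg : IsPotential g C)
    (hα : α ∈ doublyStochastic ℝ (Fin N)) (n : ℕ) {H : Fin N → Fin N → X × X → ℝ}
    {c : Matrix (Fin N) (Fin N) ℝ} {B : ℝ}
    (hB : ∀ i l q, |H i l q| ≤ B * c i l) (j j' : Fin N) (q : X × X) :
    |pairStep α f g n H j j' q| ≤ C n ^ 2 * B * (α.transpose * c * α) j j' := by
  have e : C n ^ 2 * B * (α.transpose * c * α) j j' =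
      ∑ i, ∑ l, α i j * α l j' * (C n ^ 2 * (B * c i l)) := by
    rw [Finset.sum_comm]
    simp only [Matrix.mul_apply, Matrix.transpose_apply, Finset.mul_sum, Finset.sum_mul]
    exact Finset.sum_congr rfl fun l _ => Finset.sum_congr rfl fun i _ => by ring
  rw [e]
  refine (Finset.abs_sum_le_sum_abs _ _).trans (Finset.sum_le_sum fun i _ => ?_)
  refine (Finset.abs_sum_le_sum_abs _ _).trans (Finset.sum_le_sum fun l _ => ?_)
  have h0 : 0 ≤ α i j * α l j' :=
    mul_nonneg (nonneg_of_mem_doublyStochastic hα) (nonneg_of_mem_doublyStochastic hα)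
  rw [abs_mul, abs_of_nonneg h0]
  exact mul_le_mul_of_nonneg_left (abs_tensorQ_le hg n (abs_coalesce_le _ (hB i l)) q) h0

theorem integral_nextLaw_pair_sum [Nonempty X] [IsMarkovKernel f] (hg : IsPotential g C)
    (hα : α ∈ doublyStochastic ℝ (Fin N)) (z : ℕ → Fin N → X) (n : ℕ)
    {H : Fin N → Fin N → X × X → ℝ} (hm : ∀ i l, Measurable (H i l))
    {c : Matrix (Fin N) (Fin N) ℝ} {B : ℝ} (hB : ∀ i l q, |H i l q| ≤ B * c i l) :
    ∫ y, ∑ i, ∑ l, weight α g z (n + 1) i * weight α g z (n + 1) l * H i l (y i, y l)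
        ∂(nextLaw α f g z n) = pairSum α g (pairStep α f g n H) z n := by
  have := fun i => isProbabilityMeasure_proposal (f := f) hg hα z n i
  have hint : ∀ i l, Integrable (fun y : Fin N → X =>
      weight α g z (n + 1) i * weight α g z (n + 1) l * H i l (y i, y l)) (nextLaw α f g z n) :=
    fun i l => by
      unfold nextLaw
      exact (integrable_of_bounded ((hm i l).comp (by fun_prop)) fun y => hB i l _).const_mul _
  rw [integral_finsetSum _ fun i _ => integrable_finsetSum _ fun l _ => hint i l]
  simp_rw [integral_finsetSum _ fun l _ => hint _ l, integral_const_mul,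
    weight_mul_weight_mul_integral_nextLaw hg hα z n _ _ (hm _ _) (hB _ _), pairSum, pairStep,
    Finset.mul_sum]
  have e : ∀ F : Fin N → Fin N → Fin N → Fin N → ℝ, ∑ i, ∑ l, ∑ j, ∑ j', F i l j j' =
      ∑ j, ∑ j', ∑ i, ∑ l, F i l j j' := fun F => by
    have h1 : ∀ i, ∑ l, ∑ j, ∑ j', F i l j j' = ∑ j, ∑ j', ∑ l, F i l j j' := fun i => by
      rw [Finset.sum_comm]
      exact Finset.sum_congr rfl fun j _ => Finset.sum_comm
    simp_rw [h1]
    rw [Finset.sum_comm]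
    exact Finset.sum_congr rfl fun j _ => Finset.sum_comm
  rw [e]
  refine Finset.sum_congr rfl fun j _ => Finset.sum_congr rfl fun j' _ =>
    Finset.sum_congr rfl fun i _ => Finset.sum_congr rfl fun l _ => by ring

theorem measurable_pairSum (hg : IsPotential g C) (α : Matrix (Fin N) (Fin N) ℝ)
    {H : Fin N → Fin N → X × X → ℝ} (hm : ∀ i l, Measurable (H i l)) (n : ℕ) :
    Measurable fun z : ℕ → Fin N → X => pairSum α g H z n :=
  Finset.measurable_sum _ fun i _ => Finset.measurable_sum _ fun l _ =>
    ((measurable_weight hg α n i).mul (measurable_weight hg α n l)).mul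
      ((hm i l).comp (by fun_prop))

theorem abs_weight_mul_weight_mul_le [Nonempty X] (hg : IsPotential g C)
    (hα : α ∈ doublyStochastic ℝ (Fin N)) {B : ℝ} {b : ℝ} (hb : |b| ≤ B)
    (z : ℕ → Fin N → X) (n : ℕ) (i l : Fin N) :
    |weight α g z n i * weight α g z n l * b| ≤ weightBound C n ^ 2 * B := by
  have h1 := weight_le hg hα z n i
  have h2 := weight_le hg hα z n l
  have h3 := weight_pos hg hα z n i
  have h4 := weight_pos hg hα z n l
  rw [abs_mul, abs_of_pos (mul_pos h3 h4), sq]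
  exact mul_le_mul (mul_le_mul h1 h2 h4.le (h3.le.trans h1)) hb (abs_nonneg _)
    (mul_nonneg (h3.le.trans h1) (h3.le.trans h1))

theorem abs_pairSum_le [Nonempty X] (hg : IsPotential g C)
    (hα : α ∈ doublyStochastic ℝ (Fin N)) {H : Fin N → Fin N → X × X → ℝ}
    {c : Matrix (Fin N) (Fin N) ℝ} (hc : c ∈ doublyStochastic ℝ (Fin N)) {B : ℝ}
    (hB : ∀ i l q, |H i l q| ≤ B * c i l) (z : ℕ → Fin N → X) (n : ℕ) :
    |pairSum α g H z n| ≤ N * (weightBound C n ^ 2 * B) := by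
  refine (Finset.abs_sum_le_sum_abs _ _).trans ?_
  refine (Finset.sum_le_card_nsmul _ _ (weightBound C n ^ 2 * B) fun i _ => ?_).trans (by simp)
  refine (Finset.abs_sum_le_sum_abs _ _).trans ?_
  refine (Finset.sum_le_sum fun l _ =>
    abs_weight_mul_weight_mul_le hg hα (hB i l (z n i, z n l)) z n i l).trans (le_of_eq ?_)
  rw [← Finset.mul_sum, ← Finset.mul_sum, sum_row_of_mem_doublyStochastic hc, mul_one]

theorem integral_sub_sq_eq {Y : Type*} [MeasurableSpace Y] {μ : Measure Y}
    [IsProbabilityMeasure μ] {F : Y → ℝ} (hm : Measurable F) {B : ℝ} (hB : ∀ y, |F y| ≤ B)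
    (a : ℝ) : ∫ y, (F y - a) ^ 2 ∂μ = Var[F; μ] + (∫ y, F y ∂μ - a) ^ 2 := by
  have hL := memLp_of_bounded (μ := μ) hm hB 2
  have i1 := integrable_of_bounded (μ := μ) hm hB
  rw [variance_eq_sub hL]
  have e : ∀ y, (F y - a) ^ 2 = F y ^ 2 - (2 * a) * F y + a ^ 2 := fun y => by ring
  simp_rw [e]
  have i2 : Integrable (fun y => F y ^ 2) μ := hL.integrable_sq
  have i3 : Integrable (fun y => F y ^ 2 - (2 * a) * F y) μ := i2.sub (i1.const_mul _)
  rw [integral_add i3 (integrable_const _), integral_sub i2 (i1.const_mul _),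
    integral_const_mul]
  simp
  ring

theorem measurable_uncurry_pair (hg : IsPotential g C) (α : Matrix (Fin N) (Fin N) ℝ)
    {H : Fin N → Fin N → X × X → ℝ} (hm : ∀ i l, Measurable (H i l)) (n : ℕ) :
    Measurable fun q : (ℕ → Fin N → X) × (Fin N → X) =>
      ∑ i, ∑ l, weight α g q.1 n i * weight α g q.1 n l * H i l (q.2 i, q.2 l) :=
  Finset.measurable_sum _ fun i _ => Finset.measurable_sum _ fun l _ =>
    (((measurable_weight hg α n i).comp measurable_fst).mul
      ((measurable_weight hg α n l).comp measurable_fst)).mul ((hm i l).comp (by fun_prop))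

section ParticleSystem

variable [StandardBorelSpace X] [Nonempty X] {Ω : Type*} [MeasurableSpace Ω] {P : Measure Ω}
  [IsProbabilityMeasure P] {ζ : ℕ → Ω → Fin N → X}

theorem IsParticleSystem.measurable_pairSum (hS : IsParticleSystem π₀ f g α P ζ)
    (hg : IsPotential g C) {H : Fin N → Fin N → X × X → ℝ} (hm : ∀ i l, Measurable (H i l))
    (n : ℕ) : Measurable fun ω => pairSum α g H (fun k => ζ k ω) n :=
  (LocalExchange.measurable_pairSum hg α hm n).comp hS.measurable_path

variable [IsMarkovKernel f]

theorem IsParticleSystem.integral_pairSum_succ (hS : IsParticleSystem π₀ f g α P ζ)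
    (hg : IsPotential g C) (hα : α ∈ doublyStochastic ℝ (Fin N)) (n : ℕ)
    {H : Fin N → Fin N → X × X → ℝ} (hm : ∀ i l, Measurable (H i l))
    {c : Matrix (Fin N) (Fin N) ℝ} (hc : c ∈ doublyStochastic ℝ (Fin N)) {B : ℝ}
    (hB : ∀ i l q, |H i l q| ≤ B * c i l) :
    ∫ ω, pairSum α g H (fun k => ζ k ω) (n + 1) ∂P =
      ∫ ω, pairSum α g (pairStep α f g n H) (fun k => ζ k ω) n ∂P := by
  have e := hS.integral_succ n (G := fun z y =>
    ∑ i, ∑ l, weight α g z (n + 1) i * weight α g z (n + 1) l * H i l (y i, y l))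
    (measurable_uncurry_pair hg α hm (n + 1)) (fun z z' hz => by
      rw [weight_congr α g (n := n + 1) fun k hk => hz k (by omega)])
    (integrable_of_bounded (hS.measurable_pairSum hg hm (n + 1)) fun ω =>
      abs_pairSum_le hg hα hc hB _ _)
  simp only [pairSum] at e ⊢
  rw [e]
  congr 1 with ω
  exact integral_nextLaw_pair_sum hg hα _ n hm hB

variable [IsProbabilityMeasure π₀]

/-- Quadratic statistics concentrate: at each step the conditional variance is of order `N`, and
the conditional mean is a quadratic statistic of the preceding generation. -/
theorem IsParticleSystem.integral_pairSum_sub_sq_le (hS : IsParticleSystem π₀ f g α P ζ)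
    (hg : IsPotential g C) (hα : α ∈ doublyStochastic ℝ (Fin N)) (n : ℕ)
    {H : Fin N → Fin N → X × X → ℝ} (hm : ∀ i l, Measurable (H i l))
    {c : Matrix (Fin N) (Fin N) ℝ} (hc : c ∈ doublyStochastic ℝ (Fin N)) {B : ℝ}
    (hB : ∀ i l q, |H i l q| ≤ B * c i l) :
    ∫ ω, (pairSum α g H (fun k => ζ k ω) n -
      ∫ ω', pairSum α g H (fun k => ζ k ω') n ∂P) ^ 2 ∂P ≤
        (n + 1) * (16 * (weightBound C n ^ 2 * B) ^ 2 * N) := by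
  induction n generalizing H c B with
  | zero =>
    have hF : Measurable fun y : Fin N → X => ∑ i, ∑ l, 1 * 1 * H i l (y i, y l) :=
      Finset.measurable_sum _ fun i _ => Finset.measurable_sum _ fun l _ =>
        ((hm i l).comp (by fun_prop)).const_mul _
    simp only [pairSum, weight]
    rw [hS.integral_zero hF, hS.integral_zero (G := fun y => (∑ i, ∑ l, 1 * 1 * H i l (y i, y l) -
        ∫ y, ∑ i, ∑ l, 1 * 1 * H i l (y i, y l) ∂(Measure.pi fun _ : Fin N => π₀)) ^ 2)
        ((hF.sub_const _).pow_const 2), ← variance_eq_integral hF.aemeasurable]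
    simp only [one_mul]
    refine (variance_pi_sum_sum_le (fun _ : Fin N => π₀) hc hm hB).trans (le_of_eq ?_)
    simp [weightBound]
  | succ n ih =>
    set a := ∫ ω', pairSum α g H (fun k => ζ k ω') (n + 1) ∂P with ha
    have ha' := hS.integral_pairSum_succ hg hα n hm hc hB
    have hK : |a| ≤ N * (weightBound C (n + 1) ^ 2 * B) :=
      abs_integral_le_of_bounded fun ω => abs_pairSum_le hg hα hc hB _ _
    have e := hS.integral_succ n (G := fun z y =>
      (∑ i, ∑ l, weight α g z (n + 1) i * weight α g z (n + 1) l * H i l (y i, y l) - a) ^ 2)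
      (((measurable_uncurry_pair hg α hm (n + 1)).sub_const _).pow_const 2) (fun z z' hz => by
        rw [weight_congr α g (n := n + 1) fun k hk => hz k (by omega)])
      (integrable_of_bounded (B := (2 * (N * (weightBound C (n + 1) ^ 2 * B))) ^ 2)
        (((hS.measurable_pairSum hg hm (n + 1)).sub_const _).pow_const 2) fun ω => by
        rw [Real.norm_eq_abs, abs_pow]
        refine pow_le_pow_left₀ (abs_nonneg _) ((abs_sub _ _).trans ?_) 2
        rw [two_mul]
        exact add_le_add (abs_pairSum_le hg hα hc hB _ _) hK)
    have hmT := measurable_pairStep (f := f) hg α n hm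
    have hcT : α.transpose * c * α ∈ doublyStochastic ℝ (Fin N) :=
      mul_mem (mul_mem (transpose_mem_doublyStochastic_iff.2 hα) hc) hα
    have hBT := abs_pairStep_le (f := f) hg hα n hB
    have inner : ∀ z : ℕ → Fin N → X,
        ∫ y, (∑ i, ∑ l, weight α g z (n + 1) i * weight α g z (n + 1) l * H i l (y i, y l) - a) ^ 2
          ∂(nextLaw α f g z n) ≤ 16 * (weightBound C (n + 1) ^ 2 * B) ^ 2 * N +
            (pairSum α g (pairStep α f g n H) z n - a) ^ 2 := by
      intro z
      have := fun i => isProbabilityMeasure_proposal (f := f) hg hα z n i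
      have hFm : ∀ i l, Measurable fun q : X × X =>
        weight α g z (n + 1) i * weight α g z (n + 1) l * H i l q := fun i l =>
          (hm i l).const_mul _
      have hFB : ∀ i l (q : X × X), |weight α g z (n + 1) i * weight α g z (n + 1) l * H i l q| ≤
          weightBound C (n + 1) ^ 2 * B * c i l := fun i l q =>
        (abs_weight_mul_weight_mul_le hg hα (hB i l q) z (n + 1) i l).trans (le_of_eq (by ring))
      have hv := variance_pi_sum_sum_le (fun i => proposal α f g z n i) hc hFm hFB
      rw [Fintype.card_fin] at hv
      rw [← integral_nextLaw_pair_sum hg hα z n hm hB]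
      unfold nextLaw
      rw [integral_sub_sq_eq (B := ∑ i, ∑ l, weightBound C (n + 1) ^ 2 * B * c i l)]
      · gcongr
      · exact Finset.measurable_sum _ fun i _ => Finset.measurable_sum _ fun l _ =>
          (hFm i l).comp (by fun_prop)
      · exact fun y => (Finset.abs_sum_le_sum_abs _ _).trans (Finset.sum_le_sum fun i _ =>
          (Finset.abs_sum_le_sum_abs _ _).trans (Finset.sum_le_sum fun l _ => hFB i l _))
    have i1 : Integrable (fun ω => (pairSum α g (pairStep α f g n H) (fun k => ζ k ω) n - a) ^ 2)
        P := by
      refine MemLp.integrable_sq (MemLp.sub ?_ (memLp_const _))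
      exact memLp_of_bounded (hS.measurable_pairSum hg hmT n)
        (fun ω => abs_pairSum_le hg hα hcT hBT _ _) 2
    have ihT := ih hmT hcT hBT
    rw [← ha'] at ihT
    calc _ ≤ ∫ ω, (16 * (weightBound C (n + 1) ^ 2 * B) ^ 2 * N +
            (pairSum α g (pairStep α f g n H) (fun k => ζ k ω) n - a) ^ 2) ∂P := by
          simp only [pairSum] at e ⊢
          rw [e]
          exact integral_mono_of_nonneg (ae_of_all _ fun ω => integral_nonneg fun y => sq_nonneg _)
            ((integrable_const _).add i1) (ae_of_all _ fun ω => inner _)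
      _ ≤ 16 * (weightBound C (n + 1) ^ 2 * B) ^ 2 * N +
          (n + 1) * (16 * (weightBound C n ^ 2 * (C n ^ 2 * B)) ^ 2 * N) := by
          rw [integral_add (integrable_const _) i1]
          simpa using ihT
      _ = _ := by
          rw [weightBound_succ]
          push_cast
          ring

end ParticleSystem

end LocalExchange

namespace LocalExchange

/-! ### Gaussian approximation of the characteristic function of weighted sums -/

theorem integral_pi_sum_sq {ι X : Type*} [Fintype ι] [MeasurableSpace X] (μ : ι → Measure X)
    [∀ i, IsProbabilityMeasure (μ i)] {h : ι → X → ℝ} (hm : ∀ i, Measurable (h i)) {D : ℝ}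
    (hD : ∀ i y, |h i y| ≤ D) :
    ∫ y, (∑ i, h i (y i)) ^ 2 ∂(Measure.pi μ) =
      ∑ i, Var[h i; μ i] + (∑ i, ∫ y, h i y ∂μ i) ^ 2 := by
  have hm' : Measurable fun y : ι → X => ∑ i, h i (y i) :=
    Finset.measurable_sum _ fun i _ => (hm i).comp (by fun_prop)
  have hD' : ∀ y : ι → X, |∑ i, h i (y i)| ≤ ∑ _i : ι, D := fun y =>
    (Finset.abs_sum_le_sum_abs _ _).trans (Finset.sum_le_sum fun i _ => hD i _)
  have e := integral_sub_sq_eq (μ := Measure.pi μ) hm' hD' 0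
  simp only [sub_zero] at e
  have hv := variance_sum_pi (μ := μ) (X := h) fun i => memLp_of_bounded (hm i) (hD i) 2
  have hs : (∑ i, fun y : ι → X => h i (y i)) = fun y => ∑ i, h i (y i) := by
    ext y; simp
  rw [hs] at hv
  have hint : ∀ i, Integrable (fun y : ι → X => h i (y i)) (Measure.pi μ) := fun i =>
    integrable_of_bounded ((hm i).comp (measurable_pi_apply i)) fun y => hD i _
  rw [e, hv, integral_finsetSum _ fun i _ => hint i]
  congr 3 with i
  exact integral_comp_eval (μ := μ) (i := i) (f := h i) (hm i).aestronglyMeasurable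

/-- `N` summands of size `E / √N` contribute an error of order `N ^ (-1 / 2)`. -/
theorem mul_charFunRemainder_le {E : ℝ} (hE : 0 ≤ E) {N : ℕ} (hN : 1 ≤ N) :
    N * charFunRemainder (E / √N) ≤ charFunRemainder E / √N := by
  have hN' : (1 : ℝ) ≤ N := by exact_mod_cast hN
  have h1 : 1 ≤ √(N : ℝ) := Real.one_le_sqrt.2 hN'
  have h0 : 0 < √(N : ℝ) := by linarith
  have hs : (N : ℝ) = √N * √N := (Real.mul_self_sqrt (by positivity)).symm
  have hle : E / √N ≤ E := div_le_self hE h1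
  have hle0 : 0 ≤ E / √N := by positivity
  have e1 : Real.exp (2 * (E / √N)) ≤ Real.exp (2 * E) := by gcongr
  have e2 : Real.exp ((E / √N) ^ 2) ≤ Real.exp (E ^ 2) := by gcongr
  unfold charFunRemainder
  calc (N : ℝ) * ((2 * (E / √N)) ^ 3 * Real.exp (2 * (E / √N)) +
        ((E / √N) ^ 2) ^ 2 * Real.exp ((E / √N) ^ 2))
      ≤ N * ((2 * (E / √N)) ^ 3 * Real.exp (2 * E) + ((E / √N) ^ 2) ^ 2 * Real.exp (E ^ 2)) := by
        gcongr
    _ = (2 * E) ^ 3 * Real.exp (2 * E) / √N +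
        (E ^ 2) ^ 2 * Real.exp (E ^ 2) / √N * (1 / √N) := by
        generalize √(N : ℝ) = r at *
        rw [hs]
        field_simp
    _ ≤ (2 * E) ^ 3 * Real.exp (2 * E) / √N + (E ^ 2) ^ 2 * Real.exp (E ^ 2) / √N * 1 := by
        gcongr
        rw [div_le_one h0]
        exact h1
    _ = _ := by ring

theorem abs_exp_neg_sub_exp_neg_le {a b : ℝ} (ha : 0 ≤ a) (hb : 0 ≤ b) :
    |Real.exp (-a) - Real.exp (-b)| ≤ |a - b| := by
  wlog hab : a ≤ b generalizing a b
  · rw [abs_sub_comm, abs_sub_comm a]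
    exact this hb ha (le_of_not_ge hab)
  have h1 : Real.exp (-b) ≤ Real.exp (-a) := by gcongr
  rw [abs_of_nonneg (by linarith), abs_of_nonpos (by linarith)]
  have h2 : Real.exp (-b) = Real.exp (-a) * Real.exp (-(b - a)) := by
    rw [← Real.exp_add]; ring_nf
  have h3 := Real.add_one_le_exp (-(b - a))
  have h4 : Real.exp (-a) ≤ 1 := Real.exp_le_one_iff.2 (by linarith)
  have h5 := Real.exp_pos (-a)
  have h6 : Real.exp (-(b - a)) ≤ 1 := Real.exp_le_one_iff.2 (by linarith)
  rw [h2]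
  nlinarith

variable {X : Type*} [MeasurableSpace X] {π₀ : Measure X} {f : Kernel X X} {g : ℕ → X → ℝ}
  {C : ℕ → ℝ} {N : ℕ} {α : Matrix (Fin N) (Fin N) ℝ}

/-- The kernel of the conditional variance of a weighted sum, as a quadratic statistic of the
preceding generation. -/
noncomputable def condVarKernel (α : Matrix (Fin N) (Fin N) ℝ) (f : Kernel X X) (g : ℕ → X → ℝ)
    (n : ℕ) (h : X → ℝ) : Fin N → Fin N → X × X → ℝ :=
  fun j j' q => (α.transpose * α) j j' * (g n q.2 * propagate f g n (fun x => h x ^ 2) q.1 -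
    propagate f g n h q.1 * propagate f g n h q.2)

theorem measurable_condVarKernel (hg : IsPotential g C) (α : Matrix (Fin N) (Fin N) ℝ) (n : ℕ)
    {h : X → ℝ} (hm : Measurable h) (j j' : Fin N) :
    Measurable (condVarKernel α f g n h j j') :=
  (((((hg.measurable n).comp measurable_snd).mul
    ((measurable_propagate hg n (hm.pow_const 2)).comp measurable_fst)).sub
    (((measurable_propagate hg n hm).comp measurable_fst).mul
    ((measurable_propagate hg n hm).comp measurable_snd))).const_mul _)

theorem abs_condVarKernel_le [IsMarkovKernel f] (hg : IsPotential g C)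
    (hα : α ∈ doublyStochastic ℝ (Fin N)) (n : ℕ) {h : X → ℝ} {B : ℝ} (hB : ∀ x, |h x| ≤ B)
    (j j' : Fin N) (q : X × X) :
    |condVarKernel α f g n h j j' q| ≤ (2 * (C n * B) ^ 2) * (α.transpose * α) j j' := by
  have hc : α.transpose * α ∈ doublyStochastic ℝ (Fin N) :=
    mul_mem (transpose_mem_doublyStochastic_iff.2 hα) hα
  have h0 : 0 ≤ (α.transpose * α) j j' := nonneg_of_mem_doublyStochastic hc
  have hB2 : ∀ x, |h x ^ 2| ≤ B ^ 2 := fun x => by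
    rw [abs_pow]; exact pow_le_pow_left₀ (abs_nonneg _) (hB x) 2
  rw [condVarKernel, abs_mul, abs_of_nonneg h0, mul_comm]
  refine mul_le_mul_of_nonneg_right ?_ h0
  have h1 : |g n q.2 * propagate f g n (fun x => h x ^ 2) q.1| ≤ C n * (C n * B ^ 2) := by
    rw [abs_mul, abs_of_pos (hg.pos n _)]
    exact mul_le_mul (hg.le n _) (abs_propagate_le hg n hB2 _) (abs_nonneg _)
      ((hg.pos n q.2).le.trans (hg.le n _))
  have h2 : |propagate f g n h q.1 * propagate f g n h q.2| ≤ (C n * B) * (C n * B) := by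
    rw [abs_mul]
    have := abs_propagate_le (f := f) hg n hB q.1
    exact mul_le_mul this (abs_propagate_le hg n hB _) (abs_nonneg _) ((abs_nonneg _).trans this)
  refine (abs_sub _ _).trans ?_
  linarith

/-- The conditional variance of a weighted sum is a quadratic statistic of the preceding
generation. -/
theorem sum_variance_proposal [Nonempty X] [IsMarkovKernel f] (hg : IsPotential g C)
    (hα : α ∈ doublyStochastic ℝ (Fin N)) (z : ℕ → Fin N → X) (n : ℕ) {h : X → ℝ}
    (hm : Measurable h) {B : ℝ} (hB : ∀ x, |h x| ≤ B) :
    ∑ i, Var[fun x => weight α g z (n + 1) i * h x; proposal α f g z n i] =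
      pairSum α g (condVarKernel α f g n h) z n := by
  have := fun i => isProbabilityMeasure_proposal (f := f) hg hα z n i
  have hB2 : ∀ x, |h x ^ 2| ≤ B ^ 2 := fun x => by
    rw [abs_pow]; exact pow_le_pow_left₀ (abs_nonneg _) (hB x) 2
  have e : ∀ i, Var[fun x => weight α g z (n + 1) i * h x; proposal α f g z n i] =
      ∑ j, ∑ j', α i j * α i j' * (weight α g z n j * weight α g z n j' *
        (g n (z n j') * propagate f g n (fun x => h x ^ 2) (z n j) -
          propagate f g n h (z n j) * propagate f g n h (z n j'))) := by
    intro i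
    rw [variance_const_mul, variance_eq_sub (memLp_of_bounded hm hB 2)]
    have e1 := weight_mul_integral_proposal (f := f) hg hα z n i hm hB
    have e2 := weight_mul_integral_proposal (f := f) hg hα z n i (hm.pow_const 2) hB2
    have e3 : weight α g z (n + 1) i = ∑ j', α i j' * weight α g z n j' * g n (z n j') := rfl
    simp only [Pi.pow_apply]
    calc _ = (weight α g z (n + 1) i * ∫ x, h x ^ 2 ∂(proposal α f g z n i)) *
          weight α g z (n + 1) i - (weight α g z (n + 1) i * ∫ x, h x ∂(proposal α f g z n i)) *
          (weight α g z (n + 1) i * ∫ x, h x ∂(proposal α f g z n i)) := by ring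
      _ = _ := by
          rw [e1, e2, e3, Finset.sum_mul_sum, Finset.sum_mul_sum, ← Finset.sum_sub_distrib]
          refine Finset.sum_congr rfl fun j _ => ?_
          rw [← Finset.sum_sub_distrib]
          exact Finset.sum_congr rfl fun j' _ => by ring
  simp_rw [e]
  rw [Finset.sum_comm, pairSum]
  refine Finset.sum_congr rfl fun j _ => ?_
  rw [Finset.sum_comm]
  refine Finset.sum_congr rfl fun j' _ => ?_
  rw [← Finset.sum_mul, condVarKernel, Matrix.mul_apply]
  simp only [Matrix.transpose_apply]
  ring

variable [StandardBorelSpace X] [Nonempty X] {Ω : Type*} [MeasurableSpace Ω] {P : Measure Ω}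
  [IsProbabilityMeasure P] {ζ : ℕ → Ω → Fin N → X} [IsMarkovKernel f]

/-- The decomposition of the second moment into those of the conditional mean and of the
conditional fluctuations. -/
theorem IsParticleSystem.integral_weightedSum_sq_succ (hS : IsParticleSystem π₀ f g α P ζ)
    (hg : IsPotential g C) (hα : α ∈ doublyStochastic ℝ (Fin N)) (n : ℕ) {h : X → ℝ}
    (hm : Measurable h) {B : ℝ} (hB : ∀ x, |h x| ≤ B) :
    ∫ ω, weightedSum α g h (fun k => ζ k ω) (n + 1) ^ 2 ∂P =
      ∫ ω, weightedSum α g (propagate f g n h) (fun k => ζ k ω) n ^ 2 ∂P +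
      ∫ ω, pairSum α g (condVarKernel α f g n h) (fun k => ζ k ω) n ∂P := by
  have hsq : ∀ (n : ℕ) {h : X → ℝ}, Measurable h → ∀ {B : ℝ}, (∀ x, |h x| ≤ B) →
      Integrable (fun ω => weightedSum α g h (fun k => ζ k ω) n ^ 2) P := fun n h hm B hB =>
    (memLp_of_bounded (hS.measurable_weightedSum hg hm n)
      (fun ω => abs_weightedSum_le hg hα hB _ n) 2).integrable_sq
  have e := hS.integral_succ n (G := fun z y => (∑ i, weight α g z (n + 1) i * h (y i)) ^ 2)
    ((uncurry_weight_measurable hg α hm (n + 1)).pow_const 2) (fun z z' hz => by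
      rw [weight_congr α g (n := n + 1) fun k hk => hz k (by omega)]) (hsq (n + 1) hm hB)
  have hc : α.transpose * α ∈ doublyStochastic ℝ (Fin N) :=
    mul_mem (transpose_mem_doublyStochastic_iff.2 hα) hα
  have i2 : Integrable (fun ω => pairSum α g (condVarKernel α f g n h) (fun k => ζ k ω) n) P :=
    integrable_of_bounded (hS.measurable_pairSum hg (measurable_condVarKernel hg α n hm) n)
      fun ω => abs_pairSum_le hg hα hc (abs_condVarKernel_le hg hα n hB) _ n
  rw [← integral_add (hsq n (measurable_propagate hg n hm) (abs_propagate_le hg n hB)) i2]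
  simp only [weightedSum] at e ⊢
  rw [e]
  congr 1 with ω
  have := fun i => isProbabilityMeasure_proposal (f := f) hg hα (fun k => ζ k ω) n i
  have e2 := integral_pi_sum_sq (fun i => proposal α f g (fun k => ζ k ω) n i)
    (h := fun i x => weight α g (fun k => ζ k ω) (n + 1) i * h x) (fun i => hm.const_mul _)
    fun i x => abs_weight_mul_le hg hα hB (fun k => ζ k ω) (n + 1) i x
  unfold nextLaw
  rw [e2, sum_variance_proposal hg hα _ n hm hB]
  simp_rw [integral_const_mul]
  rw [sum_weight_mul_integral_proposal hg hα _ n hm hB, weightedSum, add_comm]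

variable [IsProbabilityMeasure π₀]

/-- The characteristic function of a normalised weighted sum of a centred test function is close to
that of the Gaussian law with the same variance, uniformly over the matrices and the test
functions with a given bound. One time step is treated as a conditional central limit theorem whose
variance is almost deterministic. -/
theorem exists_norm_charFun_sub_le (π₀ : Measure X) [IsProbabilityMeasure π₀] (f : Kernel X X)
    [IsMarkovKernel f] (hg : IsPotential g C) (t : ℝ) (n : ℕ) (B : ℝ) :
    ∃ L : ℝ, ∀ {N : ℕ}, 1 ≤ N → ∀ {α : Matrix (Fin N) (Fin N) ℝ},
      α ∈ doublyStochastic ℝ (Fin N) → ∀ {Ω : Type*} [MeasurableSpace Ω] {P : Measure Ω}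
      [IsProbabilityMeasure P] {ζ : ℕ → Ω → Fin N → X}, IsParticleSystem π₀ f g α P ζ →
      ∀ {h : X → ℝ}, Measurable h → (∀ x, |h x| ≤ B) → ∫ x, h x ∂(unnormFilter π₀ f g n) = 0 →
      ‖∫ ω, Complex.exp ((t / √N * weightedSum α g h (fun k => ζ k ω) n : ℝ) * Complex.I) ∂P -
        Complex.exp ((-((t / √N) ^ 2 *
          (∫ ω, weightedSum α g h (fun k => ζ k ω) n ^ 2 ∂P) / 2) : ℝ))‖ ≤ L / √N := by
  induction n generalizing B with
  | zero =>
    refine ⟨charFunRemainder (|t| * |B|), fun {N} hN {α} hα {Ω} _ {P} _ {ζ} hS {h} hm hB hγ => ?_⟩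
    have hγ' : ∫ x, h x ∂π₀ = 0 := hγ
    have e2 : ∫ ω, weightedSum α g h (fun k => ζ k ω) 0 ^ 2 ∂P = N * Var[h; π₀] := by
      simp only [weightedSum, weight, one_mul]
      have hF : Measurable fun y : Fin N → X => (∑ i, h (y i)) ^ 2 :=
        (Finset.measurable_sum _ fun i _ => hm.comp (by fun_prop)).pow_const 2
      rw [hS.integral_zero hF, integral_pi_sum_sq (fun _ : Fin N => π₀) (fun _ => hm)
        fun _ x => hB x]
      simp [hγ']
    rw [e2]
    have hF : Measurable fun y : Fin N → X =>
        Complex.exp ((t / √N * ∑ i, h (y i) : ℝ) * Complex.I) := by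
      have : Measurable fun y : Fin N → X => ∑ i, h (y i) :=
        Finset.measurable_sum _ fun i _ => hm.comp (by fun_prop)
      fun_prop
    simp only [weightedSum, weight, one_mul]
    rw [hS.integral_zero hF]
    have key := norm_integral_pi_exp_sub_exp_le (fun _ : Fin N => π₀)
      (h := fun _ x => t / √N * h x) (fun _ => hm.const_mul _) (D := |t| * |B| / √N) fun _ x => by
        rw [abs_mul, abs_div, abs_of_nonneg (Real.sqrt_nonneg _), div_mul_eq_mul_div]
        refine div_le_div_of_nonneg_right (mul_le_mul_of_nonneg_left ?_ (abs_nonneg t))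
          (Real.sqrt_nonneg _)
        exact (hB x).trans (le_abs_self B)
    refine le_trans (le_of_eq ?_) (key.trans ?_)
    · congr 2
      · simp only [Finset.mul_sum]
      · simp only [integral_const_mul, hγ', mul_zero, Finset.sum_const_zero, Complex.ofReal_zero,
          zero_mul, zero_sub, variance_const_mul, Finset.sum_const, Finset.card_univ,
          Fintype.card_fin, nsmul_eq_mul]
        congr 1
        push_cast
        ring
    · rw [Fintype.card_fin]
      exact mul_charFunRemainder_le (by positivity) hN
  | succ n ih =>
    obtain ⟨L, hL⟩ := ih (C n * B)
    set K := weightBound C (n + 1) with hK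
    set V := weightBound C n ^ 2 * (2 * (C n * B) ^ 2) with hV
    refine ⟨charFunRemainder (|t| * |K * B|) + t ^ 2 / 2 * √((n + 1) * (16 * V ^ 2)) + L,
      fun {N} hN {α} hα {Ω} _ {P} _ {ζ} hS {h} hm hB hγ => ?_⟩
    have hN0 : (0 : ℝ) < N := by exact_mod_cast hN
    set s := t / √(N : ℝ) with hs
    have hs2 : s ^ 2 = t ^ 2 / N := by rw [hs, div_pow, Real.sq_sqrt hN0.le]
    have hQm := measurable_propagate (f := f) hg n hm
    have hQB : ∀ x, |propagate f g n h x| ≤ C n * B := abs_propagate_le hg n hB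
    have hγ' : ∫ x, propagate f g n h x ∂(unnormFilter π₀ f g n) = 0 := by
      rw [← integral_unnormFilter_succ hg n hm hB]; exact hγ
    have hc : α.transpose * α ∈ doublyStochastic ℝ (Fin N) :=
      mul_mem (transpose_mem_doublyStochastic_iff.2 hα) hα
    have hVm := measurable_condVarKernel (f := f) hg α n hm
    have hVB := abs_condVarKernel_le (f := f) hg hα n hB
    set S : Ω → ℝ := fun ω => weightedSum α g (propagate f g n h) (fun k => ζ k ω) n with hSdef
    set W : Ω → ℝ := fun ω => pairSum α g (condVarKernel α f g n h) (fun k => ζ k ω) n with hWdef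
    have hSm : Measurable S := hS.measurable_weightedSum hg hQm n
    have hWm : Measurable W := hS.measurable_pairSum hg hVm n
    have hWB : ∀ ω, |W ω| ≤ N * V := fun ω => abs_pairSum_le hg hα hc hVB _ n
    have hW0 : ∀ ω, 0 ≤ W ω := fun ω => by
      rw [hWdef]
      simp only
      rw [← sum_variance_proposal hg hα _ n hm hB]
      exact Finset.sum_nonneg fun i _ => variance_nonneg _ _
    set w := ∫ ω, W ω ∂P with hw
    have hw0 : 0 ≤ w := integral_nonneg hW0
    have eV : ∫ ω, weightedSum α g h (fun k => ζ k ω) (n + 1) ^ 2 ∂P = ∫ ω, S ω ^ 2 ∂P + w :=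
      hS.integral_weightedSum_sq_succ hg hα n hm hB
    rw [eV]
    set v := ∫ ω, S ω ^ 2 ∂P with hv
    have i2 : Integrable (fun ω => Complex.exp ((s * S ω : ℝ) * Complex.I -
        (s ^ 2 * W ω / 2 : ℝ))) P := by
      refine integrable_of_bounded (B := 1) (by fun_prop) fun ω => ?_
      rw [Complex.norm_exp]
      have := hW0 ω
      simp only [Complex.sub_re, Complex.mul_re, Complex.ofReal_re, Complex.I_re, mul_zero,
        Complex.ofReal_im, Complex.I_im, zero_mul, sub_zero, Real.exp_le_one_iff]
      have : 0 ≤ s ^ 2 * W ω / 2 := by positivity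
      linarith
    -- Conditionally on the history, the last generation is a sum of independent variables.
    have step1 : ‖∫ ω, Complex.exp ((s * weightedSum α g h (fun k => ζ k ω) (n + 1) : ℝ) *
        Complex.I) ∂P - ∫ ω, Complex.exp ((s * S ω : ℝ) * Complex.I - (s ^ 2 * W ω / 2 : ℝ)) ∂P‖ ≤
        charFunRemainder (|t| * |K * B|) / √N := by
      have hGm : Measurable fun q : (ℕ → Fin N → X) × (Fin N → X) =>
          Complex.exp ((s * ∑ i, weight α g q.1 (n + 1) i * h (q.2 i) : ℝ) * Complex.I) := by
        have := uncurry_weight_measurable hg α hm (n + 1)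
        fun_prop
      have hcm : ∀ {Y : Ω → ℝ}, Measurable Y →
          Measurable fun ω => Complex.exp ((s * Y ω : ℝ) * Complex.I) := fun hY => by fun_prop
      have e := hS.integral_succ n (G := fun z y =>
        Complex.exp ((s * ∑ i, weight α g z (n + 1) i * h (y i) : ℝ) * Complex.I)) hGm
        (fun z z' hz => by
          rw [weight_congr α g (n := n + 1) fun k hk => hz k (by omega)])
        (integrable_of_bounded (B := 1) (hcm (hS.measurable_weightedSum hg hm (n + 1))) fun ω => by
          rw [Complex.norm_exp_ofReal_mul_I])
      have inner : ∀ z : ℕ → Fin N → X,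
          ‖∫ y, Complex.exp ((s * ∑ i, weight α g z (n + 1) i * h (y i) : ℝ) * Complex.I)
              ∂(nextLaw α f g z n) -
            Complex.exp ((s * weightedSum α g (propagate f g n h) z n : ℝ) * Complex.I -
              (s ^ 2 * pairSum α g (condVarKernel α f g n h) z n / 2 : ℝ))‖ ≤
            charFunRemainder (|t| * |K * B|) / √N := by
        intro z
        have := fun i => isProbabilityMeasure_proposal (f := f) hg hα z n i
        have key := norm_integral_pi_exp_sub_exp_le (fun i => proposal α f g z n i)
          (h := fun i x => s * (weight α g z (n + 1) i * h x)) (fun _ => by fun_prop)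
          (D := |t| * |K * B| / √N) fun i x => by
            rw [abs_mul, hs, abs_div, abs_of_nonneg (Real.sqrt_nonneg _), div_mul_eq_mul_div]
            refine div_le_div_of_nonneg_right (mul_le_mul_of_nonneg_left ?_ (abs_nonneg t))
              (Real.sqrt_nonneg _)
            exact (abs_weight_mul_le hg hα hB z (n + 1) i x).trans (le_abs_self _)
        refine le_trans (le_of_eq ?_) (key.trans ?_)
        · unfold nextLaw
          simp_rw [variance_const_mul s, ← Finset.mul_sum]
          rw [sum_variance_proposal hg hα z n hm hB]
          simp_rw [integral_const_mul, ← Finset.mul_sum]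
          rw [sum_weight_mul_integral_proposal hg hα z n hm hB]
        · rw [Fintype.card_fin]
          exact mul_charFunRemainder_le (by positivity) hN
      have i1 : Integrable (fun ω => ∫ y, Complex.exp ((s * ∑ i,
          weight α g (fun k => ζ k ω) (n + 1) i * h (y i) : ℝ) * Complex.I)
            ∂(nextLaw α f g (fun k => ζ k ω) n)) P := by
        refine hS.integrable_succ n (G := fun z y =>
          Complex.exp ((s * ∑ i, weight α g z (n + 1) i * h (y i) : ℝ) * Complex.I)) hGm
          (fun z z' hz => by
            rw [weight_congr α g (n := n + 1) fun k hk => hz k (by omega)])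
          (integrable_of_bounded (B := 1) (hcm (hS.measurable_weightedSum hg hm (n + 1)))
            fun ω => by rw [Complex.norm_exp_ofReal_mul_I])
      simp only [weightedSum] at e ⊢
      rw [e, ← integral_sub i1 i2]
      exact (norm_integral_le_of_norm_le_const (ae_of_all _ fun ω => inner _)).trans (by simp)
    -- The conditional variance concentrates, so that it may be replaced by its mean `w`.
    have step2 : ‖∫ ω, Complex.exp ((s * S ω : ℝ) * Complex.I - (s ^ 2 * W ω / 2 : ℝ)) ∂P -
        Complex.exp (-(s ^ 2 * w / 2 : ℝ)) * ∫ ω, Complex.exp ((s * S ω : ℝ) * Complex.I) ∂P‖ ≤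
        t ^ 2 / 2 * √((n + 1) * (16 * V ^ 2)) / √N := by
      have i3 : Integrable (fun ω => Complex.exp ((s * S ω : ℝ) * Complex.I)) P :=
        integrable_of_bounded (B := 1) (by fun_prop) fun ω => by
          rw [Complex.norm_exp_ofReal_mul_I]
      have hWd : Measurable fun ω => W ω - w := hWm.sub_const _
      have hWL : MemLp (fun ω => W ω - w) 2 P := (memLp_of_bounded hWm hWB 2).sub (memLp_const _)
      have hL1 : ∫ ω, |W ω - w| ∂P ≤ √((n + 1) * (16 * V ^ 2) * N) := by
        have hcc := hS.integral_pairSum_sub_sq_le hg hα n hVm hc hVB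
        refine Real.le_sqrt_of_sq_le ?_
        have hJ : (∫ ω, |W ω - w| ∂P) ^ 2 ≤ ∫ ω, |W ω - w| ^ 2 ∂P := by
          have hv := variance_nonneg (fun ω => |W ω - w|) P
          rw [variance_eq_sub (X := fun ω => |W ω - w|) hWL.abs] at hv
          simp only [Pi.pow_apply] at hv
          linarith
        refine hJ.trans ?_
        simp only [sq_abs]
        refine hcc.trans (le_of_eq ?_)
        rw [hV]; ring
      rw [← integral_const_mul, ← integral_sub i2 (i3.const_mul _)]
      have pt : ∀ ω, ‖Complex.exp ((s * S ω : ℝ) * Complex.I - (s ^ 2 * W ω / 2 : ℝ)) -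
          Complex.exp (-(s ^ 2 * w / 2 : ℝ)) * Complex.exp ((s * S ω : ℝ) * Complex.I)‖ ≤
          s ^ 2 / 2 * |W ω - w| := by
        intro ω
        have hWω := hW0 ω
        have e : Complex.exp ((s * S ω : ℝ) * Complex.I - (s ^ 2 * W ω / 2 : ℝ)) -
          Complex.exp (-(s ^ 2 * w / 2 : ℝ)) * Complex.exp ((s * S ω : ℝ) * Complex.I) =
          Complex.exp ((s * S ω : ℝ) * Complex.I) *
            ((Real.exp (-(s ^ 2 * W ω / 2)) - Real.exp (-(s ^ 2 * w / 2)) : ℝ) : ℂ) := by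
          rw [sub_eq_add_neg ((s * S ω : ℝ) * Complex.I : ℂ), Complex.exp_add]
          push_cast
          ring
        rw [e, norm_mul, Complex.norm_exp_ofReal_mul_I, one_mul, Complex.norm_real]
        refine (abs_exp_neg_sub_exp_neg_le (by positivity) (by positivity)).trans (le_of_eq ?_)
        rw [show s ^ 2 * W ω / 2 - s ^ 2 * w / 2 = s ^ 2 / 2 * (W ω - w) by ring, abs_mul,
          abs_of_nonneg (by positivity)]
      refine (norm_integral_le_of_norm_le ((hWL.integrable (by norm_num)).abs.const_mul _)
        (ae_of_all _ pt)).trans ?_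
      rw [integral_const_mul]
      calc s ^ 2 / 2 * ∫ ω, |W ω - w| ∂P ≤ s ^ 2 / 2 * √((n + 1) * (16 * V ^ 2) * N) := by gcongr
        _ = _ := by
          have hsN : (N : ℝ) = √N * √N := (Real.mul_self_sqrt hN0.le).symm
          have hsN0 : √(N : ℝ) ≠ 0 := by positivity
          rw [Real.sqrt_mul (by positivity), hs2]
          nth_rewrite 1 [hsN]
          field_simp
    -- What is left is the weighted sum of the propagated function one step earlier.
    have step3 := hL hN hα hS hQm hQB hγ'
    have e3 : Complex.exp ((-(s ^ 2 * (v + w) / 2) : ℝ)) = Complex.exp (-(s ^ 2 * w / 2 : ℝ)) *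
        Complex.exp ((-(s ^ 2 * v / 2) : ℝ)) := by
      rw [← Complex.exp_add]; congr 1; push_cast; ring
    have step3' : ‖Complex.exp (-(s ^ 2 * w / 2 : ℝ)) *
        ∫ ω, Complex.exp ((s * S ω : ℝ) * Complex.I) ∂P -
        Complex.exp ((-(s ^ 2 * (v + w) / 2) : ℝ))‖ ≤ L / √N := by
      rw [e3, ← mul_sub, norm_mul]
      refine (mul_le_of_le_one_left (norm_nonneg _) ?_).trans step3
      rw [← Complex.ofReal_neg, ← Complex.ofReal_exp, Complex.norm_real,
        Real.norm_of_nonneg (Real.exp_pos _).le, Real.exp_le_one_iff]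
      have : 0 ≤ s ^ 2 * w / 2 := by positivity
      linarith
    have := norm_sub_le_norm_sub_add_norm_sub
      (∫ ω, Complex.exp ((s * weightedSum α g h (fun k => ζ k ω) (n + 1) : ℝ) * Complex.I) ∂P)
      (∫ ω, Complex.exp ((s * S ω : ℝ) * Complex.I - (s ^ 2 * W ω / 2 : ℝ)) ∂P)
      (Complex.exp ((-(s ^ 2 * (v + w) / 2) : ℝ)))
    have h2 := norm_sub_le_norm_sub_add_norm_sub
      (∫ ω, Complex.exp ((s * S ω : ℝ) * Complex.I - (s ^ 2 * W ω / 2 : ℝ)) ∂P)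
      (Complex.exp (-(s ^ 2 * w / 2 : ℝ)) * ∫ ω, Complex.exp ((s * S ω : ℝ) * Complex.I) ∂P)
      (Complex.exp ((-(s ^ 2 * (v + w) / 2) : ℝ)))
    rw [add_div, add_div]
    linarith

end LocalExchange

namespace LocalExchange

/-! ### Second moments of pairs of particles -/

variable {X : Type*} [MeasurableSpace X] {π₀ : Measure X} {f : Kernel X X} {g : ℕ → X → ℝ}
  {C : ℕ → ℝ} {N : ℕ} {α : Matrix (Fin N) (Fin N) ℝ}

/-- The moment `𝔼[Wₙᵘ Wₙᵛ h(ζₙᵘ, ζₙᵛ)]`, computed by tracing the genealogies of the particles `u`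
and `v` backwards. -/
noncomputable def pairMoment (π₀ : Measure X) (f : Kernel X X) (g : ℕ → X → ℝ)
    (α : Matrix (Fin N) (Fin N) ℝ) : ℕ → Fin N → Fin N → (X × X → ℝ) → ℝ
  | 0, u, v, h => ∫ q, coalesce (u, v) h q ∂(π₀.prod π₀)
  | n + 1, u, v, h => ∑ j, ∑ j', α u j * α v j' *
      pairMoment π₀ f g α n j j' (tensorQ f g n (coalesce (u, v) h))

/-- The analogue of `pairMoment` for labels in `ℤ` and a matrix of bandwidth `β`. -/
noncomputable def latticeMoment (π₀ : Measure X) (f : Kernel X X) (g : ℕ → X → ℝ)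
    (αinf : ℤ → ℤ → ℝ) (β : ℕ) : ℕ → ℤ → ℤ → (X × X → ℝ) → ℝ
  | 0, u, v, h => ∫ q, coalesce (u, v) h q ∂(π₀.prod π₀)
  | n + 1, u, v, h => ∑ d ∈ Finset.Icc (-(β : ℤ)) β, ∑ e ∈ Finset.Icc (-(β : ℤ)) β,
      αinf u (u + d) * αinf v (v + e) *
        latticeMoment π₀ f g αinf β n (u + d) (v + e) (tensorQ f g n (coalesce (u, v) h))

/-- The sum over the paths of the backward chain, evaluated one step at a time. Since `αinf` has
bandwidth `β`, only finitely many paths contribute, so that the sum is a genuine one. -/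
theorem hasSum_pathProb_mul {αinf : ℤ → ℤ → ℝ} {β : ℕ}
    (hβ : ∀ i j : ℤ, (β : ℤ) < |i - j| → αinf i j = 0) (n : ℕ) (u v : ℤ) (h : X × X → ℝ) :
    HasSum (fun s => pathProb αinf n u v s * ∫ q, tensorFlow f g n s h q ∂(π₀.prod π₀))
      (latticeMoment π₀ f g αinf β n u v h) := by
  induction n generalizing u v h with
  | zero =>
    have := hasSum_single (f := fun s : Fin 1 → ℤ × ℤ =>
      pathProb αinf 0 u v s * ∫ q, tensorFlow f g 0 s h q ∂(π₀.prod π₀)) (fun _ => (u, v))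
      fun s hs => by
        have : s (Fin.last 0) ≠ (u, v) := fun h0 =>
          hs (by ext i : 1; rw [← h0, Subsingleton.elim i])
        rw [pathProb, if_neg this, zero_mul]
    simpa [pathProb, tensorFlow, latticeMoment] using this
  | succ n ih =>
    set h' := tensorQ f g n (coalesce (u, v) h) with hh'
    have hinj : Function.Injective fun s : Fin (n + 1) → ℤ × ℤ =>
        (Fin.snoc s (u, v) : Fin (n + 2) → ℤ × ℤ) := fun s s' hs => by
      have := congrArg Fin.init hs
      simpa using this
    refine (hinj.hasSum_iff fun s hs => ?_).1 ?_
    · have : s (Fin.last (n + 1)) ≠ (u, v) := fun h0 => hs ⟨Fin.init s, by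
        simp only [← h0, Fin.snoc_init_self]⟩
      simp [pathProb, this]
    · have hs := hasSum_sum (s := Finset.Icc (-(β : ℤ)) β) fun d _ =>
        hasSum_sum (s := Finset.Icc (-(β : ℤ)) β) fun e _ =>
          (ih (u + d) (v + e) h').mul_left (αinf u (u + d) * αinf v (v + e))
      rw [latticeMoment]
      refine hs.congr_fun fun s => ?_
      simp only [Function.comp_apply, tensorFlow, Fin.init_snoc, Fin.snoc_last]
      rw [← hh']
      simp_rw [← mul_assoc, ← Finset.sum_mul]
      congr 1
      -- Only the steps `d`, `e` that lead to the last position `a` of the path `s` contribute.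
      set a := s (Fin.last n) with ha
      set p := ∏ k : Fin n, αinf (s k.succ).1 (s k.castSucc).1 *
        αinf (s k.succ).2 (s k.castSucc).2 with hp
      have e1 : pathProb αinf (n + 1) u v (Fin.snoc s (u, v)) = p * (αinf u a.1 * αinf v a.2) := by
        simp only [pathProb, Fin.snoc_last, if_true]
        rw [Fin.prod_univ_castSucc]
        congr 1
        · refine Finset.prod_congr rfl fun k _ => ?_
          rw [Fin.succ_castSucc, Fin.snoc_castSucc, Fin.snoc_castSucc]
        · rw [Fin.succ_last, Fin.snoc_last, Fin.snoc_castSucc]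
      have e2 : ∀ d e, αinf u (u + d) * αinf v (v + e) * pathProb αinf n (u + d) (v + e) s =
          if d = a.1 - u then
            (if e = a.2 - v then p * (αinf u a.1 * αinf v a.2) else 0) else 0 := by
        intro d e
        by_cases hd : d = a.1 - u
        · by_cases he : e = a.2 - v
          · have : s (Fin.last n) = (u + d, v + e) := by
              rw [← ha, hd, he]; ext <;> simp
            simp only [pathProb, this, if_true, hd, he]
            rw [← hp]
            simp
            ring
          · have : s (Fin.last n) ≠ (u + d, v + e) := fun h0 => he (by
              rw [ha, h0]; simp)
            simp [pathProb, this, he]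
        · have : s (Fin.last n) ≠ (u + d, v + e) := fun h0 => hd (by
            rw [ha, h0]; simp)
          simp [pathProb, this, hd]
      simp_rw [e2, e1]
      by_cases hd : a.1 - u ∈ Finset.Icc (-(β : ℤ)) β
      · by_cases he : a.2 - v ∈ Finset.Icc (-(β : ℤ)) β
        · simp [Finset.sum_ite_eq', hd, he]
        · have : αinf v a.2 = 0 := hβ _ _ (by
            by_contra hlt
            rw [not_lt, abs_le] at hlt
            exact he (Finset.mem_Icc.2 ⟨by linarith [hlt.2], by linarith [hlt.1]⟩))
          simp [this]
      · have : αinf u a.1 = 0 := hβ _ _ (by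
          by_contra hlt
          rw [not_lt, abs_le] at hlt
          exact hd (Finset.mem_Icc.2 ⟨by linarith [hlt.2], by linarith [hlt.1]⟩))
        simp [this]

theorem backwardExp_tensorFlow {αinf : ℤ → ℤ → ℝ} {β : ℕ}
    (hβ : ∀ i j : ℤ, (β : ℤ) < |i - j| → αinf i j = 0) (n : ℕ) (u v : ℤ) (h : X × X → ℝ) :
    backwardExp αinf n u v (fun s => ∫ q, tensorFlow f g n s h q ∂(π₀.prod π₀)) =
      latticeMoment π₀ f g αinf β n u v h :=
  (hasSum_pathProb_mul hβ n u v h).tsum_eq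

theorem tensorQ_mul [IsMarkovKernel f] (n : ℕ) (h₁ h₂ : X → ℝ) :
    tensorQ f g n (fun q => h₁ q.1 * h₂ q.2) =
      fun q => propagate f g n h₁ q.1 * propagate f g n h₂ q.2 := by
  ext q
  rw [tensorQ, integral_prod_mul, propagate, propagate]
  ring

/-- Particles whose genealogies cannot meet contribute the product of the means. -/
theorem pairMoment_mul_of_far [IsProbabilityMeasure π₀] [IsMarkovKernel f] (hg : IsPotential g C)
    (hα : α ∈ doublyStochastic ℝ (Fin N)) {β : ℕ}
    (hband : ∀ i j : Fin N, (∀ l : ℤ, (β : ℤ) < |(i : ℤ) - j + l * N|) → α i j = 0) (n : ℕ)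
    (u v : Fin N) (huv : ∀ l : ℤ, (2 * n * β : ℤ) < |(u : ℤ) - v + l * N|) {h₁ h₂ : X → ℝ}
    (hm₁ : Measurable h₁) (hm₂ : Measurable h₂) {B₁ B₂ : ℝ} (hB₁ : ∀ x, |h₁ x| ≤ B₁)
    (hB₂ : ∀ x, |h₂ x| ≤ B₂) :
    pairMoment π₀ f g α n u v (fun q => h₁ q.1 * h₂ q.2) =
      (∫ x, h₁ x ∂(unnormFilter π₀ f g n)) * ∫ x, h₂ x ∂(unnormFilter π₀ f g n) := by
  have hne : ((u : ℕ) : ℤ) ≠ (v : ℕ) := fun h0 => by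
    have := huv 0
    rw [h0] at this
    simp only [sub_self, zero_mul, add_zero, abs_zero] at this
    have : (0 : ℤ) ≤ 2 * n * β := by positivity
    omega
  have hco : ∀ h : X × X → ℝ, coalesce (((u : ℕ) : ℤ), ((v : ℕ) : ℤ)) h = h := fun h => by
    ext q; simp [coalesce, hne]
  induction n generalizing u v h₁ h₂ B₁ B₂ with
  | zero =>
    rw [pairMoment, hco, integral_prod_mul]
    rfl
  | succ n ih =>
    rw [pairMoment, hco, tensorQ_mul, integral_unnormFilter_succ hg n hm₁ hB₁,
      integral_unnormFilter_succ hg n hm₂ hB₂]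
    set c := (∫ x, propagate f g n h₁ x ∂(unnormFilter π₀ f g n)) *
      ∫ x, propagate f g n h₂ x ∂(unnormFilter π₀ f g n) with hc
    have key : ∀ j j', α u j * α v j' * pairMoment π₀ f g α n j j'
        (fun q => propagate f g n h₁ q.1 * propagate f g n h₂ q.2) = α u j * α v j' * c := by
      intro j j'
      by_cases h1 : α u j = 0
      · simp [h1]
      by_cases h2 : α v j' = 0
      · simp [h2]
      have h1' := mt (hband u j) h1
      have h2' := mt (hband v j') h2
      push Not at h1' h2'
      obtain ⟨l₁, hl₁⟩ := h1'
      obtain ⟨l₂, hl₂⟩ := h2'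
      -- One step backwards brings the two labels closer by at most `2 β`.
      have hfar : ∀ l : ℤ, (2 * n * β : ℤ) < |(j : ℤ) - j' + l * N| := by
        intro l
        have h3 := huv (l + l₁ - l₂)
        have e : (u : ℤ) - v + (l + l₁ - l₂) * N = ((j : ℤ) - j' + l * N) +
          (((u : ℤ) - j + l₁ * N) - ((v : ℤ) - j' + l₂ * N)) := by ring
        rw [e] at h3
        have h4 := abs_add_le ((j : ℤ) - j' + l * N)
          (((u : ℤ) - j + l₁ * N) - ((v : ℤ) - j' + l₂ * N))
        have h5 := abs_sub ((u : ℤ) - j + l₁ * N) ((v : ℤ) - j' + l₂ * N)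
        push_cast at h3
        linarith
      have hne' : ((j : ℕ) : ℤ) ≠ (j' : ℕ) := fun h0 => by
        have := hfar 0
        rw [h0] at this
        simp only [sub_self, zero_mul, add_zero, abs_zero] at this
        have : (0 : ℤ) ≤ 2 * n * β := by positivity
        omega
      rw [ih j j' hfar (measurable_propagate hg n hm₁) (measurable_propagate hg n hm₂)
        (abs_propagate_le hg n hB₁) (abs_propagate_le hg n hB₂) hne' fun h => by
          ext q; simp [coalesce, hne']]
    simp_rw [key, ← Finset.sum_mul, ← Finset.mul_sum, sum_row_of_mem_doublyStochastic hα, mul_one]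
    rw [sum_row_of_mem_doublyStochastic hα, one_mul]

section ParticleSystem

variable [StandardBorelSpace X] [Nonempty X] {Ω : Type*} [MeasurableSpace Ω] {P : Measure Ω}
  [IsProbabilityMeasure P] {ζ : ℕ → Ω → Fin N → X} [IsProbabilityMeasure π₀] [IsMarkovKernel f]

theorem IsParticleSystem.integral_weight_mul_weight_mul (hS : IsParticleSystem π₀ f g α P ζ)
    (hg : IsPotential g C) (hα : α ∈ doublyStochastic ℝ (Fin N)) (n : ℕ) (u v : Fin N)
    {h : X × X → ℝ} (hm : Measurable h) {B : ℝ} (hB : ∀ q, |h q| ≤ B) :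
    ∫ ω, weight α g (fun k => ζ k ω) n u * weight α g (fun k => ζ k ω) n v *
      h (ζ n ω u, ζ n ω v) ∂P = pairMoment π₀ f g α n u v h := by
  have hint : ∀ (n : ℕ) (u v : Fin N) {h : X × X → ℝ}, Measurable h → ∀ {B : ℝ},
      (∀ q, |h q| ≤ B) → Integrable (fun ω => weight α g (fun k => ζ k ω) n u *
        weight α g (fun k => ζ k ω) n v * h (ζ n ω u, ζ n ω v)) P := by
    intro n u v h hm B hB
    refine integrable_of_bounded ?_ fun ω =>
      abs_weight_mul_weight_mul_le hg hα (hB _) (fun k => ζ k ω) n u v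
    have := hS.measurable n
    exact (((measurable_weight hg α n u).comp hS.measurable_path).mul
      ((measurable_weight hg α n v).comp hS.measurable_path)).mul (hm.comp (by fun_prop))
  induction n generalizing u v h B with
  | zero =>
    simp only [weight, one_mul, pairMoment]
    rw [hS.integral_zero (G := fun y => h (y u, y v)) (hm.comp (by fun_prop)),
      integral_pi_pair _ u v hm]
  | succ n ih =>
    have e := hS.integral_succ n (G := fun z y => weight α g z (n + 1) u * weight α g z (n + 1) v *
      h (y u, y v)) ((((measurable_weight hg α (n + 1) u).comp measurable_fst).mul
      ((measurable_weight hg α (n + 1) v).comp measurable_fst)).mul (hm.comp (by fun_prop)))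
      (fun z z' hz => by rw [weight_congr α g (n := n + 1) fun k hk => hz k (by omega)])
      (hint (n + 1) u v hm hB)
    rw [e]
    simp_rw [integral_const_mul, weight_mul_weight_mul_integral_nextLaw hg hα _ n u v hm hB]
    have hm' := measurable_tensorQ (f := f) hg n (measurable_coalesce (u, v) hm)
    have hB' := abs_tensorQ_le (f := f) hg n (abs_coalesce_le (((u : ℕ) : ℤ), ((v : ℕ) : ℤ)) hB)
    rw [integral_finsetSum _ fun j _ => integrable_finsetSum _ fun j' _ =>
      (hint n j j' hm' hB').const_mul _]
    simp_rw [integral_finsetSum _ fun j' _ => (hint n _ j' hm' hB').const_mul _,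
      integral_const_mul, ih _ _ hm' hB']
    rfl

theorem IsParticleSystem.integral_weightedSum_sq (hS : IsParticleSystem π₀ f g α P ζ)
    (hg : IsPotential g C) (hα : α ∈ doublyStochastic ℝ (Fin N)) (n : ℕ) {h : X → ℝ}
    (hm : Measurable h) {B : ℝ} (hB : ∀ x, |h x| ≤ B) :
    ∫ ω, weightedSum α g h (fun k => ζ k ω) n ^ 2 ∂P =
      ∑ u, ∑ v, pairMoment π₀ f g α n u v fun q => h q.1 * h q.2 := by
  have hm' : Measurable fun q : X × X => h q.1 * h q.2 := by fun_prop
  have hB' : ∀ q : X × X, |h q.1 * h q.2| ≤ B * B := fun q => by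
    rw [abs_mul]
    exact mul_le_mul (hB _) (hB _) (abs_nonneg _) ((abs_nonneg _).trans (hB q.1))
  simp_rw [← hS.integral_weight_mul_weight_mul hg hα n _ _ hm' hB']
  have hint : ∀ u v, Integrable (fun ω => weight α g (fun k => ζ k ω) n u *
      weight α g (fun k => ζ k ω) n v * (h (ζ n ω u) * h (ζ n ω v))) P := by
    intro u v
    have := hS.measurable n
    refine integrable_of_bounded ?_ fun ω =>
      abs_weight_mul_weight_mul_le hg hα (hB' (ζ n ω u, ζ n ω v)) (fun k => ζ k ω) n u v
    exact (((measurable_weight hg α n u).comp hS.measurable_path).mul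
      ((measurable_weight hg α n v).comp hS.measurable_path)).mul (hm'.comp
        (g := fun q : X × X => h q.1 * h q.2) (f := fun ω => (ζ n ω u, ζ n ω v)) (by fun_prop))
  simp_rw [← integral_finsetSum _ fun v _ => hint _ v]
  rw [← integral_finsetSum _ fun u _ => integrable_finsetSum _ fun v _ => hint u v]
  congr 1 with ω
  rw [weightedSum, sq, Finset.sum_mul_sum]
  exact Finset.sum_congr rfl fun u _ => Finset.sum_congr rfl fun v _ => by ring

end ParticleSystem

end LocalExchange

namespace LocalExchange

/-! ### From the cyclic group of labels to the integers -/

/-- The residue of the integer `u` modulo `N`, as a label. -/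
def residue (N : ℕ) [NeZero N] (u : ℤ) : Fin N :=
  ⟨(u % N).toNat, by
    have h0 : (0 : ℤ) < N := by exact_mod_cast Nat.pos_of_ne_zero (NeZero.ne N)
    have h1 := Int.emod_nonneg u h0.ne'
    have h2 := Int.emod_lt_of_pos u h0
    omega⟩

variable {N : ℕ} [NeZero N]

theorem residue_coe (u : ℤ) : ((residue N u : ℕ) : ℤ) = u % N := by
  have h0 : (0 : ℤ) < N := by exact_mod_cast Nat.pos_of_ne_zero (NeZero.ne N)
  simp [residue, Int.toNat_of_nonneg (Int.emod_nonneg u h0.ne')]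

theorem residue_modEq (u : ℤ) : ((residue N u : ℕ) : ℤ) ≡ u [ZMOD N] := by
  rw [residue_coe]
  exact Int.mod_modEq u N

theorem residue_eq_iff (u : ℤ) (i : Fin N) : residue N u = i ↔ ((i : ℕ) : ℤ) ≡ u [ZMOD N] := by
  have hi : ((i : ℕ) : ℤ) % N = i := Int.emod_eq_of_lt (by positivity) (by exact_mod_cast i.2)
  rw [Fin.ext_iff, ← Nat.cast_inj (R := ℤ), residue_coe, Int.ModEq, hi, eq_comm]

theorem residue_eq_residue_iff (u v : ℤ) : residue N u = residue N v ↔ u ≡ v [ZMOD N] := by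
  rw [residue_eq_iff]
  exact ⟨fun h => h.symm.trans (residue_modEq v), fun h => (residue_modEq v).trans h.symm⟩

theorem residue_natCast (i : Fin N) : residue N ((i : ℕ) : ℤ) = i :=
  (residue_eq_iff _ _).2 rfl

theorem eq_of_modEq_of_abs_sub_lt {N : ℕ} {u v : ℤ} (h : u ≡ v [ZMOD N])
    (hlt : |u - v| < N) : u = v := by
  have := Int.eq_zero_of_abs_lt_dvd (Int.ModEq.dvd h.symm) hlt
  linarith

/-- A sum over the labels of a function supported within distance `R` of `u` is a sum over the
integers at distance at most `R` from `u`. -/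
theorem sum_eq_sum_residue (u : ℤ) (R : ℕ) (hR : 2 * R + 1 ≤ N) (G : Fin N → ℝ)
    (hG : ∀ j : Fin N, (∀ l : ℤ, (R : ℤ) < |((residue N u : ℕ) : ℤ) - j + l * N|) → G j = 0) :
    ∑ j, G j = ∑ d ∈ Finset.Icc (-(R : ℤ)) R, G (residue N (u + d)) := by
  have hinj : Set.InjOn (fun d : ℤ => residue N (u + d)) (Finset.Icc (-(R : ℤ)) R : Finset ℤ) := by
    intro d hd e he hde
    have hd' := Finset.mem_Icc.1 hd
    have he' := Finset.mem_Icc.1 he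
    have h1 := (residue_eq_residue_iff _ _).1 hde
    have h2 := eq_of_modEq_of_abs_sub_lt h1 (by rw [abs_lt]; constructor <;> omega)
    linarith
  rw [← Finset.sum_image (f := G) (g := fun d : ℤ => residue N (u + d)) hinj]
  refine (Finset.sum_subset (Finset.subset_univ _) fun j _ hj => hG j fun l => ?_).symm
  by_contra hle
  rw [not_lt, abs_le] at hle
  refine hj (Finset.mem_image.2 ⟨-(((residue N u : ℕ) : ℤ) - j + l * N),
    Finset.mem_Icc.2 ⟨by linarith, by linarith⟩, (residue_eq_iff _ _).2 ?_⟩)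
  have h1 : u + -(((residue N u : ℕ) : ℤ) - j + l * N) =
      j + (u - ((residue N u : ℕ) : ℤ)) + (-l) * N := by ring
  have h2 := (residue_modEq (N := N) u).dvd
  rw [h1, Int.modEq_iff_dvd]
  have : ((j : ℕ) : ℤ) + (u - ((residue N u : ℕ) : ℤ)) + (-l) * N - ((j : ℕ) : ℤ) =
      (u - ((residue N u : ℕ) : ℤ)) + (-l) * N := by ring
  rw [this]
  exact dvd_add h2 (Dvd.intro_left _ rfl)

theorem coalesce_residue {Y : Type*} {u v : ℤ} (huv : |u - v| < N) (h : Y × Y → ℝ) :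
    coalesce (((residue N u : ℕ) : ℤ), ((residue N v : ℕ) : ℤ)) h = coalesce (u, v) h := by
  have : ((residue N u : ℕ) : ℤ) = ((residue N v : ℕ) : ℤ) ↔ u = v := by
    rw [Nat.cast_inj, ← Fin.ext_iff, residue_eq_residue_iff]
    exact ⟨fun h => eq_of_modEq_of_abs_sub_lt h huv, fun h => h ▸ rfl⟩
  ext q
  simp only [coalesce, this]

variable {X : Type*} [MeasurableSpace X] {π₀ : Measure X} {f : Kernel X X} {g : ℕ → X → ℝ}
  {C : ℕ → ℝ}

section LocalInteraction

variable {M β : ℕ} {α : ∀ m : ℕ, Matrix (Fin (M * m)) (Fin (M * m)) ℝ} {αinf : ℤ → ℤ → ℝ}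

theorem IsLocalInteraction.limit_eq (hI : IsLocalInteraction M β α αinf) {m : ℕ} (hm : 1 ≤ m)
    [NeZero (M * m)] (hN : 2 * β + 1 ≤ M * m) (i j : ℤ) :
    αinf i j = if |i - j| ≤ (β : ℤ) then α m (residue _ i) (residue _ j) else 0 :=
  hI.similar m hm hN i j _ _ (residue_modEq i) (residue_modEq j)

theorem IsLocalInteraction.limit_eq_zero (hI : IsLocalInteraction M β α αinf) (hM : 1 < M)
    {i j : ℤ} (hij : (β : ℤ) < |i - j|) : αinf i j = 0 := by
  have hN : 2 * β + 1 ≤ M * (2 * β + 1) := Nat.le_mul_of_pos_left _ (by omega)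
  have : NeZero (M * (2 * β + 1)) := ⟨by positivity⟩
  rw [hI.limit_eq (m := 2 * β + 1) (by omega) hN, if_neg (by omega)]

theorem IsLocalInteraction.limit_add_add (hI : IsLocalInteraction M β α αinf) (hM : 1 < M)
    (i j : ℤ) : αinf (i + M) (j + M) = αinf i j := by
  have hN : 2 * β + 1 ≤ M * (2 * β + 1) := Nat.le_mul_of_pos_left _ (by omega)
  have : NeZero (M * (2 * β + 1)) := ⟨by positivity⟩
  rw [hI.limit_eq (m := 2 * β + 1) (by omega) hN, hI.limit_eq (m := 2 * β + 1) (by omega) hN,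
    add_sub_add_right_eq_sub]
  congr 1
  refine (hI.circulant (2 * β + 1) (by omega) _ _ _ _ 1 ?_ ?_).symm
  · rw [one_mul]
    exact (residue_modEq _).trans ((residue_modEq i).symm.add_right _)
  · rw [one_mul]
    exact (residue_modEq _).trans ((residue_modEq j).symm.add_right _)

theorem latticeMoment_add_add (hper : ∀ i j : ℤ, αinf (i + M) (j + M) = αinf i j) (n : ℕ)
    (u v : ℤ) (h : X × X → ℝ) : latticeMoment π₀ f g αinf β n (u + M) (v + M) h =
      latticeMoment π₀ f g αinf β n u v h := by
  have hco : ∀ (u v : ℤ) (h : X × X → ℝ), coalesce (u + M, v + M) h = coalesce (u, v) h :=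
    fun u v h => by ext q; simp [coalesce]
  induction n generalizing u v h with
  | zero => simp only [latticeMoment, hco]
  | succ n ih =>
    simp only [latticeMoment, hco]
    refine Finset.sum_congr rfl fun d _ => Finset.sum_congr rfl fun e _ => ?_
    rw [add_right_comm u, add_right_comm v, hper, hper, ih]

theorem IsLocalInteraction.sum_mul_eq (hI : IsLocalInteraction M β α αinf) {m : ℕ} (hm : 1 ≤ m)
    [NeZero (M * m)] (hN : 2 * β + 1 ≤ M * m) (u : ℤ) (G : Fin (M * m) → ℝ) :
    ∑ j, α m (residue _ u) j * G j =
      ∑ d ∈ Finset.Icc (-(β : ℤ)) β, αinf u (u + d) * G (residue _ (u + d)) := by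
  rw [sum_eq_sum_residue u β hN _ fun j hj => by
    rw [hI.banded m hm hN _ j hj, zero_mul]]
  refine Finset.sum_congr rfl fun d hd => ?_
  have hd' := Finset.mem_Icc.1 hd
  rw [hI.limit_eq hm hN, if_pos (by rw [abs_le]; constructor <;> linarith)]

/-- Up to the time at which genealogies can wrap around, the moments for labels modulo `M m` are
those for integer labels. -/
theorem IsLocalInteraction.pairMoment_eq (hI : IsLocalInteraction M β α αinf) {m : ℕ} (hm : 1 ≤ m)
    [NeZero (M * m)] (hN : 2 * β + 1 ≤ M * m) (n : ℕ) (u v : ℤ)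
    (huv : |u - v| + 2 * n * β < M * m) (h : X × X → ℝ) :
    pairMoment π₀ f g (α m) n (residue _ u) (residue _ v) h =
      latticeMoment π₀ f g αinf β n u v h := by
  have huv' : |u - v| < (M * m : ℕ) := by
    have : (0 : ℤ) ≤ 2 * n * β := by positivity
    push_cast
    omega
  induction n generalizing u v h with
  | zero => rw [pairMoment, latticeMoment, coalesce_residue huv']
  | succ n ih =>
    rw [pairMoment, latticeMoment, coalesce_residue huv']
    simp_rw [mul_assoc, ← Finset.mul_sum]
    rw [hI.sum_mul_eq hm hN u fun j => ∑ j', α m (residue _ v) j' *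
      pairMoment π₀ f g (α m) n j j' (tensorQ f g n (coalesce (u, v) h))]
    refine Finset.sum_congr rfl fun d hd => ?_
    rw [hI.sum_mul_eq hm hN v fun j' =>
      pairMoment π₀ f g (α m) n (residue _ (u + d)) j' (tensorQ f g n (coalesce (u, v) h))]
    congr 1
    refine Finset.sum_congr rfl fun e he => ?_
    have hd' := Finset.mem_Icc.1 hd
    have he' := Finset.mem_Icc.1 he
    have h1 : |u + d - (v + e)| ≤ |u - v| + 2 * β := by
      have : u + d - (v + e) = (u - v) + (d - e) := by ring
      rw [this]
      refine (abs_add_le _ _).trans ?_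
      have : |d - e| ≤ 2 * β := by rw [abs_le]; constructor <;> linarith
      linarith
    have h2 : |u + d - (v + e)| + 2 * n * β < M * m := by
      push_cast at huv
      linarith
    rw [ih (u + d) (v + e) h2 _ (by
      have : (0 : ℤ) ≤ 2 * n * β := by positivity
      push_cast
      omega)]

/-- The asymptotic variance in terms of the moments for integer labels, including the case `n = 0`,
in which each particle is correlated with itself only. -/
theorem asympVar_eq [IsProbabilityMeasure π₀] {φ : X → ℝ} (hM : 1 < M)
    (hβ : ∀ i j : ℤ, (β : ℤ) < |i - j| → αinf i j = 0) (n : ℕ) :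
    asympVar π₀ f g φ M β αinf n = 1 / ((unnormFilter π₀ f g n).real Set.univ ^ 2 * M) *
      ∑ u ∈ Finset.range M, ∑ d ∈ Finset.Icc (-((2 * n * β : ℕ) : ℤ)) (2 * n * β : ℕ),
        latticeMoment π₀ f g αinf β n u (u + d) fun q =>
          (φ q.1 - ∫ y, φ y ∂(predFilter π₀ f g n)) *
            (φ q.2 - ∫ y, φ y ∂(predFilter π₀ f g n)) := by
  cases n with
  | zero =>
    have h1 := integral_fun_fst (μ := π₀) (ν := π₀)
      (f := fun x => (φ x - ∫ y, φ y ∂π₀) * (φ x - ∫ y, φ y ∂π₀))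
    simp only [asympVar, unnormFilter, latticeMoment, predFilter, coalesce]
    simp only [mul_zero, zero_mul, Nat.cast_zero, neg_zero, Finset.Icc_self, Finset.sum_singleton,
      add_zero, if_true, Finset.sum_const, Finset.card_range, h1]
    have : (M : ℝ) ≠ 0 := by positivity
    simp [sq, this]
  | succ n =>
    simp only [asympVar, backwardExp_tensorFlow hβ]
    push_cast
    rfl

theorem sum_range_mul_of_periodic {F : ℤ → ℝ} (hF : ∀ u, F (u + M) = F u) (m : ℕ) :
    ∑ u ∈ Finset.range (M * m), F u = m * ∑ u ∈ Finset.range M, F u := by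
  have hF' : ∀ (k : ℕ) (u : ℤ), F (M * k + u) = F u := by
    intro k
    induction k with
    | zero => simp
    | succ k ih =>
      intro u
      have e : (M : ℤ) * (k + 1 : ℕ) + u = (M * k + u) + M := by push_cast; ring
      rw [e, hF, ih]
  induction m with
  | zero => simp
  | succ m ih =>
    rw [Nat.mul_succ, Finset.sum_range_add, ih]
    push_cast
    simp_rw [hF']
    ring

/-- The second moment of the weighted sum of the centred test function is, exactly and for all
large `m`, given by the asymptotic variance. -/
theorem IsParticleSystem.integral_weightedSum_sq_eq_asympVar [StandardBorelSpace X] [Nonempty X]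
    [IsProbabilityMeasure π₀] [IsMarkovKernel f] (hg : IsPotential g C)
    (hI : IsLocalInteraction M β α αinf) (hM : 1 < M) {m : ℕ} (hm : 1 ≤ m)
    {Ω : Type*} [MeasurableSpace Ω] {P : Measure Ω} [IsProbabilityMeasure P]
    {ζ : ℕ → Ω → Fin (M * m) → X} (hS : IsParticleSystem π₀ f g (α m) P ζ) (n : ℕ)
    (hN : 2 * β + 1 ≤ M * m) (hN' : 4 * n * β + 1 ≤ M * m) {φ : X → ℝ} (hφ : Measurable φ) {B : ℝ}
    (hB : ∀ x, |φ x| ≤ B) :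
    ∫ ω, weightedSum (α m) g (fun x => φ x - ∫ y, φ y ∂(predFilter π₀ f g n))
        (fun k => ζ k ω) n ^ 2 ∂P =
      (M * m : ℕ) * (unnormFilter π₀ f g n).real Set.univ ^ 2 * asympVar π₀ f g φ M β αinf n := by
  have : NeZero (M * m) := ⟨by positivity⟩
  have hα := hI.doubly_stochastic m hm
  set c := ∫ y, φ y ∂(predFilter π₀ f g n) with hc
  have hm1 : Measurable fun x => φ x - c := hφ.sub_const _
  have hB1 : ∀ x, |φ x - c| ≤ B + |c| := fun x => (abs_sub _ _).trans (by gcongr; exact hB x)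
  have hγpos := unnormFilter_real_univ_pos (π₀ := π₀) (f := f) hg n
  have hcent : ∫ x, (φ x - c) ∂(unnormFilter π₀ f g n) = 0 := integral_sub_predFilter hg n hφ hB
  rw [hS.integral_weightedSum_sq hg hα n hm1 hB1, asympVar_eq hM
    (fun i j hij => hI.limit_eq_zero hM hij) n]
  set F : ℤ → ℝ := fun u => ∑ d ∈ Finset.Icc (-((2 * n * β : ℕ) : ℤ)) (2 * n * β : ℕ),
    latticeMoment π₀ f g αinf β n u (u + d) fun q => (φ q.1 - c) * (φ q.2 - c) with hF
  have hFper : ∀ u, F (u + M) = F u := fun u => by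
    simp only [hF]
    refine Finset.sum_congr rfl fun d _ => ?_
    rw [add_right_comm, latticeMoment_add_add (hI.limit_add_add hM)]
  have inner : ∀ u : Fin (M * m), ∑ v, pairMoment π₀ f g (α m) n u v
      (fun q => (φ q.1 - c) * (φ q.2 - c)) = F (u : ℕ) := by
    intro u
    rw [sum_eq_sum_residue ((u : ℕ) : ℤ) (2 * n * β) (by linarith) _ fun v hv => ?_]
    · refine Finset.sum_congr rfl fun d hd => ?_
      have hd' := Finset.mem_Icc.1 hd
      have e := hI.pairMoment_eq (π₀ := π₀) (f := f) (g := g) hm hN n (u : ℕ) ((u : ℕ) + d) (by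
        have h1 : |((u : ℕ) : ℤ) - ((u : ℕ) + d)| ≤ (2 * n * β : ℕ) := by
          rw [abs_le]; constructor <;> linarith
        have h2 : ((4 * n * β + 1 : ℕ) : ℤ) ≤ ((M * m : ℕ) : ℤ) := by exact_mod_cast hN'
        push_cast at h1 h2
        linarith) fun q => (φ q.1 - c) * (φ q.2 - c)
      rwa [residue_natCast] at e
    · rw [residue_natCast] at hv
      rw [pairMoment_mul_of_far hg hα (hI.banded m hm hN) n u v (by exact_mod_cast hv) hm1 hm1 hB1
        hB1, hcent, zero_mul]
  simp_rw [inner]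
  rw [← Finset.sum_range (fun i : ℕ => F (i : ℤ)), sum_range_mul_of_periodic hFper]
  have : (M : ℝ) ≠ 0 := by positivity
  simp only [hF, hc]
  push_cast
  field_simp

end LocalInteraction

end LocalExchange

namespace LocalExchange

/-! ### The limit of the normalised `L_p` error -/

variable {X : Type*} [MeasurableSpace X] {π₀ : Measure X} {f : Kernel X X} {g : ℕ → X → ℝ}
  {C : ℕ → ℝ}

/-- Linearisation of the ratio `S / T` around `T = N γ`, with a quadratic remainder. Since
`|S / T| ≤ B`, no lower bound on `T` is needed. -/
theorem abs_sqrt_mul_div_sub_le {S T N γ B : ℝ} (hT : 0 < T) (hN : 0 < N) (hγ : 0 < γ)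
    (hS : |S| ≤ B * T) :
    |√N * (S / T) - S / (√N * γ)| ≤
      (1 / γ + B / γ ^ 2) / √N * ((S / (√N * γ)) ^ 2 + ((T - N * γ) / √N) ^ 2) := by
  have hr : 0 < √N := Real.sqrt_pos.2 hN
  have hrN : N = √N ^ 2 := (Real.sq_sqrt hN.le).symm
  set r := √N with hr_def
  set Y := S / (r * γ) with hY
  set D := (T - N * γ) / r with hD
  set Z := r * (S / T) with hZ
  have hZB : |Z| ≤ r * B := by
    rw [hZ, abs_mul, abs_of_pos hr, abs_div, abs_of_pos hT]
    refine mul_le_mul_of_nonneg_left ?_ hr.le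
    rwa [div_le_iff₀ hT]
  have e : Z - Y = Y * (-D / (r * γ)) + Z * (-D / (r * γ)) ^ 2 := by
    rw [hZ, hY, hD, hrN]
    field_simp
    ring
  have hB0 : 0 ≤ B := by
    by_contra h
    have : B * T < 0 := mul_neg_of_neg_of_pos (not_le.1 h) hT
    linarith [abs_nonneg S]
  rw [e]
  have h1 : |Y * (-D / (r * γ))| ≤ 1 / γ / r * (Y ^ 2 + D ^ 2) := by
    rw [abs_mul, abs_div (-D), abs_neg, abs_of_pos (mul_pos hr hγ)]
    have h2 : |Y| * |D| ≤ Y ^ 2 + D ^ 2 := by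
      rw [← sq_abs Y, ← sq_abs D]
      nlinarith [sq_nonneg (|Y| - |D|), sq_nonneg |Y|, sq_nonneg |D|]
    calc |Y| * (|D| / (r * γ)) = 1 / γ / r * (|Y| * |D|) := by field_simp
      _ ≤ _ := by gcongr
  have h3 : |Z * (-D / (r * γ)) ^ 2| ≤ B / γ ^ 2 / r * (Y ^ 2 + D ^ 2) := by
    rw [abs_mul, abs_of_nonneg (sq_nonneg (-D / (r * γ)))]
    calc |Z| * (-D / (r * γ)) ^ 2 ≤ (r * B) * (-D / (r * γ)) ^ 2 := by gcongr
      _ = B / γ ^ 2 / r * D ^ 2 := by field_simp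
      _ ≤ _ := by
        gcongr
        linarith [sq_nonneg Y]
  refine (abs_add_le _ _).trans ((add_le_add h1 h3).trans (le_of_eq (by ring)))

theorem estimate_eq {Y : Type*} {N : ℕ} (α : Matrix (Fin N) (Fin N) ℝ) (g : ℕ → Y → ℝ)
    (φ : Y → ℝ) (z : ℕ → Fin N → Y) (n : ℕ) :
    estimate α g φ z n = weightedSum α g φ z n / weightedSum α g (fun _ => 1) z n := by
  simp [estimate, weightedSum]

theorem weightedSum_one_pos {N : ℕ} [NeZero N] {α : Matrix (Fin N) (Fin N) ℝ}
    (hg : IsPotential g C) (hα : α ∈ doublyStochastic ℝ (Fin N)) (z : ℕ → Fin N → X) (n : ℕ) :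
    0 < weightedSum α g (fun _ => 1) z n :=
  Finset.sum_pos (fun i _ => by simpa using weight_pos hg hα z n i) Finset.univ_nonempty

theorem abs_weightedSum_le_mul {N : ℕ} {α : Matrix (Fin N) (Fin N) ℝ}
    (hg : IsPotential g C) (hα : α ∈ doublyStochastic ℝ (Fin N)) {h : X → ℝ} {B : ℝ}
    (hB : ∀ x, |h x| ≤ B) (z : ℕ → Fin N → X) (n : ℕ) :
    |weightedSum α g h z n| ≤ B * weightedSum α g (fun _ => 1) z n := by
  rw [weightedSum, weightedSum, Finset.mul_sum]
  refine (Finset.abs_sum_le_sum_abs _ _).trans (Finset.sum_le_sum fun i _ => ?_)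
  rw [abs_mul, abs_of_pos (weight_pos hg hα z n i), mul_one, mul_comm]
  exact mul_le_mul_of_nonneg_right (hB _) (weight_pos hg hα z n i).le

theorem estimate_sub_eq {N : ℕ} [NeZero N] {α : Matrix (Fin N) (Fin N) ℝ}
    (hg : IsPotential g C) (hα : α ∈ doublyStochastic ℝ (Fin N)) (φ : X → ℝ) (c : ℝ)
    (z : ℕ → Fin N → X) (n : ℕ) :
    estimate α g φ z n - c =
      weightedSum α g (fun x => φ x - c) z n / weightedSum α g (fun _ => 1) z n := by
  have hT := weightedSum_one_pos hg hα z n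
  rw [estimate_eq, eq_div_iff hT.ne', sub_mul, div_mul_cancel₀ _ hT.ne']
  simp only [weightedSum, Finset.mul_sum, ← Finset.sum_sub_distrib]
  exact Finset.sum_congr rfl fun i _ => by ring

section ParticleSystem

variable [StandardBorelSpace X] [Nonempty X] [IsProbabilityMeasure π₀] [IsMarkovKernel f]

/-- The normalised fluctuations of a weighted sum have exponential moments that are bounded
uniformly in the number of particles. -/
theorem IsParticleSystem.hasExpBound {N : ℕ} [NeZero N] {α : Matrix (Fin N) (Fin N) ℝ}
    {Ω : Type*} [MeasurableSpace Ω] {P : Measure Ω} [IsProbabilityMeasure P]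
    {ζ : ℕ → Ω → Fin N → X} (hS : IsParticleSystem π₀ f g α P ζ)
    (hg : IsPotential g C) (hα : α ∈ doublyStochastic ℝ (Fin N)) (n : ℕ) {h : X → ℝ}
    (hm : Measurable h) {B : ℝ} (hB : ∀ x, |h x| ≤ B) (γ : ℝ) :
    HasExpBound (fun ω => (weightedSum α g h (fun k => ζ k ω) n -
      N * ∫ x, h x ∂(unnormFilter π₀ f g n)) / (√N * γ)) P
      (Real.exp ((n + 1) * ((weightBound C n * B / γ) ^ 2 / 2))) := by
  have hN : (0 : ℝ) < N := by exact_mod_cast Nat.pos_of_ne_zero (NeZero.ne N)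
  have hms := (hS.measurable_weightedSum hg hm n).sub_const
    (N * ∫ x, h x ∂(unnormFilter π₀ f g n))
  have hint : ∀ s : ℝ, Integrable (fun ω => Real.exp (s * (weightedSum α g h (fun k => ζ k ω) n -
      N * ∫ x, h x ∂(unnormFilter π₀ f g n)))) P := fun s => by
    refine integrable_of_bounded (B := Real.exp (|s| * (N * (weightBound C n * B) +
      |N * ∫ x, h x ∂(unnormFilter π₀ f g n)|))) (by fun_prop) fun ω => ?_
    rw [Real.norm_of_nonneg (Real.exp_pos _).le, Real.exp_le_exp]
    refine (le_abs_self _).trans ?_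
    rw [abs_mul]
    refine mul_le_mul_of_nonneg_left ((abs_sub _ _).trans ?_) (abs_nonneg _)
    gcongr
    exact abs_weightedSum_le hg hα hB _ n
  have e : ∀ σ : ℝ, σ ^ 2 = 1 → (n + 1) * (N * ((σ / (√N * γ) * (weightBound C n * B)) ^ 2 / 2)) =
      (n + 1) * ((weightBound C n * B / γ) ^ 2 / 2) := fun σ hσ => by
    have hs : √(N : ℝ) ^ 2 = N := Real.sq_sqrt hN.le
    have : (σ / (√N * γ) * (weightBound C n * B)) ^ 2 = (weightBound C n * B / γ) ^ 2 / N := by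
      rw [mul_pow, div_pow, mul_pow, hs, hσ, div_pow]
      field_simp
    rw [this]
    field_simp
  have key := fun σ : ℝ => hS.integral_exp_weightedSum_le hg hα (σ / (√N * γ)) n hm hB
  have e1 : ∀ x : ℝ, x / (√N * γ) = 1 / (√N * γ) * x := fun x => by ring
  have e2 : ∀ x : ℝ, -(x / (√N * γ)) = -1 / (√N * γ) * x := fun x => by ring
  refine ⟨hms.div_const _, ?_, ?_, ?_, ?_⟩
  · exact (hint _).congr (ae_of_all _ fun ω => (congrArg Real.exp (e1 _)).symm)
  · exact (hint _).congr (ae_of_all _ fun ω => (congrArg Real.exp (e2 _)).symm)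
  · refine le_trans (le_of_eq (integral_congr_ae (ae_of_all _ fun ω => ?_)))
      ((key 1).trans (le_of_eq (by rw [e 1 (by norm_num)])))
    beta_reduce
    rw [← e1]
  · refine le_trans (le_of_eq (integral_congr_ae (ae_of_all _ fun ω => ?_)))
      ((key (-1)).trans (le_of_eq (by rw [e (-1) (by norm_num)])))
    beta_reduce
    rw [← e2]

variable {M β : ℕ} {α : ∀ m : ℕ, Matrix (Fin (M * m)) (Fin (M * m)) ℝ} {αinf : ℤ → ℤ → ℝ}
  {Ω : ℕ → Type*} [∀ m, MeasurableSpace (Ω m)] {P : ∀ m, Measure (Ω m)}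
  [∀ m, IsProbabilityMeasure (P m)] {ζ : ∀ m, ℕ → Ω m → Fin (M * m) → X}

/-- The asymptotics of the `L_p` norms of the numerator of the error. The index is shifted by one,
so that there is at least one group. -/
theorem tendsto_eLpNorm_weightedSum (hg : IsPotential g C) {φ : X → ℝ} (hφ : Measurable φ) {B : ℝ}
    (hB : ∀ x, |φ x| ≤ B) (hM : 1 < M) (hI : IsLocalInteraction M β α αinf)
    (hS : ∀ m, 1 ≤ m → IsParticleSystem π₀ f g (α m) (P m) (ζ m)) (n : ℕ)
    (hσ : 0 < asympVar π₀ f g φ M β αinf n) {p : ℝ} (hp : 1 ≤ p) :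
    Tendsto (fun m : ℕ => eLpNorm (fun ω =>
      weightedSum (α (m + 1)) g (fun x => φ x - ∫ y, φ y ∂(predFilter π₀ f g n))
        (fun k => ζ (m + 1) k ω) n / (√(M * (m + 1) : ℕ) * (unnormFilter π₀ f g n).real Set.univ))
        (ENNReal.ofReal p) (P (m + 1))) atTop
      (𝓝 (ENNReal.ofReal (√(2 * asympVar π₀ f g φ M β αinf n) *
        (Real.Gamma ((p + 1) / 2) / √Real.pi) ^ (1 / p)))) := by
  set c := ∫ y, φ y ∂(predFilter π₀ f g n) with hc
  set γ := (unnormFilter π₀ f g n).real Set.univ with hγ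
  set σ2 := asympVar π₀ f g φ M β αinf n with hσ2
  have hγpos : 0 < γ := unnormFilter_real_univ_pos hg n
  have hm1 : Measurable fun x => φ x - c := hφ.sub_const _
  have hB1 : ∀ x, |φ x - c| ≤ B + |c| := fun x => (abs_sub _ _).trans (by gcongr; exact hB x)
  have hcent : ∫ x, (φ x - c) ∂(unnormFilter π₀ f g n) = 0 := integral_sub_predFilter hg n hφ hB
  have hNe : ∀ m : ℕ, NeZero (M * (m + 1)) := fun m => ⟨by positivity⟩
  have hexp := fun m : ℕ => (hS (m + 1) (by omega)).hasExpBound hg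
    (hI.doubly_stochastic (m + 1) (by omega)) n hm1 hB1 γ
  simp only [hcent, mul_zero, sub_zero] at hexp
  have hv : σ2.toNNReal ≠ 0 := by simpa using hσ
  have hvc : ((σ2.toNNReal : NNReal) : ℝ) = σ2 := Real.coe_toNNReal _ hσ.le
  have main := tendsto_eLpNorm_of_tendsto_charFun (fun m => P (m + 1)) _ hexp hv (fun t => ?_) hp
  · rw [hvc] at main
    exact main
  rw [hvc]
  obtain ⟨L, hL⟩ := exists_norm_charFun_sub_le π₀ f hg (t / γ) n (B + |c|)
  have hNtop : Tendsto (fun m : ℕ => M * (m + 1)) atTop atTop :=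
    tendsto_atTop_mono (fun m => Nat.le_mul_of_pos_left _ (by omega)) (tendsto_add_atTop_nat 1)
  have hsq : Tendsto (fun m : ℕ => L / √(M * (m + 1) : ℕ)) atTop (𝓝 0) :=
    Tendsto.div_atTop tendsto_const_nhds
      (Real.tendsto_sqrt_atTop.comp (tendsto_natCast_atTop_atTop.comp hNtop))
  rw [tendsto_iff_norm_sub_tendsto_zero]
  refine squeeze_zero' (Eventually.of_forall fun m => norm_nonneg _) ?_ hsq
  filter_upwards [hNtop.eventually_ge_atTop (2 * β + 1), hNtop.eventually_ge_atTop (4 * n * β + 1)]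
    with m h1 h2
  have hNpos : (0 : ℝ) < (M * (m + 1) : ℕ) := by exact_mod_cast Nat.pos_of_ne_zero (hNe m).ne
  have h3 := hL (N := M * (m + 1)) (Nat.pos_of_ne_zero (hNe m).ne)
    (hI.doubly_stochastic (m + 1) (by omega)) (hS (m + 1) (by omega)) hm1 hB1 hcent
  rw [(hS (m + 1) (by omega)).integral_weightedSum_sq_eq_asympVar hg hI hM (by omega) n h1 h2 hφ hB]
    at h3
  refine le_trans (le_of_eq ?_) h3
  have hs : √((M * (m + 1) : ℕ) : ℝ) ^ 2 = (M * (m + 1) : ℕ) := Real.sq_sqrt hNpos.le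
  have e1 : (t / γ / √((M * (m + 1) : ℕ) : ℝ)) ^ 2 * ((M * (m + 1) : ℕ) * γ ^ 2 * σ2) =
      t ^ 2 * σ2 := by
    rw [div_pow, hs, div_pow]
    field_simp
  rw [← hγ, ← hσ2, e1]
  congr 3
  ext ω
  congr 3
  field_simp

/-- The limit of the `L_p` norms of the normalised error. The error differs from its normalised
numerator by the remainder in `abs_sqrt_mul_div_sub_le`, whose `L_p` norm is of order
`N ^ (-1 / 2)`. -/
theorem tendsto_sqrt_mul_lpError (hg : IsPotential g C) {φ : X → ℝ} (hφ : Measurable φ) {B : ℝ}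
    (hB : ∀ x, |φ x| ≤ B) (hM : 1 < M) (hI : IsLocalInteraction M β α αinf)
    (hS : ∀ m, 1 ≤ m → IsParticleSystem π₀ f g (α m) (P m) (ζ m)) (n : ℕ)
    (hσ : 0 < asympVar π₀ f g φ M β αinf n) {p : ℝ} (hp : 1 ≤ p) :
    Tendsto (fun m : ℕ => ENNReal.ofReal √m * lpError π₀ f g (α m) φ (P m) (ζ m) p n) atTop
      (𝓝 (ENNReal.ofReal (√(asympVar π₀ f g φ M β αinf n) / √M * √2 *
        (Real.Gamma ((p + 1) / 2) / √Real.pi) ^ (1 / p)))) := by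
  rw [← tendsto_add_atTop_iff_nat 1]
  have hY := tendsto_eLpNorm_weightedSum hg hφ hB hM hI hS n hσ hp
  set c := ∫ y, φ y ∂(predFilter π₀ f g n) with hc
  set γ := (unnormFilter π₀ f g n).real Set.univ with hγ
  set σ2 := asympVar π₀ f g φ M β αinf n with hσ2
  have hp0 : 0 < p := by linarith
  have hp1 : (1 : ℝ≥0∞) ≤ ENNReal.ofReal p := by
    rw [← ENNReal.ofReal_one]; exact ENNReal.ofReal_le_ofReal hp
  have hγpos : 0 < γ := unnormFilter_real_univ_pos hg n
  have hm1 : Measurable fun x => φ x - c := hφ.sub_const _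
  have hB1 : ∀ x, |φ x - c| ≤ B + |c| := fun x => (abs_sub _ _).trans (by gcongr; exact hB x)
  have hB0 : 0 ≤ B + |c| := (abs_nonneg _).trans (hB1 (Classical.arbitrary X))
  have hcent : ∫ x, (φ x - c) ∂(unnormFilter π₀ f g n) = 0 := integral_sub_predFilter hg n hφ hB
  have hNe : ∀ m : ℕ, NeZero (M * (m + 1)) := fun m => ⟨by positivity⟩
  have hα := fun m : ℕ => hI.doubly_stochastic (m + 1) (by omega)
  let T : ∀ m, Ω (m + 1) → ℝ := fun m ω =>
    weightedSum (α (m + 1)) g (fun _ => 1) (fun k => ζ (m + 1) k ω) n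
  let S : ∀ m, Ω (m + 1) → ℝ := fun m ω =>
    weightedSum (α (m + 1)) g (fun x => φ x - c) (fun k => ζ (m + 1) k ω) n
  let Y : ∀ m, Ω (m + 1) → ℝ := fun m ω => S m ω / (√(M * (m + 1) : ℕ) * γ)
  let D : ∀ m, Ω (m + 1) → ℝ := fun m ω =>
    (T m ω - (M * (m + 1) : ℕ) * γ) / √(M * (m + 1) : ℕ)
  let Z : ∀ m, Ω (m + 1) → ℝ := fun m ω => √(M * (m + 1) : ℕ) * (S m ω / T m ω)
  have hYexp := fun m : ℕ => (hS (m + 1) (by omega)).hasExpBound hg (hα m) n hm1 hB1 γ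
  simp only [hcent, mul_zero, sub_zero] at hYexp
  have hDexp := fun m : ℕ => (hS (m + 1) (by omega)).hasExpBound hg (hα m) n
    (h := fun _ => 1) measurable_const (B := 1) (fun _ => by simp) 1
  simp only [mul_one, integral_const, smul_eq_mul] at hDexp
  obtain ⟨L₁, hL₁0, hL₁⟩ := exists_eLpNorm_le (p * 2) (by linarith)
    (Real.exp ((n + 1) * ((weightBound C n * (B + |c|) / γ) ^ 2 / 2)))
  obtain ⟨L₂, hL₂0, hL₂⟩ := exists_eLpNorm_le (p * 2) (by linarith)
    (Real.exp ((n + 1) * ((weightBound C n / 1) ^ 2 / 2)))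
  have hTm : ∀ m, Measurable (T m) := fun m =>
    (hS (m + 1) (by omega)).measurable_weightedSum hg measurable_const n
  have hSm : ∀ m, Measurable (S m) := fun m =>
    (hS (m + 1) (by omega)).measurable_weightedSum hg hm1 n
  have hYm : ∀ m, Measurable (Y m) := fun m => (hSm m).div_const _
  have hDm : ∀ m, Measurable (D m) := fun m => ((hTm m).sub_const _).div_const _
  have hZm : ∀ m, Measurable (Z m) := fun m => ((hSm m).div (hTm m)).const_mul _
  set A := 1 / γ + (B + |c|) / γ ^ 2 with hA
  have hA0 : 0 ≤ A := by positivity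
  have hsqnorm : ∀ (m : ℕ) (V : Ω (m + 1) → ℝ) (L : ℝ), 0 ≤ L →
      eLpNorm V (ENNReal.ofReal (p * 2)) (P (m + 1)) ≤ ENNReal.ofReal L →
      eLpNorm (fun ω => V ω ^ 2) (ENNReal.ofReal p) (P (m + 1)) ≤ ENNReal.ofReal (L ^ 2) := by
    intro m V L hL0 hL
    have e := eLpNorm_norm_rpow (p := ENNReal.ofReal p) (μ := P (m + 1)) V (q := 2) (by norm_num)
    have e2 : (fun ω => ‖V ω‖ ^ (2 : ℝ)) = fun ω => V ω ^ 2 := by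
      ext ω
      rw [Real.rpow_two, Real.norm_eq_abs, sq_abs]
    rw [e2, ← ENNReal.ofReal_mul hp0.le] at e
    rw [e, ENNReal.ofReal_pow hL0, ← ENNReal.rpow_natCast]
    exact ENNReal.rpow_le_rpow hL (by norm_num)
  have hdiff : ∀ m, eLpNorm (fun ω => Z m ω - Y m ω) (ENNReal.ofReal p) (P (m + 1)) ≤
      ENNReal.ofReal (A / √(M * (m + 1) : ℕ) * (L₁ ^ 2 + L₂ ^ 2)) := by
    intro m
    have hNpos : (0 : ℝ) < (M * (m + 1) : ℕ) := by exact_mod_cast Nat.pos_of_ne_zero (hNe m).ne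
    have hpt : ∀ ω, ‖Z m ω - Y m ω‖ ≤ ‖A / √(M * (m + 1) : ℕ) * (Y m ω ^ 2 + D m ω ^ 2)‖ := by
      intro ω
      refine le_trans ?_ (Real.le_norm_self _)
      exact abs_sqrt_mul_div_sub_le (weightedSum_one_pos hg (hα m) _ n) hNpos hγpos
        (abs_weightedSum_le_mul hg (hα m) hB1 _ n)
    refine (eLpNorm_mono hpt).trans ?_
    have e := eLpNorm_const_smul (A / √(M * (m + 1) : ℕ)) (fun ω => Y m ω ^ 2 + D m ω ^ 2)
      (ENNReal.ofReal p) (P (m + 1))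
    have e' : (A / √(M * (m + 1) : ℕ)) • (fun ω => Y m ω ^ 2 + D m ω ^ 2) =
      fun ω => A / √(M * (m + 1) : ℕ) * (Y m ω ^ 2 + D m ω ^ 2) := rfl
    rw [e'] at e
    rw [e, ENNReal.ofReal_mul (by positivity), Real.enorm_of_nonneg (by positivity)]
    gcongr
    refine (eLpNorm_add_le ((hYm m).pow_const 2).aestronglyMeasurable
      ((hDm m).pow_const 2).aestronglyMeasurable hp1).trans ?_
    rw [ENNReal.ofReal_add (by positivity) (by positivity)]
    exact add_le_add (hsqnorm m _ _ hL₁0 (hL₁ _ _ (hYexp m)))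
      (hsqnorm m _ _ hL₂0 (hL₂ _ _ (hDexp m)))
  have hNtop : Tendsto (fun m : ℕ => M * (m + 1)) atTop atTop :=
    tendsto_atTop_mono (fun m => Nat.le_mul_of_pos_left _ (by omega)) (tendsto_add_atTop_nat 1)
  have hε : Tendsto (fun m : ℕ => ENNReal.ofReal (A / √(M * (m + 1) : ℕ) * (L₁ ^ 2 + L₂ ^ 2))) atTop
      (𝓝 0) := by
    rw [← ENNReal.ofReal_zero]
    refine ENNReal.tendsto_ofReal ?_
    rw [← zero_mul (L₁ ^ 2 + L₂ ^ 2)]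
    exact Tendsto.mul_const _ (Tendsto.div_atTop tendsto_const_nhds
      (Real.tendsto_sqrt_atTop.comp (tendsto_natCast_atTop_atTop.comp hNtop)))
  have hZ : Tendsto (fun m => eLpNorm (Z m) (ENNReal.ofReal p) (P (m + 1))) atTop
      (𝓝 (ENNReal.ofReal (√(2 * σ2) * (Real.Gamma ((p + 1) / 2) / √Real.pi) ^ (1 / p)))) := by
    have hup := hY.add hε
    have hlo := ENNReal.Tendsto.sub hY hε (Or.inl ENNReal.ofReal_ne_top)
    rw [add_zero] at hup
    rw [tsub_zero] at hlo
    refine tendsto_of_tendsto_of_tendsto_of_le_of_le hlo hup (fun m => ?_) fun m => ?_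
    · rw [tsub_le_iff_right]
      have e : Y m = Z m - fun ω => Z m ω - Y m ω := by ext ω; simp
      calc eLpNorm (Y m) (ENNReal.ofReal p) (P (m + 1))
          ≤ eLpNorm (Z m) (ENNReal.ofReal p) (P (m + 1)) +
            eLpNorm (fun ω => Z m ω - Y m ω) (ENNReal.ofReal p) (P (m + 1)) := by
            conv_lhs => rw [e]
            exact eLpNorm_sub_le (hZm m).aestronglyMeasurable
              ((hZm m).sub (hYm m)).aestronglyMeasurable hp1
        _ ≤ _ := by gcongr; exact hdiff m
    · have e : Z m = Y m + fun ω => Z m ω - Y m ω := by ext ω; simp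
      calc eLpNorm (Z m) (ENNReal.ofReal p) (P (m + 1))
          ≤ eLpNorm (Y m) (ENNReal.ofReal p) (P (m + 1)) +
            eLpNorm (fun ω => Z m ω - Y m ω) (ENNReal.ofReal p) (P (m + 1)) := by
            conv_lhs => rw [e]
            exact eLpNorm_add_le (hYm m).aestronglyMeasurable
              ((hZm m).sub (hYm m)).aestronglyMeasurable hp1
        _ ≤ _ := by gcongr; exact hdiff m
  have hfin := ENNReal.Tendsto.const_mul (a := ENNReal.ofReal (1 / √M)) hZ
    (Or.inr ENNReal.ofReal_ne_top)
  have hM0 : (0 : ℝ) < M := by positivity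
  rw [← ENNReal.ofReal_mul (by positivity)] at hfin
  have e0 : 1 / √(M : ℝ) * (√(2 * σ2) * (Real.Gamma ((p + 1) / 2) / √Real.pi) ^ (1 / p)) =
      √σ2 / √M * √2 * (Real.Gamma ((p + 1) / 2) / √Real.pi) ^ (1 / p) := by
    rw [Real.sqrt_mul (by norm_num)]
    ring
  rw [e0] at hfin
  refine hfin.congr fun m => ?_
  have e1 := eLpNorm_const_smul (1 / √(M : ℝ)) (Z m) (ENNReal.ofReal p) (P (m + 1))
  have e2 := eLpNorm_const_smul (√((m + 1 : ℕ) : ℝ)) (fun ω =>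
    estimate (α (m + 1)) g φ (fun k => ζ (m + 1) k ω) n - c) (ENNReal.ofReal p) (P (m + 1))
  rw [Real.enorm_of_nonneg (by positivity)] at e1 e2
  rw [lpError, ← hc, ← e2, ← e1]
  congr 1
  ext ω
  simp only [Pi.smul_apply, smul_eq_mul, Z, S, T]
  rw [estimate_sub_eq hg (hα m), Nat.cast_mul, Real.sqrt_mul hM0.le]
  field_simp

/-- Bounds on the normalised errors that are uniform in time bound the asymptotic variances. For
each time it suffices that the bound holds for arbitrarily large `m`. -/
theorem limsup_asympVar_ne_top (hg : IsPotential g C) {φ : X → ℝ} (hφ : Measurable φ) {B : ℝ}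
    (hB : ∀ x, |φ x| ≤ B) (hM : 1 < M) (hI : IsLocalInteraction M β α αinf)
    (hS : ∀ m, 1 ≤ m → IsParticleSystem π₀ f g (α m) (P m) (ζ m)) {p : ℝ} (hp : 1 ≤ p) {K : ℝ≥0∞}
    (hK : K ≠ ∞) (hbound : ∀ n, ∃ᶠ m : ℕ in atTop,
      ENNReal.ofReal √m * lpError π₀ f g (α m) φ (P m) (ζ m) p n ≤ K) :
    limsup (fun n => (asympVar π₀ f g φ M β αinf n : EReal)) atTop ≠ ⊤ := by
  set cp := √2 * (Real.Gamma ((p + 1) / 2) / √Real.pi) ^ (1 / p) / √M with hcp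
  have hM0 : (0 : ℝ) < M := by positivity
  have hcp0 : 0 < cp := by
    have : 0 < Real.Gamma ((p + 1) / 2) := Real.Gamma_pos_of_pos (by linarith)
    positivity
  have key : ∀ n, asympVar π₀ f g φ M β αinf n ≤ (K.toReal / cp) ^ 2 := by
    intro n
    rcases le_or_gt (asympVar π₀ f g φ M β αinf n) 0 with h | h
    · exact h.trans (sq_nonneg _)
    · have hlim := tendsto_sqrt_mul_lpError hg hφ hB hM hI hS n h hp
      have h1 := le_of_tendsto_of_frequently hlim (hbound n)
      rw [ENNReal.ofReal_le_iff_le_toReal hK] at h1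
      have h2 : √(asympVar π₀ f g φ M β αinf n) ≤ K.toReal / cp := by
        rw [le_div_iff₀ hcp0]
        refine le_trans (le_of_eq ?_) h1
        rw [hcp]
        ring
      calc _ = √(asympVar π₀ f g φ M β αinf n) ^ 2 := (Real.sq_sqrt h.le).symm
        _ ≤ _ := by gcongr
  refine ne_top_of_le_ne_top (EReal.coe_ne_top ((K.toReal / cp) ^ 2)) ?_
  exact limsup_le_of_le (h := Eventually.of_forall fun n => EReal.coe_le_coe_iff.2 (key n))

end ParticleSystem

end LocalExchange

namespace LocalExchange

/-! ### Stability under the mixing condition -/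

/-- The ratio `p / q` takes values in `[a, b]`, and the positive function `q` varies by a factor of
at most `κ`. -/
structure IsBoundedRatio {X : Type*} [MeasurableSpace X] (κ a b : ℝ) (p q : X → ℝ) : Prop where
  measurable_num : Measurable p
  measurable_den : Measurable q
  den_pos : ∀ x, 0 < q x
  den_le : ∀ x y, q x ≤ κ * q y
  le_num : ∀ x, a * q x ≤ p x
  num_le : ∀ x, p x ≤ b * q x

/-- A weighted ratio of averages lies between the bounds of the ratio. -/
theorem IsBoundedRatio.sum_div_sum_mem {X : Type*} [MeasurableSpace X] {κ a b : ℝ}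
    {p q : X → ℝ} (h : IsBoundedRatio κ a b p q) {N : ℕ} [NeZero N]
    {w : Fin N → ℝ} (hw : ∀ i, 0 < w i) (y : Fin N → X) :
    a ≤ (∑ i, w i * p (y i)) / ∑ i, w i * q (y i) ∧
      (∑ i, w i * p (y i)) / ∑ i, w i * q (y i) ≤ b := by
  have hT : 0 < ∑ i, w i * q (y i) :=
    Finset.sum_pos (fun i _ => mul_pos (hw i) (h.den_pos _)) Finset.univ_nonempty
  rw [le_div_iff₀ hT, div_le_iff₀ hT, Finset.mul_sum, Finset.mul_sum]
  constructor
  · refine Finset.sum_le_sum fun i _ => ?_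
    rw [mul_left_comm]
    exact mul_le_mul_of_nonneg_left (h.le_num _) (hw i).le
  · refine Finset.sum_le_sum fun i _ => ?_
    rw [mul_left_comm]
    exact mul_le_mul_of_nonneg_left (h.num_le _) (hw i).le

section Ratio

variable {X : Type*} [MeasurableSpace X] [Nonempty X] {κ a b : ℝ} {p q : X → ℝ}

theorem IsBoundedRatio.one_le (h : IsBoundedRatio κ a b p q) : 1 ≤ κ := by
  have h0 := h.den_pos (Classical.arbitrary X)
  have h1 := h.den_le (Classical.arbitrary X) (Classical.arbitrary X)
  by_contra hκ
  nlinarith [not_le.1 hκ]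

theorem IsBoundedRatio.le (h : IsBoundedRatio κ a b p q) : a ≤ b :=
  le_of_mul_le_mul_right ((h.le_num (Classical.arbitrary X)).trans (h.num_le _)) (h.den_pos _)

theorem IsBoundedRatio.abs_den_le (h : IsBoundedRatio κ a b p q) (x : X) :
    |q x| ≤ κ * q (Classical.arbitrary X) := by
  rw [abs_of_pos (h.den_pos x)]
  exact h.den_le _ _

theorem IsBoundedRatio.abs_sub_le (h : IsBoundedRatio κ a b p q) {r : ℝ} (ha : a ≤ r) (hb : r ≤ b)
    (x : X) : |p x - r * q x| ≤ (b - a) * (κ * q (Classical.arbitrary X)) := by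
  have h0 := h.den_pos x
  have hab := h.le
  refine le_trans ?_ (mul_le_mul_of_nonneg_left (h.den_le x _) (by linarith))
  rw [abs_le]
  constructor <;> nlinarith [h.le_num x, h.num_le x]

theorem IsBoundedRatio.abs_num_le (h : IsBoundedRatio κ a b p q) (x : X) :
    |p x| ≤ (b - a) * (κ * q (Classical.arbitrary X)) +
      |a| * (κ * q (Classical.arbitrary X)) := by
  have e : p x = (p x - a * q x) + a * q x := by ring
  rw [e]
  refine (abs_add_le _ _).trans (add_le_add (h.abs_sub_le le_rfl h.le x) ?_)
  rw [abs_mul]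
  exact mul_le_mul_of_nonneg_left (h.abs_den_le x) (abs_nonneg _)

/-- The fluctuations of a weighted ratio of independent samples around its mean field value are
controlled by the effective sample size of the weights. -/
theorem IsBoundedRatio.integral_abs_sum_div_sum_sub_le (h : IsBoundedRatio κ a b p q) {N : ℕ}
    [NeZero N] {μ : Fin N → Measure X} [∀ i, IsProbabilityMeasure (μ i)] {w : Fin N → ℝ}
    (hw : ∀ i, 0 < w i) {r : ℝ} (ha : a ≤ r) (hb : r ≤ b)
    (hmean : ∑ i, w i * ∫ x, (p x - r * q x) ∂μ i = 0) :
    ∫ y, |(∑ i, w i * p (y i)) / (∑ i, w i * q (y i)) - r| ∂(Measure.pi μ) ≤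
      κ ^ 2 * (b - a) * (√(∑ i, w i ^ 2) / ∑ i, w i) := by
  set x₀ : X := Classical.arbitrary X with hx₀
  have hκ := h.one_le
  have hab := h.le
  have hq₀ := h.den_pos x₀
  have hW : 0 < ∑ i, w i := Finset.sum_pos (fun i _ => hw i) Finset.univ_nonempty
  set E := (b - a) * (κ * q x₀) with hE
  have hE0 : 0 ≤ E := mul_nonneg (by linarith) (by positivity)
  have hm : Measurable fun x => p x - r * q x :=
    h.measurable_num.sub (h.measurable_den.const_mul r)
  have hB : ∀ x, |p x - r * q x| ≤ E := h.abs_sub_le ha hb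
  set F : (Fin N → X) → ℝ := fun y => ∑ i, w i * (p (y i) - r * q (y i)) with hF
  have hFm : Measurable F := Finset.measurable_sum _ fun i _ =>
    (hm.comp (measurable_pi_apply i)).const_mul _
  have hwB : ∀ i x, |w i * (p x - r * q x)| ≤ w i * E := fun i x => by
    rw [abs_mul, abs_of_pos (hw i)]
    exact mul_le_mul_of_nonneg_left (hB x) (hw i).le
  have hwle : ∀ i, w i ≤ ∑ i, w i := fun i =>
    Finset.single_le_sum (f := w) (fun j _ => (hw j).le) (Finset.mem_univ i)
  have hFB : ∀ y, |F y| ≤ ∑ i, w i * E := fun y =>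
    (Finset.abs_sum_le_sum_abs _ _).trans (Finset.sum_le_sum fun i _ => hwB i _)
  have hsq : ∫ y, F y ^ 2 ∂(Measure.pi μ) ≤ E ^ 2 * ∑ i, w i ^ 2 := by
    rw [integral_pi_sum_sq μ (h := fun i x => w i * (p x - r * q x)) (fun i => hm.const_mul _)
      (D := (∑ i, w i) * E) fun i x => (hwB i x).trans
        (mul_le_mul_of_nonneg_right (hwle i) hE0)]
    simp only [integral_const_mul, hmean]
    rw [zero_pow two_ne_zero, add_zero, Finset.mul_sum]
    refine Finset.sum_le_sum fun i _ => ?_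
    have hv := variance_le_sq_of_bounded (μ := μ i) (X := fun x => w i * (p x - r * q x))
      (a := -(w i * E)) (b := w i * E) (ae_of_all _ fun x => abs_le.1 (hwB i x))
      (hm.const_mul _).aemeasurable
    exact hv.trans (le_of_eq (by ring))
  have habs : ∫ y, |F y| ∂(Measure.pi μ) ≤ E * √(∑ i, w i ^ 2) := by
    have hv := variance_nonneg (fun y => |F y|) (Measure.pi μ)
    rw [variance_eq_sub (memLp_of_bounded hFm.abs (B := ∑ i, w i * E) (fun y => by
      rw [abs_abs]; exact hFB y) 2)] at hv
    simp only [Pi.pow_apply, sq_abs] at hv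
    refine abs_le_of_sq_le_sq' (b := E * √(∑ i, w i ^ 2)) ?_ (by positivity) |>.2
    rw [mul_pow, Real.sq_sqrt (Finset.sum_nonneg fun i _ => sq_nonneg _)]
    linarith
  have hden : ∀ y : Fin N → X, (q x₀ / κ) * ∑ i, w i ≤ ∑ i, w i * q (y i) := fun y => by
    rw [Finset.mul_sum]
    refine Finset.sum_le_sum fun i _ => ?_
    rw [mul_comm]
    refine mul_le_mul_of_nonneg_left ?_ (hw i).le
    rw [div_le_iff₀ (by linarith), mul_comm]
    exact h.den_le _ _
  have hκ0 : 0 < κ := by linarith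
  have hd0 : 0 < (q x₀ / κ) * ∑ i, w i := by positivity
  have hpt : ∀ y, |(∑ i, w i * p (y i)) / (∑ i, w i * q (y i)) - r| ≤
      |F y| / ((q x₀ / κ) * ∑ i, w i) := fun y => by
    have hT := hd0.trans_le (hden y)
    have e : (∑ i, w i * p (y i)) / (∑ i, w i * q (y i)) - r = F y / ∑ i, w i * q (y i) := by
      rw [eq_div_iff hT.ne', sub_mul, div_mul_cancel₀ _ hT.ne', hF, Finset.mul_sum,
        ← Finset.sum_sub_distrib]
      exact Finset.sum_congr rfl fun i _ => by ring
    rw [e, abs_div, abs_of_pos hT]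
    exact div_le_div_of_nonneg_left (abs_nonneg _) hd0 (hden y)
  calc ∫ y, |(∑ i, w i * p (y i)) / (∑ i, w i * q (y i)) - r| ∂(Measure.pi μ)
      ≤ ∫ y, |F y| / ((q x₀ / κ) * ∑ i, w i) ∂(Measure.pi μ) := by
        refine integral_mono_of_nonneg (ae_of_all _ fun _ => abs_nonneg _) ?_ (ae_of_all _ hpt)
        exact (integrable_of_bounded hFm.abs (B := ∑ i, w i * E) fun y => by
          rw [Real.norm_eq_abs, abs_abs]; exact hFB y).div_const _
    _ = (∫ y, |F y| ∂(Measure.pi μ)) / ((q x₀ / κ) * ∑ i, w i) := integral_div _ _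
    _ ≤ E * √(∑ i, w i ^ 2) / ((q x₀ / κ) * ∑ i, w i) := by gcongr
    _ = _ := by
        rw [hE]
        field_simp

end Ratio

theorem integral_le_mul_integral_of_le_smul {X : Type*} [MeasurableSpace X] {μ ν : Measure X}
    [IsFiniteMeasure ν] {ε : ℝ} (hε : 0 ≤ ε) (h : μ ≤ ENNReal.ofReal ε • ν) {u : X → ℝ}
    (hm : Measurable u) (h0 : ∀ x, 0 ≤ u x) {B : ℝ} (hB : ∀ x, u x ≤ B) :
    ∫ x, u x ∂μ ≤ ε * ∫ x, u x ∂ν := by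
  have hi : Integrable u (ENNReal.ofReal ε • ν) :=
    (integrable_of_bounded hm (B := B) fun x => by
      rw [Real.norm_of_nonneg (h0 x)]; exact hB x).smul_measure ENNReal.ofReal_ne_top
  refine (integral_mono_measure h (ae_of_all _ h0) hi).trans (le_of_eq ?_)
  rw [integral_smul_measure, ENNReal.toReal_ofReal hε, smul_eq_mul]

section Contraction

variable {X : Type*} [MeasurableSpace X] [Nonempty X] {f : Kernel X X} [IsMarkovKernel f]
  {g : ℕ → X → ℝ} {C : ℕ → ℝ}

/-- Doeblin's argument: propagation keeps the denominators comparable, and contracts the range of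
the ratio by the factor `1 - ε⁻²`. -/
theorem IsBoundedRatio.propagate (hg : IsPotential g C) {δ ε κ a b : ℝ} (hε : 1 ≤ ε)
    (hgδ : ∀ n x y, g n x / g n y ≤ δ) (hfε : ∀ x y, f x ≤ ENNReal.ofReal ε • f y)
    {p q : X → ℝ} (h : IsBoundedRatio κ a b p q) (n : ℕ) :
    ∃ a' b', a ≤ a' ∧ b' ≤ b ∧ b' - a' = (1 - 1 / ε ^ 2) * (b - a) ∧
      IsBoundedRatio (δ * ε) a' b' (propagate f g n p) (propagate f g n q) := by
  set x₀ : X := Classical.arbitrary X with hx₀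
  have hκ := h.one_le
  have hab := h.le
  have hε0 : 0 < ε := by linarith
  have hqi : ∀ x, Integrable q (f x) := fun x => integrable_of_bounded h.measurable_den h.abs_den_le
  have hpi : ∀ x, Integrable p (f x) := fun x => integrable_of_bounded h.measurable_num h.abs_num_le
  set K := q x₀ / κ with hK
  have hK0 : 0 < K := div_pos (h.den_pos _) (by linarith)
  have hqK : ∀ x, K ≤ ∫ y, q y ∂(f x) := fun x => by
    have e : ∫ _ : X, K ∂(f x) = K := by simp
    rw [← e]
    refine integral_mono (integrable_const _) (hqi x) fun y => ?_
    rw [hK, div_le_iff₀ (by linarith), mul_comm]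
    exact h.den_le _ _
  have hq0 : ∀ x, 0 < ∫ y, q y ∂(f x) := fun x => hK0.trans_le (hqK x)
  have hqε : ∀ x y, ∫ t, q t ∂(f x) ≤ ε * ∫ t, q t ∂(f y) := fun x y =>
    integral_le_mul_integral_of_le_smul hε0.le (hfε x y) h.measurable_den
      (fun t => (h.den_pos t).le) fun t => h.den_le t x₀
  have hum : Measurable fun x => p x - a * q x :=
    h.measurable_num.sub (h.measurable_den.const_mul a)
  have hwm : Measurable fun x => b * q x - p x :=
    (h.measurable_den.const_mul b).sub h.measurable_num
  have huε : ∀ x y, ∫ t, (p t - a * q t) ∂(f x) ≤ ε * ∫ t, (p t - a * q t) ∂(f y) := fun x y =>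
    integral_le_mul_integral_of_le_smul hε0.le (hfε x y) hum (fun t => sub_nonneg.2 (h.le_num t))
      fun t => (le_abs_self _).trans (h.abs_sub_le le_rfl hab t)
  have hwε : ∀ x y, ∫ t, (b * q t - p t) ∂(f x) ≤ ε * ∫ t, (b * q t - p t) ∂(f y) := fun x y =>
    integral_le_mul_integral_of_le_smul hε0.le (hfε x y) hwm (fun t => sub_nonneg.2 (h.num_le t))
      fun t => (le_abs_self _).trans ((abs_sub_comm _ _).trans_le (h.abs_sub_le hab le_rfl t))
  have eu : ∀ x, ∫ t, (p t - a * q t) ∂(f x) = ∫ t, p t ∂(f x) - a * ∫ t, q t ∂(f x) := fun x => by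
    rw [integral_sub (hpi x) ((hqi x).const_mul a), integral_const_mul]
  have ew : ∀ x, ∫ t, (b * q t - p t) ∂(f x) = b * ∫ t, q t ∂(f x) - ∫ t, p t ∂(f x) := fun x => by
    rw [integral_sub ((hqi x).const_mul b) (hpi x), integral_const_mul]
  have hu0 : 0 ≤ ∫ t, (p t - a * q t) ∂(f x₀) := integral_nonneg fun t => sub_nonneg.2 (h.le_num t)
  have hw0 : 0 ≤ ∫ t, (b * q t - p t) ∂(f x₀) := integral_nonneg fun t => sub_nonneg.2 (h.num_le t)
  set s := (∫ t, (p t - a * q t) ∂(f x₀)) / ∫ t, q t ∂(f x₀) with hs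
  set t₀ := (∫ t, (b * q t - p t) ∂(f x₀)) / ∫ t, q t ∂(f x₀) with ht₀
  have hs0 : 0 ≤ s := div_nonneg hu0 (hq0 x₀).le
  have ht0 : 0 ≤ t₀ := div_nonneg hw0 (hq0 x₀).le
  have hst : s + t₀ = b - a := by
    rw [hs, ht₀, ← add_div, eu, ew, div_eq_iff (hq0 x₀).ne']
    ring
  -- The mass that `f x` gives to a nonnegative function is at least `ε⁻¹` times that of `f x₀`,
  -- whereas the mass given to `q` is at most `ε` times as large.
  have hlow : ∀ (v : X → ℝ), (∀ x y, ∫ t, v t ∂(f x) ≤ ε * ∫ t, v t ∂(f y)) →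
      0 ≤ ∫ t, v t ∂(f x₀) → ∀ x,
      (1 / ε ^ 2 * ((∫ t, v t ∂(f x₀)) / ∫ t, q t ∂(f x₀))) * ∫ t, q t ∂(f x) ≤
        ∫ t, v t ∂(f x) := by
    intro v hv hv0 x
    have h1 := hv x₀ x
    have h2 := hqε x x₀
    have h3 := hq0 x₀
    calc (1 / ε ^ 2 * ((∫ t, v t ∂(f x₀)) / ∫ t, q t ∂(f x₀))) * ∫ t, q t ∂(f x)
        ≤ (1 / ε ^ 2 * ((∫ t, v t ∂(f x₀)) / ∫ t, q t ∂(f x₀))) * (ε * ∫ t, q t ∂(f x₀)) := by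
          gcongr
      _ = (∫ t, v t ∂(f x₀)) / ε := by field_simp
      _ ≤ _ := by rwa [div_le_iff₀ hε0, mul_comm]
  have hulow := fun x => hlow _ huε hu0 x
  have hwlow := fun x => hlow _ hwε hw0 x
  refine ⟨a + 1 / ε ^ 2 * s, b - 1 / ε ^ 2 * t₀, ?_, ?_, ?_, ?_⟩
  · have : 0 ≤ 1 / ε ^ 2 * s := by positivity
    linarith
  · have : 0 ≤ 1 / ε ^ 2 * t₀ := by positivity
    linarith
  · rw [← hst]
    linear_combination -hst
  · refine ⟨measurable_propagate hg n h.measurable_num, measurable_propagate hg n h.measurable_den,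
      fun x => mul_pos (hg.pos n x) (hq0 x), fun x y => ?_, fun x => ?_, fun x => ?_⟩
    · have h1 : g n x ≤ δ * g n y := (div_le_iff₀ (hg.pos n y)).1 (hgδ n x y)
      calc g n x * ∫ t, q t ∂(f x) ≤ (δ * g n y) * (ε * ∫ t, q t ∂(f y)) :=
            mul_le_mul h1 (hqε x y) (hq0 x).le ((hg.pos n x).le.trans h1)
        _ = _ := by rw [LocalExchange.propagate]; ring
    · have h1 := hulow x
      rw [eu x] at h1
      have h2 := hg.pos n x
      rw [LocalExchange.propagate, LocalExchange.propagate, mul_left_comm]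
      refine mul_le_mul_of_nonneg_left ?_ h2.le
      rw [hs]
      linarith
    · have h1 := hwlow x
      rw [ew x] at h1
      have h2 := hg.pos n x
      rw [LocalExchange.propagate, LocalExchange.propagate, mul_left_comm]
      refine mul_le_mul_of_nonneg_left ?_ h2.le
      rw [ht₀]
      linarith

end Contraction

section WeightRatio

variable {Y : Type*} [MeasurableSpace Y] {g : ℕ → Y → ℝ} {C : ℕ → ℝ} {N : ℕ}
  {α : Matrix (Fin N) (Fin N) ℝ}

/-- The square root of the inverse of the effective sample size. -/
noncomputable def weightRatio (α : Matrix (Fin N) (Fin N) ℝ) (g : ℕ → Y → ℝ)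
    (z : ℕ → Fin N → Y) (n : ℕ) : ℝ :=
  √(∑ i, weight α g z n i ^ 2) / ∑ i, weight α g z n i

theorem measurable_weightRatio (hg : IsPotential g C) (α : Matrix (Fin N) (Fin N) ℝ) (n : ℕ) :
    Measurable fun z : ℕ → Fin N → Y => weightRatio α g z n :=
  (Finset.measurable_sum _ fun i _ => (measurable_weight hg α n i).pow_const 2).sqrt.div
    (Finset.measurable_sum _ fun i _ => measurable_weight hg α n i)

theorem weightRatio_nonneg (hg : IsPotential g C)
    (hα : α ∈ doublyStochastic ℝ (Fin N)) (z : ℕ → Fin N → Y) (n : ℕ) : 0 ≤ weightRatio α g z n :=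
  div_nonneg (Real.sqrt_nonneg _) (Finset.sum_nonneg fun i _ => (weight_pos hg hα z n i).le)

theorem weightRatio_le_one (hg : IsPotential g C)
    (hα : α ∈ doublyStochastic ℝ (Fin N)) (z : ℕ → Fin N → Y) (n : ℕ) :
    weightRatio α g z n ≤ 1 := by
  have h0 : 0 ≤ ∑ i, weight α g z n i := Finset.sum_nonneg fun i _ => (weight_pos hg hα z n i).le
  refine div_le_one_of_le₀ (Real.sqrt_le_iff.2 ⟨h0, ?_⟩) h0
  exact Finset.sum_sq_le_sq_sum_of_nonneg fun i _ => (weight_pos hg hα z n i).le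

end WeightRatio

section ParticleSystem

variable {X : Type*} [MeasurableSpace X] [StandardBorelSpace X] [Nonempty X] {π₀ : Measure X}
  [IsProbabilityMeasure π₀] {f : Kernel X X} [IsMarkovKernel f] {g : ℕ → X → ℝ} {C : ℕ → ℝ}
  {N : ℕ} [NeZero N] {α : Matrix (Fin N) (Fin N) ℝ} {Ω : Type*} [MeasurableSpace Ω] {P : Measure Ω}
  [IsProbabilityMeasure P] {ζ : ℕ → Ω → Fin N → X}

/-- Under the mixing condition the error is bounded, uniformly in time, in terms of the expected
inverse effective sample sizes. The numerator and the denominator are propagated back one step at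
a time: each step adds a fluctuation that is proportional to the range of their ratio, and this
range decreases geometrically. -/
theorem IsParticleSystem.integral_abs_ratio_sub_le (hS : IsParticleSystem π₀ f g α P ζ)
    (hg : IsPotential g C) (hα : α ∈ doublyStochastic ℝ (Fin N)) {δ ε : ℝ}
    (hε : 1 ≤ ε) (hgδ : ∀ n x y, g n x / g n y ≤ δ)
    (hfε : ∀ x y, f x ≤ ENNReal.ofReal ε • f y) {R : ℝ}
    (hR : ∀ n, ∫ ω, weightRatio α g (fun k => ζ k ω) n ∂P ≤ R) (n : ℕ) {a b : ℝ} {p q : X → ℝ}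
    (h : IsBoundedRatio (δ * ε) a b p q) :
    ∫ ω, |weightedSum α g p (fun k => ζ k ω) n / weightedSum α g q (fun k => ζ k ω) n -
      (∫ x, p x ∂(unnormFilter π₀ f g n)) / ∫ x, q x ∂(unnormFilter π₀ f g n)| ∂P ≤
        (δ * ε) ^ 2 * ε ^ 2 * (b - a) * R := by
  have hε2 : 1 ≤ ε ^ 2 := one_le_pow₀ hε
  have hR0 : 0 ≤ R := (integral_nonneg fun ω => weightRatio_nonneg hg hα _ 0).trans (hR 0)
  induction n generalizing a b p q with
  | zero =>
    have hab := h.le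
    have hpi : Integrable p π₀ := integrable_of_bounded h.measurable_num h.abs_num_le
    have hqi : Integrable q π₀ := integrable_of_bounded h.measurable_den h.abs_den_le
    have hq0 : 0 < ∫ x, q x ∂π₀ := by
      rw [integral_pos_iff_support_of_nonneg (fun x => (h.den_pos x).le) hqi]
      have : Function.support q = Set.univ := by
        ext x; simp [(h.den_pos x).ne']
      simp [this]
    set r := (∫ x, p x ∂π₀) / ∫ x, q x ∂π₀ with hr
    have ha : a ≤ r := by
      rw [hr, le_div_iff₀ hq0, ← integral_const_mul]
      exact integral_mono (hqi.const_mul a) hpi h.le_num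
    have hb : r ≤ b := by
      rw [hr, div_le_iff₀ hq0, ← integral_const_mul]
      exact integral_mono hpi (hqi.const_mul b) h.num_le
    have key := h.integral_abs_sum_div_sum_sub_le (μ := fun _ : Fin N => π₀) (w := fun _ => 1)
      (fun _ => one_pos) ha hb (by
        rw [integral_sub hpi (hqi.const_mul r), integral_const_mul, hr, div_mul_cancel₀ _ hq0.ne']
        simp)
    have hGm : Measurable fun y : Fin N → X =>
        |(∑ i, 1 * p (y i)) / (∑ i, 1 * q (y i)) - r| := by
      have := h.measurable_num
      have := h.measurable_den
      fun_prop
    have e := hS.integral_zero hGm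
    simp only [weightedSum, weight, unnormFilter]
    rw [e]
    have hR' := hR 0
    have e2 : ∀ z : ℕ → Fin N → X, weightRatio α g z 0 = √(∑ _i : Fin N, (1 : ℝ) ^ 2) /
      ∑ _i : Fin N, (1 : ℝ) := fun z => rfl
    simp only [e2, integral_const, probReal_univ, one_smul] at hR'
    refine key.trans ?_
    have h1 : 0 ≤ (δ * ε) ^ 2 * (b - a) := mul_nonneg (sq_nonneg _) (by linarith)
    calc _ ≤ (δ * ε) ^ 2 * (b - a) * R := mul_le_mul_of_nonneg_left hR' h1
      _ = 1 * ((δ * ε) ^ 2 * (b - a) * R) := (one_mul _).symm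
      _ ≤ ε ^ 2 * ((δ * ε) ^ 2 * (b - a) * R) :=
        mul_le_mul_of_nonneg_right hε2 (mul_nonneg h1 hR0)
      _ = _ := by ring
  | succ n ih =>
    have hab := h.le
    obtain ⟨a', b', ha', hb', hab', h'⟩ := h.propagate hg hε hgδ hfε n
    have hrec := ih h'
    have := fun (z : ℕ → Fin N → X) i => isProbabilityMeasure_proposal (f := f) hg hα z n i
    have hpm := measurable_propagate (f := f) hg n h.measurable_num
    have hqm := measurable_propagate (f := f) hg n h.measurable_den
    have hmem := fun z : ℕ → Fin N → X => h'.sum_div_sum_mem (weight_pos hg hα z n) (z n)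
    have hmem1 := fun (z : ℕ → Fin N → X) (y : Fin N → X) =>
      h.sum_div_sum_mem (weight_pos hg hα z (n + 1)) y
    set ψ : (ℕ → Fin N → X) → ℝ := fun z => weightedSum α g (LocalExchange.propagate f g n p) z n /
      weightedSum α g (LocalExchange.propagate f g n q) z n with hψ
    have hψa : ∀ z, a ≤ ψ z := fun z => ha'.trans (hmem z).1
    have hψb : ∀ z, ψ z ≤ b := fun z => (hmem z).2.trans hb'
    have hψm : Measurable ψ := (LocalExchange.measurable_weightedSum hg α hpm n).div
      (LocalExchange.measurable_weightedSum hg α hqm n)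
    let G : (ℕ → Fin N → X) → (Fin N → X) → ℝ := fun z y =>
      |(∑ i, weight α g z (n + 1) i * p (y i)) / (∑ i, weight α g z (n + 1) i * q (y i)) - ψ z|
    have hGm : Measurable (Function.uncurry G) :=
      (((uncurry_weight_measurable hg α h.measurable_num (n + 1)).div
        (uncurry_weight_measurable hg α h.measurable_den (n + 1))).sub
          (hψm.comp measurable_fst)).abs
    have hGB : ∀ z y, ‖G z y‖ ≤ b - a := fun z y => by
      have h1 := hmem1 z y
      have h2 := hψa z
      have h3 := hψb z
      simp only [G]
      rw [Real.norm_eq_abs, abs_abs, abs_le]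
      constructor <;> linarith
    have hpath := hS.measurable_path
    have hGint : Integrable (fun ω => G (fun k => ζ k ω) (ζ (n + 1) ω)) P := by
      have hcomp : Measurable fun ω => Function.uncurry G (fun k => ζ k ω, ζ (n + 1) ω) :=
        hGm.comp (hpath.prodMk (hS.measurable (n + 1)))
      exact integrable_of_bounded (B := b - a) hcomp fun ω => hGB (fun k => ζ k ω) (ζ (n + 1) ω)
    have hdep : ∀ z z' : ℕ → Fin N → X, (∀ k ≤ n, z k = z' k) → G z = G z' := fun z z' hz => by
      have e1 : weight α g z (n + 1) = weight α g z' (n + 1) :=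
        weight_congr α g fun k hk => hz k (by omega)
      have e2 : weight α g z n = weight α g z' n := weight_congr α g fun k hk => hz k (by omega)
      have e3 : z n = z' n := hz n le_rfl
      simp only [G, ψ, weightedSum, e1, e2, e3]
    have e := hS.integral_succ n hGm hdep hGint
    have hstep : ∀ z, ∫ y, G z y ∂(nextLaw α f g z n) ≤
        (δ * ε) ^ 2 * (b - a) * weightRatio α g z (n + 1) := fun z => by
      refine h.integral_abs_sum_div_sum_sub_le (weight_pos hg hα z (n + 1)) (hψa z) (hψb z) ?_
      rw [sum_weight_mul_integral_proposal hg hα z n (h := fun x => p x - ψ z * q x)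
        (h.measurable_num.sub (h.measurable_den.const_mul _)) (h.abs_sub_le (hψa z) (hψb z))]
      have hT : 0 < weightedSum α g (LocalExchange.propagate f g n q) z n :=
        Finset.sum_pos (fun i _ => mul_pos (weight_pos hg hα z n i) (h'.den_pos _))
          Finset.univ_nonempty
      have e1 : LocalExchange.propagate f g n (fun x => p x - ψ z * q x) = fun x =>
          LocalExchange.propagate f g n p x - ψ z * LocalExchange.propagate f g n q x := by
        ext x
        rw [LocalExchange.propagate, integral_sub
          (integrable_of_bounded h.measurable_num h.abs_num_le)
          ((integrable_of_bounded h.measurable_den h.abs_den_le).const_mul _), integral_const_mul,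
          LocalExchange.propagate, LocalExchange.propagate]
        ring
      have e2 : weightedSum α g (fun x => LocalExchange.propagate f g n p x -
          ψ z * LocalExchange.propagate f g n q x) z n =
          weightedSum α g (LocalExchange.propagate f g n p) z n -
            ψ z * weightedSum α g (LocalExchange.propagate f g n q) z n := by
        simp only [weightedSum, Finset.mul_sum, ← Finset.sum_sub_distrib]
        exact Finset.sum_congr rfl fun i _ => by ring
      rw [e1, e2, hψ]
      beta_reduce
      rw [div_mul_cancel₀ _ hT.ne', sub_self]
    have hWint : Integrable (fun ω => weightRatio α g (fun k => ζ k ω) (n + 1)) P :=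
      integrable_of_bounded ((measurable_weightRatio hg α (n + 1)).comp hpath) (B := 1) fun ω => by
        rw [Real.norm_of_nonneg (weightRatio_nonneg hg hα _ _)]
        exact weightRatio_le_one hg hα _ _
    have hκ0 : 0 ≤ (δ * ε) ^ 2 * (b - a) := mul_nonneg (sq_nonneg _) (by linarith)
    have hfluct : ∫ ω, G (fun k => ζ k ω) (ζ (n + 1) ω) ∂P ≤ (δ * ε) ^ 2 * (b - a) * R := by
      rw [e]
      refine (integral_mono (hS.integrable_succ n hGm hdep hGint) (hWint.const_mul _)
        fun ω => hstep _).trans ?_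
      rw [integral_const_mul]
      exact mul_le_mul_of_nonneg_left (hR (n + 1)) hκ0
    rw [integral_unnormFilter_succ hg n h.measurable_num h.abs_num_le,
      integral_unnormFilter_succ hg n h.measurable_den h.abs_den_le]
    set c := (∫ x, LocalExchange.propagate f g n p x ∂(unnormFilter π₀ f g n)) /
      ∫ x, LocalExchange.propagate f g n q x ∂(unnormFilter π₀ f g n) with hc
    have hrint : Integrable (fun ω => |ψ (fun k => ζ k ω) - c|) P :=
      integrable_of_bounded ((hψm.comp hpath).sub_const c).abs (B := |a| + |b| + |c|) fun ω => by
        rw [Real.norm_eq_abs, abs_abs]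
        refine (abs_sub _ _).trans (add_le_add ?_ le_rfl)
        exact (abs_le_max_abs_abs (hψa _) (hψb _)).trans
          (max_le_add_of_nonneg (abs_nonneg _) (abs_nonneg _))
    calc _ ≤ ∫ ω, (G (fun k => ζ k ω) (ζ (n + 1) ω) + |ψ (fun k => ζ k ω) - c|) ∂P :=
          integral_mono_of_nonneg (ae_of_all _ fun _ => abs_nonneg _) (hGint.add hrint)
            (ae_of_all _ fun ω => abs_sub_le _ _ _)
      _ ≤ (δ * ε) ^ 2 * (b - a) * R + (δ * ε) ^ 2 * ε ^ 2 * (b' - a') * R := by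
          rw [integral_add hGint hrint]
          exact add_le_add hfluct hrec
      _ = _ := by
          rw [hab']
          field_simp
          ring

/-- The `L₁` error is bounded uniformly in time in terms of the expected inverse effective sample
sizes. -/
theorem IsParticleSystem.lpError_one_le (hS : IsParticleSystem π₀ f g α P ζ)
    (hg : IsPotential g C) (hα : α ∈ doublyStochastic ℝ (Fin N)) {δ ε : ℝ} (hδ : 1 ≤ δ)
    (hε : 1 ≤ ε) (hgδ : ∀ n x y, g n x / g n y ≤ δ)
    (hfε : ∀ x y, f x ≤ ENNReal.ofReal ε • f y) {R : ℝ}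
    (hR : ∀ n, ∫ ω, weightRatio α g (fun k => ζ k ω) n ∂P ≤ R) {φ : X → ℝ} (hφ : Measurable φ)
    {B : ℝ} (hB : ∀ x, |φ x| ≤ B) (n : ℕ) :
    lpError π₀ f g α φ P ζ 1 n ≤ ENNReal.ofReal ((δ * ε) ^ 2 * ε ^ 2 * (2 * B) * R) := by
  have hfin := isFiniteMeasure_unnormFilter (π₀ := π₀) (f := f) hg n
  have h : IsBoundedRatio (δ * ε) (-B) B φ fun _ => 1 :=
    ⟨hφ, measurable_const, fun _ => one_pos, fun _ _ => by nlinarith,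
      fun x => by simpa using (abs_le.1 (hB x)).1, fun x => by simpa using (abs_le.1 (hB x)).2⟩
  have key := hS.integral_abs_ratio_sub_le hg hα hε hgδ hfε hR n h
  have hm : Measurable fun ω => estimate α g φ (fun k => ζ k ω) n -
      ∫ x, φ x ∂(predFilter π₀ f g n) := by
    simp only [estimate_eq]
    exact ((hS.measurable_weightedSum hg hφ n).div
      (hS.measurable_weightedSum hg measurable_const n)).sub_const _
  rw [lpError, ENNReal.ofReal_one, eLpNorm_one_eq_lintegral_enorm]
  have hb : ∀ ω, |estimate α g φ (fun k => ζ k ω) n - ∫ x, φ x ∂(predFilter π₀ f g n)| ≤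
      B + |∫ x, φ x ∂(predFilter π₀ f g n)| := fun ω => by
    refine (abs_sub _ _).trans (add_le_add ?_ le_rfl)
    rw [estimate_eq, abs_div, abs_of_pos (weightedSum_one_pos hg hα _ n),
      div_le_iff₀ (weightedSum_one_pos hg hα _ n)]
    exact abs_weightedSum_le_mul hg hα hB _ n
  rw [← ofReal_integral_norm_eq_lintegral_enorm (integrable_of_bounded hm hb)]
  refine ENNReal.ofReal_le_ofReal ?_
  simp only [Real.norm_eq_abs, estimate_eq, integral_predFilter hg]
  simp only [integral_const, smul_eq_mul, mul_one] at key
  refine key.trans (le_of_eq (by ring))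

end ParticleSystem

end LocalExchange

namespace LocalExchange

/-! ### Local exchange and independent filters -/

/-- A sum over labels of a function of the group is `M` times the sum over the groups. -/
theorem sum_eq_mul_sum_group {M m : ℕ} {F : Fin (M * m) → ℝ} {G : Fin m → ℝ}
    (h : ∀ (i : Fin (M * m)) (k : Fin m), (i : ℕ) / M = k → F i = G k) :
    ∑ i, F i = M * ∑ k, G k := by
  rcases Nat.eq_zero_or_pos M with rfl | hM
  · have : IsEmpty (Fin (0 * m)) := by rw [Nat.zero_mul]; infer_instance
    simp
  let e : Fin m × Fin M ≃ Fin (M * m) := finProdFinEquiv.trans (finCongr (Nat.mul_comm m M))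
  have he : ∀ x, F (e x) = G x.1 := fun x => h _ _ (by
    have h1 : ((e x : Fin (M * m)) : ℕ) = x.2 + M * x.1 := rfl
    rw [h1, Nat.add_mul_div_left _ _ hM, Nat.div_eq_of_lt x.2.2, zero_add])
  rw [← e.sum_comp, Fintype.sum_prod_type, Finset.mul_sum]
  simp [he]

theorem ediv_modEq_of_modEq {M m : ℕ} (hM : 0 < M) {u v : ℤ} (h : u ≡ v [ZMOD (M * m : ℕ)]) :
    u / M ≡ v / M [ZMOD m] := by
  obtain ⟨l, hl⟩ := h.dvd
  have hM' : (M : ℤ) ≠ 0 := by positivity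
  have e : v = u + M * (m * l) := by
    push_cast at hl
    linear_combination hl
  rw [e, Int.add_mul_ediv_left _ _ hM', Int.modEq_iff_dvd]
  exact ⟨l, by ring⟩

/-- The group of `i` and the group of `(j - θ) mod M m` coincide iff they do modulo `m`. -/
theorem lepfMatrix_apply {M m : ℕ} (hM : 0 < M) (θ : ℕ) (i j : Fin (M * m)) :
    lepfMatrix M θ m i j =
      if ((i : ℕ) : ℤ) / M ≡ (((j : ℕ) : ℤ) - θ) / M [ZMOD m] then (M : ℝ)⁻¹ else 0 := by
  have hN : (0 : ℤ) < (M * m : ℕ) := by exact_mod_cast (Nat.zero_le _).trans_lt i.2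
  have h1 := ediv_modEq_of_modEq hM (Int.mod_modEq (((j : ℕ) : ℤ) - θ) (M * m : ℕ))
  have hM' : (0 : ℤ) < M := by exact_mod_cast hM
  have hb : ∀ u : ℤ, 0 ≤ u → u < (M * m : ℕ) → 0 ≤ u / M ∧ u / M < m := fun u h0 hu =>
    ⟨Int.ediv_nonneg h0 hM'.le, Int.ediv_lt_of_lt_mul hM' (by push_cast at hu; linarith)⟩
  have hi := hb _ (Int.natCast_nonneg (i : ℕ)) (by exact_mod_cast i.2)
  have hj := hb _ (Int.emod_nonneg (((j : ℕ) : ℤ) - θ) hN.ne')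
    (Int.emod_lt_of_pos (((j : ℕ) : ℤ) - θ) hN)
  rw [lepfMatrix]
  refine if_congr ⟨fun h => h ▸ h1, fun h => ?_⟩ rfl rfl
  exact eq_of_modEq_of_abs_sub_lt (h.trans h1.symm) (by rw [abs_lt]; constructor <;> linarith)

theorem abs_sub_le_of_ediv_eq {M : ℕ} (hM : 0 < M) {u v : ℤ} (h : u / M = v / M) :
    |u - v| ≤ M - 1 := by
  have hM' : (0 : ℤ) < M := by exact_mod_cast hM
  have h1 := Int.emod_add_mul_ediv u M
  have h2 := Int.emod_add_mul_ediv v M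
  have h3 := Int.emod_nonneg u hM'.ne'
  have h4 := Int.emod_nonneg v hM'.ne'
  have h5 := Int.emod_lt_of_pos u hM'
  have h6 := Int.emod_lt_of_pos v hM'
  rw [h] at h1
  rw [abs_le]
  constructor <;> linarith

theorem sum_ite_group {M m : ℕ} (hM : 0 < M) (k : Fin m) :
    ∑ i : Fin (M * m), (if ((i : ℕ) : ℤ) / M = (k : ℕ) then (M : ℝ)⁻¹ else 0) = 1 := by
  rw [sum_eq_mul_sum_group (G := fun l : Fin m => if l = k then (M : ℝ)⁻¹ else 0) fun i l hl => ?_]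
  · have : (M : ℝ) ≠ 0 := by positivity
    simp [this]
  · refine if_congr ?_ rfl rfl
    rw [Fin.ext_iff, ← hl]
    norm_cast

theorem lepfMatrix_mem_doublyStochastic {M : ℕ} (hM : 0 < M) (θ : ℕ) {m : ℕ} (hm : 1 ≤ m) :
    lepfMatrix M θ m ∈ doublyStochastic ℝ (Fin (M * m)) := by
  have : NeZero (M * m) := ⟨by positivity⟩
  have hdiv : ∀ i : Fin (M * m), (i : ℕ) / M < m := fun i => Nat.div_lt_of_lt_mul i.2
  have hres : ∀ i j : Fin (M * m), lepfMatrix M θ m i j =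
      if ((i : ℕ) : ℤ) / M = ((residue (M * m) (((j : ℕ) : ℤ) - θ) : ℕ) : ℤ) / M
        then (M : ℝ)⁻¹ else 0 := fun i j => by
    rw [residue_coe]; rfl
  have hbij : Function.Bijective fun j : Fin (M * m) => residue (M * m) (((j : ℕ) : ℤ) - θ) := by
    refine Finite.injective_iff_bijective.1 fun j j' hj => ?_
    have h1 := ((residue_eq_residue_iff _ _).1 hj).add_right (θ : ℤ)
    rw [sub_add_cancel, sub_add_cancel] at h1
    rw [← residue_natCast j, ← residue_natCast j']
    exact (residue_eq_residue_iff _ _).2 h1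
  rw [mem_doublyStochastic_iff_sum]
  refine ⟨fun i j => ?_, fun i => ?_, fun j => ?_⟩
  · rw [hres]
    split_ifs <;> positivity
  · simp_rw [hres]
    rw [hbij.sum_comp fun j : Fin (M * m) =>
      if ((i : ℕ) : ℤ) / M = ((j : ℕ) : ℤ) / M then (M : ℝ)⁻¹ else 0]
    rw [← sum_ite_group hM ⟨(i : ℕ) / M, hdiv i⟩]
    refine Finset.sum_congr rfl fun j _ => if_congr ?_ rfl rfl
    push_cast
    exact eq_comm
  · simp_rw [hres]
    rw [← sum_ite_group hM ⟨(residue (M * m) (((j : ℕ) : ℤ) - θ) : ℕ) / M, hdiv _⟩]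
    push_cast
    rfl

/-- The matrices of the local exchange filter satisfy the structural hypotheses. The shift `θ` may
take any value; `θ = 0` corresponds to independent filters. -/
theorem isLocalInteraction_lepf {M : ℕ} (hM : 1 < M) (θ : ℕ) :
    IsLocalInteraction M (M - 1 + θ) (lepfMatrix M θ) (lepfLimit M θ) := by
  have hM0 : 0 < M := by omega
  have hβ : ((M - 1 + θ : ℕ) : ℤ) = M - 1 + θ := by push_cast [Nat.cast_sub hM.le]; ring
  refine ⟨by omega, fun m hm => lepfMatrix_mem_doublyStochastic hM0 θ hm, ?_, ?_, ?_⟩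
  · intro m hm i j i' j' z hi hj
    rw [lepfMatrix_apply hM0, lepfMatrix_apply hM0]
    have hM' : (M : ℤ) ≠ 0 := by positivity
    have hi2 := ediv_modEq_of_modEq hM0 hi
    have hj2 := ediv_modEq_of_modEq hM0 (hj.sub_right (θ : ℤ))
    have e : ((j : ℕ) : ℤ) + z * M - θ = ((j : ℕ) : ℤ) - θ + z * M := by ring
    rw [e, Int.add_mul_ediv_right _ _ hM'] at hj2
    rw [Int.add_mul_ediv_right _ _ hM'] at hi2
    refine if_congr ⟨fun h => ?_, fun h => ?_⟩ rfl rfl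
    · exact hi2.trans ((h.add_right z).trans hj2.symm)
    · exact Int.ModEq.add_right_cancel' z (hi2.symm.trans (h.trans hj2))
  · intro m hm _ i j hij
    rw [lepfMatrix_apply hM0, if_neg fun h => ?_]
    obtain ⟨l, hl⟩ := h.dvd
    have hM' : (M : ℤ) ≠ 0 := by positivity
    have e : (((i : ℕ) : ℤ) + M * (m * l)) / M = (((j : ℕ) : ℤ) - θ) / M := by
      rw [Int.add_mul_ediv_left _ _ hM']
      linarith
    have h1 := abs_le.1 (abs_sub_le_of_ediv_eq hM0 e)
    have h2 := hij l
    have e2 : l * ((M * m : ℕ) : ℤ) = M * (m * l) := by push_cast; ring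
    rw [hβ, e2] at h2
    refine absurd h2 (not_lt.2 (abs_le.2 ⟨?_, ?_⟩)) <;> linarith
  · intro m hm hN i j i' j' hi hj
    have hM' : (M : ℤ) ≠ 0 := by positivity
    have hN' : 2 * ((M : ℤ) - 1 + θ) + 1 ≤ M * m := by
      rw [← hβ]
      exact_mod_cast hN
    have hi2 := ediv_modEq_of_modEq hM0 hi
    have hj2 := ediv_modEq_of_modEq hM0 (hj.sub_right (θ : ℤ))
    rw [lepfMatrix_apply hM0, lepfLimit, ← ite_and, hβ]
    refine if_congr ⟨fun h => ⟨?_, ?_⟩, fun ⟨h, h'⟩ => ?_⟩ rfl rfl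
    · have h1 := abs_le.1 (abs_sub_le_of_ediv_eq hM0 h)
      refine abs_le.2 ⟨?_, ?_⟩ <;> linarith
    · exact hi2.trans (h.symm ▸ hj2.symm)
    · obtain ⟨l, hl⟩ := (hi2.symm.trans (h'.trans hj2)).dvd
      have e : (i + M * (m * l)) / M = (j - θ) / M := by
        rw [Int.add_mul_ediv_left _ _ hM']
        linarith
      have h1 := abs_le.1 (abs_sub_le_of_ediv_eq hM0 e)
      rw [abs_le] at h
      -- A group is shorter than the distance that `|i - j| ≤ β` leaves to the next copy of `i`.
      have hl0 : l = 0 := by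
        have hNl : ∀ c : ℤ, 1 ≤ c → (M : ℤ) * m ≤ M * m * c := fun c hc =>
          le_mul_of_one_le_right (by positivity) hc
        by_contra hne
        rcases lt_or_gt_of_ne hne with h0 | h0
        · have := hNl (-l) (by omega)
          nlinarith
        · have := hNl l (by omega)
          nlinarith
      rw [hl0, mul_zero, sub_eq_zero] at hl
      exact hl.symm

theorem lepfMatrix_row_eq {M θ m : ℕ} (i i' : Fin (M * m)) (h : (i : ℤ) / M = (i' : ℤ) / M) :
    lepfMatrix M θ m i = lepfMatrix M θ m i' := by
  ext j
  simp only [lepfMatrix, h]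

theorem ibpfMatrix_eq (M m : ℕ) : ibpfMatrix M m = lepfMatrix M 0 m := by
  ext i j
  have hj : ((j : ℕ) : ℤ) % (M * m : ℕ) = j :=
    Int.emod_eq_of_lt (by positivity) (by exact_mod_cast j.2)
  simp only [ibpfMatrix, lepfMatrix, Nat.cast_zero, sub_zero, hj]

theorem ibpfLimit_eq (M : ℕ) : ibpfLimit M = lepfLimit M 0 := by
  ext i j
  simp only [ibpfLimit, lepfLimit, Nat.cast_zero, sub_zero]

end LocalExchange

namespace LocalExchange

/-! ### Effective sample sizes -/

/-- The inverse effective sample size of the particles is at most that of the groups. -/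
theorem weightRatio_le_sqrt_sum_groupWeight {Y : Type*} {M m : ℕ} (hM : 0 < M)
    {α : Matrix (Fin (M * m)) (Fin (M * m)) ℝ}
    (hrow : ∀ i i' : Fin (M * m), (i : ℤ) / M = (i' : ℤ) / M → α i = α i') (g : ℕ → Y → ℝ)
    (z : ℕ → Fin (M * m) → Y) (n : ℕ) (h0 : ∀ k, 0 ≤ groupWeight hM α g z n k) :
    weightRatio α g z n ≤
      √(∑ k, (groupWeight hM α g z n k / ∑ l, groupWeight hM α g z n l) ^ 2) := by
  have e := fun i k hk => weight_eq_groupWeight hM α hrow g z n i k hk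
  have hT : 0 ≤ ∑ k, groupWeight hM α g z n k := Finset.sum_nonneg fun k _ => h0 k
  have hM1 : (1 : ℝ) ≤ M := by exact_mod_cast hM
  have hs : √(M : ℝ) ≤ M := Real.sqrt_le_iff.2 ⟨by linarith, by nlinarith⟩
  rw [weightRatio, sum_eq_mul_sum_group e,
    sum_eq_mul_sum_group (G := fun k => groupWeight hM α g z n k ^ 2)
      fun i k hk => by rw [e i k hk]]
  simp_rw [div_pow]
  rw [← Finset.sum_div, Real.sqrt_div (Finset.sum_nonneg fun k _ => sq_nonneg _),
    Real.sqrt_sq hT, Real.sqrt_mul (by linarith), mul_div_mul_comm]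
  refine mul_le_of_le_one_left (by positivity) (div_le_one_of_le₀ hs (by linarith))

section ParticleSystem

variable {X : Type*} [MeasurableSpace X] [StandardBorelSpace X] [Nonempty X] {π₀ : Measure X}
  {f : Kernel X X} {g : ℕ → X → ℝ} {C : ℕ → ℝ} {M : ℕ}

/-- By Jensen's inequality, the moment of order `p ≥ 1` controls the mean. -/
theorem IsParticleSystem.sqrt_mul_integral_weightRatio_le {m : ℕ} [NeZero (M * m)] (hM : 0 < M)
    {α : Matrix (Fin (M * m)) (Fin (M * m)) ℝ}
    (hrow : ∀ i i' : Fin (M * m), (i : ℤ) / M = (i' : ℤ) / M → α i = α i')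
    {Ω : Type*} [MeasurableSpace Ω] {P : Measure Ω} [IsProbabilityMeasure P]
    {ζ : ℕ → Ω → Fin (M * m) → X} (hS : IsParticleSystem π₀ f g α P ζ) (hg : IsPotential g C)
    (hα : α ∈ doublyStochastic ℝ (Fin (M * m))) {p : ℝ} (hp : 1 ≤ p) (n : ℕ) {K : ℝ≥0∞}
    (hK : K ≠ ∞) (h : scaledWeightMoment hM α g P ζ p n ≤ K) :
    √m * ∫ ω, weightRatio α g (fun k => ζ k ω) n ∂P ≤ (K ^ (1 / p)).toReal := by
  have hp0 : 0 < p := by linarith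
  set V : Ω → ℝ := fun ω => √(∑ k, (groupWeight hM α g (fun t => ζ t ω) n k /
    ∑ l, groupWeight hM α g (fun t => ζ t ω) n l) ^ 2) with hV
  have hgw : ∀ k, Measurable fun ω => groupWeight hM α g (fun t => ζ t ω) n k := fun k =>
    (measurable_weight hg α n _).comp hS.measurable_path
  have hVm : Measurable V := (Finset.measurable_sum _ fun k _ =>
    ((hgw k).div (Finset.measurable_sum _ fun l _ => hgw l)).pow_const 2).sqrt
  have hle : ∀ ω, weightRatio α g (fun k => ζ k ω) n ≤ V ω := fun ω =>
    weightRatio_le_sqrt_sum_groupWeight hM hrow g _ n fun k => (weight_pos hg hα _ n _).le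
  have hWm : Measurable fun ω => weightRatio α g (fun k => ζ k ω) n :=
    (measurable_weightRatio hg α n).comp hS.measurable_path
  have hjensen := eLpNorm'_le_eLpNorm'_of_exponent_le one_pos hp P hVm.aestronglyMeasurable
  have e1 : ENNReal.ofReal ((m : ℝ) ^ (p / 2)) = ENNReal.ofReal √m ^ p := by
    rw [ENNReal.ofReal_rpow_of_nonneg (Real.sqrt_nonneg _) hp0.le, Real.sqrt_eq_rpow,
      ← Real.rpow_mul (Nat.cast_nonneg m)]
    congr 2
    ring
  have e2 : ∀ ω, ENNReal.ofReal (|V ω| ^ p) = ‖V ω‖ₑ ^ p := fun ω => by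
    rw [← ENNReal.ofReal_rpow_of_nonneg (abs_nonneg _) hp0.le, ← Real.enorm_eq_ofReal_abs]
  have hKp : K ^ (1 / p) ≠ ∞ := ENNReal.rpow_ne_top_of_nonneg (by positivity) hK
  have hbound : ENNReal.ofReal √m * eLpNorm' V p P ≤ K ^ (1 / p) := by
    have hpow : ENNReal.ofReal √m ^ p * ∫⁻ ω, ‖V ω‖ₑ ^ p ∂P ≤ K := by
      rw [← e1, ← lintegral_congr e2]
      exact h
    have h' := ENNReal.rpow_le_rpow hpow (z := 1 / p) (by positivity)
    rwa [ENNReal.mul_rpow_of_nonneg _ _ (by positivity), ← ENNReal.rpow_mul,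
      mul_one_div_cancel hp0.ne', ENNReal.rpow_one] at h'
  have hW : ENNReal.ofReal (∫ ω, weightRatio α g (fun k => ζ k ω) n ∂P) ≤ eLpNorm' V 1 P := by
    rw [ofReal_integral_eq_lintegral_ofReal (integrable_of_bounded hWm (B := 1) fun ω => by
      rw [Real.norm_of_nonneg (weightRatio_nonneg hg hα _ _)]
      exact weightRatio_le_one hg hα _ _) (ae_of_all _ fun ω => weightRatio_nonneg hg hα _ _)]
    simp only [eLpNorm', ENNReal.rpow_one, div_one]
    refine lintegral_mono fun ω => ?_
    rw [Real.enorm_of_nonneg (Real.sqrt_nonneg _)]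
    exact ENNReal.ofReal_le_ofReal (hle ω)
  rw [← ENNReal.ofReal_le_iff_le_toReal hKp, ENNReal.ofReal_mul (Real.sqrt_nonneg _)]
  exact (mul_le_mul_right (hW.trans hjensen) _).trans hbound

variable [IsProbabilityMeasure π₀] [IsMarkovKernel f]
  {β : ℕ} {α : ∀ m : ℕ, Matrix (Fin (M * m)) (Fin (M * m)) ℝ} {αinf : ℤ → ℤ → ℝ}
  {Ω : ℕ → Type*} [∀ m, MeasurableSpace (Ω m)] {P : ∀ m, Measure (Ω m)}
  [∀ m, IsProbabilityMeasure (P m)] {ζ : ∀ m, ℕ → Ω m → Fin (M * m) → X}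

/-- If the asymptotic variances are unbounded, then the weights degenerate: otherwise the stability
estimate would bound the errors, and hence the asymptotic variances. -/
theorem limsup_iSup_scaledWeightMoment_eq_top (hg : IsPotential g C) {φ : X → ℝ}
    (hφ : Measurable φ) {B : ℝ} (hB : ∀ x, |φ x| ≤ B) (hM : 1 < M)
    (hI : IsLocalInteraction M β α αinf)
    (hrow : ∀ (m : ℕ) (i i' : Fin (M * m)), (i : ℤ) / M = (i' : ℤ) / M → α m i = α m i')
    (hS : ∀ m, 1 ≤ m → IsParticleSystem π₀ f g (α m) (P m) (ζ m)) (hmix : Mixing f g)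
    (hlim : limsup (fun n => (asympVar π₀ f g φ M β αinf n : EReal)) atTop = ⊤) {p : ℝ}
    (hp : 1 ≤ p) :
    limsup (fun m : ℕ => ⨆ n : ℕ,
      scaledWeightMoment (zero_lt_one.trans hM) (α m) g (P m) (ζ m) p n) atTop = ⊤ := by
  by_contra hne
  obtain ⟨K, hK1, hK2⟩ := exists_between (lt_top_iff_ne_top.2 hne)
  obtain ⟨δ, ε, hδ, hε, hgδ, hfε⟩ := hmix
  have hB0 : 0 ≤ B := (abs_nonneg _).trans (hB (Classical.arbitrary X))
  set c := (δ * ε) ^ 2 * ε ^ 2 * (2 * B) with hc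
  have hc0 : 0 ≤ c := by positivity
  refine limsup_asympVar_ne_top hg hφ hB hM hI hS le_rfl
    (K := ENNReal.ofReal (c * (K ^ (1 / p)).toReal)) ENNReal.ofReal_ne_top (fun n => ?_) hlim
  refine Eventually.frequently ?_
  filter_upwards [eventually_lt_of_limsup_lt hK1, eventually_ge_atTop 1] with m hm hm1
  have : NeZero (M * m) := ⟨by positivity⟩
  have hm0 : (0 : ℝ) < √m := Real.sqrt_pos.2 (by exact_mod_cast hm1)
  have hα := hI.doubly_stochastic m hm1
  have hR : ∀ n, ∫ ω, weightRatio (α m) g (fun k => ζ m k ω) n ∂(P m) ≤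
      (K ^ (1 / p)).toReal / √m := fun n => by
    rw [le_div_iff₀ hm0, mul_comm]
    exact (hS m hm1).sqrt_mul_integral_weightRatio_le (zero_lt_one.trans hM) (hrow m) hg hα hp n
      hK2.ne ((le_iSup (fun n => scaledWeightMoment (zero_lt_one.trans hM) (α m) g (P m) (ζ m) p n)
        n).trans hm.le)
  refine (mul_le_mul_right
    ((hS m hm1).lpError_one_le hg hα hδ hε hgδ hfε hR hφ hB n) _).trans ?_
  rw [← ENNReal.ofReal_mul hm0.le]
  refine ENNReal.ofReal_le_ofReal (le_of_eq ?_)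
  rw [← hc]
  field_simp

end ParticleSystem

end LocalExchange

theorem proposition4 {X : Type*} [MeasurableSpace X] [StandardBorelSpace X] [Nonempty X]
    -- the filtering model
    (π₀ : Measure X) [IsProbabilityMeasure π₀] (f : Kernel X X) [IsMarkovKernel f]
    (g : ℕ → X → ℝ) (hg_meas : ∀ n, Measurable (g n)) (hg_bdd : ∀ n, ∃ C, ∀ x, g n x ≤ C)
    (hg_pos : ∀ n x, 0 < g n x)
    -- the test function and the group size
    (φ : X → ℝ) (hφ_meas : Measurable φ) (hφ_bdd : ∃ C, ∀ x, |φ x| ≤ C)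
    (M : ℕ) (hM : 1 < M)
    -- for each `m`, a probability space on which the algorithm with `M * m` particles is run
    (Ω : ℕ → Type*) [∀ m, MeasurableSpace (Ω m)] (P : ∀ m, Measure (Ω m))
    [∀ m, IsProbabilityMeasure (P m)] (ζ : ∀ m, ℕ → Ω m → Fin (M * m) → X) :
    -- the general algorithm
    (∀ (β : ℕ) (α : ∀ m : ℕ, Matrix (Fin (M * m)) (Fin (M * m)) ℝ) (αinf : ℤ → ℤ → ℝ),
      LocalExchange.IsLocalInteraction M β α αinf →
      (∀ m, 1 ≤ m → LocalExchange.IsParticleSystem π₀ f g (α m) (P m) (ζ m)) →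
        (∀ n, 0 < LocalExchange.asympVar π₀ f g φ M β αinf n → ∀ p : ℝ, 1 ≤ p →
          Tendsto
            (fun m : ℕ => ENNReal.ofReal √m *
              LocalExchange.lpError π₀ f g (α m) φ (P m) (ζ m) p n)
            atTop
            (𝓝 (ENNReal.ofReal
              (√(LocalExchange.asympVar π₀ f g φ M β αinf n) / √M * √2 *
                (Real.Gamma ((p + 1) / 2) / √Real.pi) ^ (1 / p))))) ∧
        (limsup (fun n => (LocalExchange.asympVar π₀ f g φ M β αinf n : EReal)) atTop = ⊤ →
          ∀ p : ℝ, 1 ≤ p →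
            ¬ (⨆ (m : ℕ) (_ : 1 ≤ m) (n : ℕ), ENNReal.ofReal √m *
              LocalExchange.lpError π₀ f g (α m) φ (P m) (ζ m) p n) < ⊤)) ∧
    -- the LEPF
    (∀ θ : ℕ, 1 ≤ θ → θ ≤ M - 1 → LocalExchange.Mixing f g →
      limsup (fun n => (LocalExchange.asympVar π₀ f g φ M (M - 1 + θ)
        (LocalExchange.lepfLimit M θ) n : EReal)) atTop = ⊤ →
      (∀ m, 1 ≤ m → LocalExchange.IsParticleSystem π₀ f g (LocalExchange.lepfMatrix M θ m)
        (P m) (ζ m)) →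
      ∀ p : ℝ, 1 ≤ p →
        limsup (fun m : ℕ => ⨆ n : ℕ, LocalExchange.scaledWeightMoment (zero_lt_one.trans hM)
          (LocalExchange.lepfMatrix M θ m) g (P m) (ζ m) p n) atTop = ⊤) ∧
    -- the IBPF
    (LocalExchange.Mixing f g →
      limsup (fun n => (LocalExchange.asympVar π₀ f g φ M (M - 1)
        (LocalExchange.ibpfLimit M) n : EReal)) atTop = ⊤ →
      (∀ m, 1 ≤ m → LocalExchange.IsParticleSystem π₀ f g (LocalExchange.ibpfMatrix M m)
        (P m) (ζ m)) →
      ∀ p : ℝ, 1 ≤ p →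
        limsup (fun m : ℕ => ⨆ n : ℕ, LocalExchange.scaledWeightMoment (zero_lt_one.trans hM)
          (LocalExchange.ibpfMatrix M m) g (P m) (ζ m) p n) atTop = ⊤) := by
  choose C hC using hg_bdd
  obtain ⟨B, hB⟩ := hφ_bdd
  have hg : LocalExchange.IsPotential g C := ⟨hg_meas, hg_pos, hC⟩
  refine ⟨fun β α αinf hI hS => ⟨fun n hσ p hp =>
    LocalExchange.tendsto_sqrt_mul_lpError hg hφ_meas hB hM hI hS n hσ hp, fun hlim p hp hK => ?_⟩,
    fun θ _ _ hmix hlim hS p hp => ?_, fun hmix hlim hS p hp => ?_⟩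
  · refine LocalExchange.limsup_asympVar_ne_top hg hφ_meas hB hM hI hS hp hK.ne (fun n => ?_) hlim
    refine Eventually.frequently ?_
    filter_upwards [eventually_ge_atTop 1] with m hm
    exact le_iSup₂_of_le m hm (le_iSup (fun n => ENNReal.ofReal √m *
      LocalExchange.lpError π₀ f g (α m) φ (P m) (ζ m) p n) n)
  · exact LocalExchange.limsup_iSup_scaledWeightMoment_eq_top hg hφ_meas hB hM
      (LocalExchange.isLocalInteraction_lepf hM θ) (fun _ => LocalExchange.lepfMatrix_row_eq) hS
      hmix hlim hp
  · simp only [LocalExchange.ibpfMatrix_eq, LocalExchange.ibpfLimit_eq] at hS hlim ⊢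
    exact LocalExchange.limsup_iSup_scaledWeightMoment_eq_top hg hφ_meas hB hM
      (LocalExchange.isLocalInteraction_lepf hM 0) (fun _ => LocalExchange.lepfMatrix_row_eq) hS
      hmix hlim hp
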